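/- All digraphs are finite and may have loops and parallel arcs. "Planar", "connected", "cubic" (every vertex has degree $3$) and "perfect matching" refer to the underlying undirected multigraph. An *oriented graph* is a digraph in which every directed cycle has length at least $3$. A vertex set is *acyclic* if the subdigraph it induces contains no directed cycle. An *even subgraph* of a digraph $D=(V,A)$ is a set $E\subseteq A$ that is an edge-disjoint union of (not necessarily directed) cycles of $D$, and $D/E$ denotes the digraph obtained from $D$ by contracting the arcs of $E$. A *directed cut* is the set of all arcs between $X$ and $V\setminus X$ for some $\emptyset\ne X\subsetneq V$, provided that all of them are directed from $X$ to $V\setminus X$. A graph is *$3$-connected* if it has more than $3$ vertices and remains connected after the deletion of any at most $2$ vertices; it is *$3$-edge-connected* if it has at least $2$ vertices and remains connected after the deletion of any at most $2$ edges. **Proposition.** 1. The following two statements are equivalent: - (Neumann-Lara) The vertex set of every planar oriented graph can be partitioned into two (possibly empty) acyclic sets. - (Neumann-Lara') Every $3$-connected, cubic, planar digraph has a perfect matching that contains no directed cut. 2. The following two statements are equivalent: - (Hochstättler) Every $3$-edge-connected digraph $D=(V,A)$ has an even subgraph $E\subseteq A$ such that $D/E$ is strongly connected. - (Hochstättler')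 Every $3$-edge-connected, cubic digraph has a perfect matching that contains no directed cut. -/

import Mathlib

/-- A directed multigraph with vertex type `V` and arc type `A`: every arc has a tail `src` and a
head `tgt`. Loops, parallel arcs and antiparallel arcs are allowed. -/
structure MultiDigraph (V A : Type*) where
  /-- The tail of an arc. -/
  src : A → V
  /-- The head of an arc. -/
  tgt : A → V

namespace MultiDigraph

variable {V A : Type*}

/-- There is an arc from `u` to `v`. -/
def Adj (D : MultiDigraph V A) (u v : V) : Prop :=
  ∃ a, D.src a = u ∧ D.tgt a = v

/-- The arc `a` joins `u` and `v`, in one of the two directions. -/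
def Joins (D : MultiDigraph V A) (a : A) (u v : V) : Prop :=
  (D.src a = u ∧ D.tgt a = v) ∨ (D.src a = v ∧ D.tgt a = u)

/-! ### Subgraphs and contraction -/

/-- The subdigraph induced by the vertex set `X`. -/
def induce (D : MultiDigraph V A) (X : Set V) :
    MultiDigraph {v // v ∈ X} {a // D.src a ∈ X ∧ D.tgt a ∈ X} where
  src a := ⟨D.src a.1, a.2.1⟩
  tgt a := ⟨D.tgt a.1, a.2.2⟩

/-- Deletion of a set of vertices (together with all arcs incident with them). -/
def deleteVerts (D : MultiDigraph V A) (S : Set V) :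
    MultiDigraph {v // v ∈ Sᶜ} {a // D.src a ∈ Sᶜ ∧ D.tgt a ∈ Sᶜ} :=
  D.induce Sᶜ

/-- Deletion of a set of arcs. -/
def deleteArcs (D : MultiDigraph V A) (F : Set A) : MultiDigraph V {a // a ∉ F} where
  src a := D.src a.1
  tgt a := D.tgt a.1

/-- The vertex identification made by contracting the arcs of `E`: the equivalence relation
generated by identifying the two ends of every arc of `E`. -/
def contractSetoid (D : MultiDigraph V A) (E : Set A) : Setoid V :=
  Relation.EqvGen.setoid fun u v => ∃ a ∈ E, D.src a = u ∧ D.tgt a = v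

/-- The contraction `D / E`: the ends of the arcs of `E` are identified, and the arcs outside `E`
remain. -/
def contract (D : MultiDigraph V A) (E : Set A) :
    MultiDigraph (Quotient (D.contractSetoid E)) {a // a ∉ E} where
  src a := Quotient.mk (D.contractSetoid E) (D.src a.1)
  tgt a := Quotient.mk (D.contractSetoid E) (D.tgt a.1)

/-! ### Connectivity -/

/-- The equivalence relation whose classes are the connected components of the underlying
undirected graph. -/
def componentSetoid (D : MultiDigraph V A) : Setoid V :=
  Relation.EqvGen.setoid D.Adj

/-- The underlying undirected graph is connected (and non-empty). -/
def IsConnected (D : MultiDigraph V A) : Prop :=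
  Nonempty V ∧ ∀ u v, D.componentSetoid u v

/-- Strong connectivity: there is a directed walk from every vertex to every vertex. -/
def IsStronglyConnected (D : MultiDigraph V A) : Prop :=
  Nonempty V ∧ ∀ u v, Relation.ReflTransGen D.Adj u v

/-- `k`-connectivity of the underlying undirected graph: there are more than `k` vertices, and
deleting fewer than `k` vertices never disconnects the graph. -/
def IsVertexConnected (D : MultiDigraph V A) (k : ℕ) : Prop :=
  k < Nat.card V ∧ ∀ S : Set V, S.ncard < k → (D.deleteVerts S).IsConnected

/-- `k`-edge-connectivity of the underlying undirected graph: there are at least two vertices, and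
deleting fewer than `k` arcs never disconnects the graph. -/
def IsEdgeConnected (D : MultiDigraph V A) (k : ℕ) : Prop :=
  1 < Nat.card V ∧ ∀ F : Set A, F.ncard < k → (D.deleteArcs F).IsConnected

/-! ### Degrees, matchings, cuts -/

/-- The number of ends at `v` of arcs of `F` (a loop counts twice). -/
noncomputable def degreeIn (D : MultiDigraph V A) (F : Set A) (v : V) : ℕ :=
  {a | a ∈ F ∧ D.src a = v}.ncard + {a | a ∈ F ∧ D.tgt a = v}.ncard

/-- Every vertex of the underlying undirected graph has degree three. -/
def IsCubic (D : MultiDigraph V A) : Prop :=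
  ∀ v, D.degreeIn Set.univ v = 3

/-- A perfect matching of the underlying undirected graph: every vertex has degree exactly one
in `M` (so `M` contains no loops). -/
def IsPerfectMatching (D : MultiDigraph V A) (M : Set A) : Prop :=
  ∀ v, D.degreeIn M v = 1

/-- `B` is a directed cut: the set of all arcs between `X` and its complement, for a non-empty
proper vertex subset `X`, where all these arcs are directed from `X` to its complement. -/
def IsDirectedCut (D : MultiDigraph V A) (B : Set A) : Prop :=
  ∃ X : Set V, X.Nonempty ∧ Xᶜ.Nonempty ∧
    (∀ a, ¬ (D.src a ∉ X ∧ D.tgt a ∈ X)) ∧ B = {a | D.src a ∈ X ∧ D.tgt a ∉ X}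

/-- The arc set `M` contains a directed cut of `D`. -/
def ContainsDirectedCut (D : MultiDigraph V A) (M : Set A) : Prop :=
  ∃ B ⊆ M, D.IsDirectedCut B

/-! ### Cycles -/

/-- `D` contains a directed cycle of length `n`: distinct vertices `v 0, …, v (n - 1)`, with arcs
`e i` from `v i` to `v (i + 1)`, where indices are read modulo `n = m + 1`. -/
def HasDirectedCycle (D : MultiDigraph V A) (n : ℕ) : Prop :=
  ∃ m : ℕ, n = m + 1 ∧ ∃ (v : Fin (m + 1) → V) (e : Fin (m + 1) → A),
    Function.Injective v ∧ ∀ i, D.src (e i) = v i ∧ D.tgt (e i) = v (i + 1)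

/-- The length of a shortest directed cycle (`⊤` if there is none). -/
noncomputable def digirth (D : MultiDigraph V A) : ℕ∞ :=
  sInf {k : ℕ∞ | ∃ n : ℕ, D.HasDirectedCycle n ∧ k = n}

/-- An oriented graph is a digraph of digirth at least three. -/
def IsOriented (D : MultiDigraph V A) : Prop :=
  3 ≤ D.digirth

/-- The vertex set `X` is acyclic: the subdigraph induced by `X` contains no directed cycle. -/
def IsAcyclicSet (D : MultiDigraph V A) (X : Set V) : Prop :=
  ∀ n, ¬ (D.induce X).HasDirectedCycle n

/-- `C` is the arc set of a cycle of the underlying undirected graph: there are distinct vertices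
`v 0, …, v (n - 1)` and distinct arcs `e 0, …, e (n - 1)`, with `e i` joining `v i` and `v (i + 1)`
in any direction, where indices are read modulo `n = m + 1`. A loop is a cycle of length one, and
two distinct arcs joining the same two distinct vertices form a cycle of length two. -/
def IsCycle (D : MultiDigraph V A) (C : Set A) : Prop :=
  ∃ (m : ℕ) (v : Fin (m + 1) → V) (e : Fin (m + 1) → A),
    Function.Injective v ∧ Function.Injective e ∧
      (∀ i, D.Joins (e i) (v i) (v (i + 1))) ∧ Set.range e = C

/-- An even subgraph: an edge-disjoint union of (not necessarily directed) cycles. -/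
def IsEvenSubgraph (D : MultiDigraph V A) (E : Set A) : Prop :=
  ∃ 𝒞 : Set (Set A), (∀ C ∈ 𝒞, D.IsCycle C) ∧ 𝒞.PairwiseDisjoint id ∧ ⋃₀ 𝒞 = E

/-! ### Planarity

Embeddings of a finite graph in closed oriented surfaces are described, as usual, by rotation
systems: a cyclic order of the arc-ends around each vertex. The faces are obtained by face tracing,
and a connected graph is drawn in the sphere (equivalently, the plane) when the Euler characteristic
`#V - #A + #F` is two. -/

/-- The vertex at which an arc-end lies: `(a, false)` is the tail end of `a`, and `(a, true)` is
its head end. -/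
def endVertex (D : MultiDigraph V A) (d : A × Bool) : V :=
  if d.2 then D.tgt d.1 else D.src d.1

/-- The involution exchanging the two ends of every arc. -/
def flipEnd (A : Type*) : Equiv.Perm (A × Bool) where
  toFun d := (d.1, !d.2)
  invFun d := (d.1, !d.2)
  left_inv d := by simp
  right_inv d := by simp

/-- `σ` is a rotation system: it permutes the arc-ends at each vertex in a single cycle. -/
def IsRotationSystem (D : MultiDigraph V A) (σ : Equiv.Perm (A × Bool)) : Prop :=
  ∀ d d', σ.SameCycle d d' ↔ D.endVertex d = D.endVertex d'

/-- The number of faces traced by a rotation system `σ`: the number of cycles of the permutation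
that runs along an arc to its other end and then takes the next arc-end in the rotation there. -/
noncomputable def faceCount (σ : Equiv.Perm (A × Bool)) : ℕ :=
  Nat.card (Quotient (Equiv.Perm.SameCycle.setoid (σ * flipEnd A)))

/-- Planarity of a finite graph: there is a rotation system of genus zero, i.e. one for which every
connected component has Euler characteristic two. As the Euler characteristic of a component
never exceeds two, it suffices to ask this of their sum. Face tracing runs along arcs and so
does not see the one face of a component that consists of an isolated vertex; hence the number of
isolated vertices is added to the number of faces. -/
def IsPlanar (D : MultiDigraph V A) : Prop :=
  ∃ σ : Equiv.Perm (A × Bool), D.IsRotationSystem σ ∧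
    Nat.card V + (faceCount σ + {v | ∀ a, D.src a ≠ v ∧ D.tgt a ≠ v}.ncard) =
      Nat.card A + 2 * Nat.card (Quotient D.componentSetoid)

end MultiDigraph

/-! Planar duality enters as linear algebra. Let a connected digraph be drawn in the sphere. Its
tensions (differences of a vertex potential along arcs) are orthogonal to those of its dual, and by
Euler's formula the two dimensions add up to the number of arcs. So each space is the orthogonal
complement of the other (`exists_coboundary_of_orthogonal`). Over `ℚ`, a directed closed walk of the
dual is a non-negative circulation, hence a tension of the primal, and the arcs leaving the minimum
set of its potential form a directed cut; conversely, each arc of a directed cut is followed in the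
dual by another arc of that cut. Over `ZMod 2`, even subgraphs are the sets of colour changes of
2-colourings of the faces.

In a cubic plane digraph the complement of a perfect matching has all degrees two, hence is even. A
perfect matching is therefore the set of arcs joining equal colours in a 2-colouring of the dual
triangulation without monochromatic triangle, and it contains no directed cut exactly when no
directed cycle of the dual is monochromatic. Two gaps remain in (1). From colourings to matchings,
monochromatic triangles must be excluded: an octahedron with suitable orientation is inserted into
each triangle of the dual (`octa_not_monochromatic`). From matchings to colourings, a planar
oriented graph must be placed in a simple triangulation: components are joined by bridges, one arc
per parallel class is kept and the others are flipped, and every face is filled with a cycle and a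
centre. Simplicity makes the dual 3-edge-connected (`IsDualPair.isEdgeConnected_of_simple`), and a
3-edge-connected cubic graph on more than three vertices is 3-connected
(`IsCubic.isVertexConnected`).

For (2), `D/E` is strongly connected if and only if no directed cut avoids `E`
(`isStronglyConnected_contract_iff`). Both directions use one cubic expansion: every vertex becomes
a prism whose rungs are subdivided, and each original arc is attached to subdividing vertices. Even
subgraphs of the expansion restrict to even subgraphs of `D`, and directed cuts of `D` lift. The
subdividing vertices are sources or sinks, so an even subgraph with strongly connected contraction
covers them all; at a cubic vertex a parity count then forces degree two in the restriction, and its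
complement is a perfect matching. -/

namespace MultiDigraph

variable {V A F Δ W : Type*}

/-! ### Edge cuts and connectivity -/

/-- The arcs with exactly one end in `X`. -/
def cut (D : MultiDigraph V A) (X : Set V) : Set A :=
  {a | ¬ (D.src a ∈ X ↔ D.tgt a ∈ X)}

theorem cut_compl (D : MultiDigraph V A) (X : Set V) : D.cut Xᶜ = D.cut X := by
  ext a
  simp only [cut, Set.mem_ofPred_eq, Set.mem_compl_iff]
  tauto

theorem mem_iff_of_component (D : MultiDigraph V A) (X : Set V)
    (h : ∀ a, D.src a ∈ X ↔ D.tgt a ∈ X) {u v : V} (huv : D.componentSetoid u v) :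
    u ∈ X ↔ v ∈ X := by
  change Relation.EqvGen D.Adj u v at huv
  induction huv with
  | rel x y hxy => obtain ⟨a, rfl, rfl⟩ := hxy; exact h a
  | refl x => rfl
  | symm x y _ ih => exact ih.symm
  | trans x y z _ _ ih₁ ih₂ => exact ih₁.trans ih₂

theorem component_src_tgt (D : MultiDigraph V A) (a : A) :
    D.componentSetoid (D.src a) (D.tgt a) :=
  Relation.EqvGen.rel _ _ ⟨a, rfl, rfl⟩

theorem isConnected_iff_cut (D : MultiDigraph V A) :
    D.IsConnected ↔ Nonempty V ∧
      ∀ X : Set V, X.Nonempty → Xᶜ.Nonempty → (D.cut X).Nonempty := by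
  constructor
  · rintro ⟨hV, h⟩
    refine ⟨hV, fun X ⟨x, hx⟩ ⟨y, hy⟩ => ?_⟩
    by_contra hne
    rw [Set.not_nonempty_iff_eq_empty] at hne
    have := D.mem_iff_of_component X (fun a => by
      by_contra ha
      exact (hne ▸ (show a ∈ D.cut X from ha) : a ∈ (∅ : Set A))) (h x y)
    exact hy (this.1 hx)
  · rintro ⟨hV, h⟩
    refine ⟨hV, fun u v => ?_⟩
    by_contra huv
    obtain ⟨a, ha⟩ := h {w | D.componentSetoid u w} ⟨u, D.componentSetoid.refl u⟩ ⟨v, huv⟩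
    refine ha ⟨fun h1 => ?_, fun h1 => ?_⟩
    · exact D.componentSetoid.trans h1 (D.component_src_tgt a)
    · exact D.componentSetoid.trans h1 (D.componentSetoid.symm (D.component_src_tgt a))

theorem isEdgeConnected_iff_cut [Finite A] (D : MultiDigraph V A) {k : ℕ} :
    D.IsEdgeConnected k ↔ 1 < Nat.card V ∧
      ∀ X : Set V, X.Nonempty → Xᶜ.Nonempty → k ≤ (D.cut X).ncard := by
  refine and_congr_right fun hV => ?_
  have hne : Nonempty V := by
    by_contra hne
    rw [not_nonempty_iff] at hne
    simp at hV
  constructor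
  · intro h X hX hX'
    by_contra! hlt
    obtain ⟨a, ha⟩ := ((isConnected_iff_cut _).1 (h _ hlt)).2 X hX hX'
    exact a.2 ha
  · intro h F hF
    rw [isConnected_iff_cut]
    refine ⟨hne, fun X hX hX' => ?_⟩
    by_contra hcon
    have hsub : D.cut X ⊆ F := by
      intro a ha
      by_contra haF
      exact hcon ⟨⟨a, haF⟩, ha⟩
    have := h X hX hX'
    have := Set.ncard_le_ncard hsub
    omega

theorem three_le_ncard {α : Type*} [Finite α] {S : Set α} {a b c : α} (ha : a ∈ S) (hb : b ∈ S)
    (hc : c ∈ S) (hab : a ≠ b) (hac : a ≠ c) (hbc : b ≠ c) : 3 ≤ S.ncard := by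
  classical
  have : ({a, b, c} : Set α) ⊆ S := by
    rintro x (rfl | rfl | rfl) <;> assumption
  calc 3 = ({a, b, c} : Set α).ncard := by
        rw [Set.ncard_eq_three.2 ⟨a, b, c, hab, hac, hbc, rfl⟩]
    _ ≤ _ := Set.ncard_le_ncard this

theorem exists_three_of_le_ncard {α : Type*} {S : Set α} (h : 3 ≤ S.ncard) :
    ∃ a ∈ S, ∃ b ∈ S, ∃ c ∈ S, a ≠ b ∧ a ≠ c ∧ b ≠ c := by
  obtain ⟨t, ht, h3⟩ := Set.exists_subset_card_eq h
  obtain ⟨a, b, c, hab, hac, hbc, rfl⟩ := Set.ncard_eq_three.1 h3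
  exact ⟨a, ht (by simp), b, ht (by simp), c, ht (by simp), hab, hac, hbc⟩

/-! ### Directed cycles -/

/-- A non-empty arc set in which every arc is followed by another one contains a directed
cycle. -/
theorem exists_hasDirectedCycle [Finite V] (D : MultiDigraph V A) (B : Set A)
    (hB : B.Nonempty) (hf : ∀ a ∈ B, ∃ b ∈ B, D.src b = D.tgt a) :
    ∃ n, D.HasDirectedCycle n := by
  classical
  let W := {w : V // ∃ a ∈ B, D.src a = w}
  choose out hout hsrc using fun w : W => w.2
  let next : W → W := fun w => ⟨D.tgt (out w), by
    obtain ⟨b, hb, hbs⟩ := hf (out w) (hout w); exact ⟨b, hb, hbs⟩⟩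
  obtain ⟨b₀, hb₀⟩ := hB
  let w₀ : W := ⟨D.src b₀, b₀, hb₀, rfl⟩
  have : Finite W := inferInstance
  obtain ⟨i, j, hij, he⟩ := Finite.exists_ne_map_eq_of_infinite (fun n : ℕ => next^[n] w₀)
  wlog hlt : i < j generalizing i j
  · exact this j i hij.symm he.symm (by omega)
  let w := next^[i] w₀
  have hper : Function.IsPeriodicPt next (j - i) w := by
    change next^[j - i] (next^[i] w₀) = next^[i] w₀
    rw [← Function.iterate_add_apply, Nat.sub_add_cancel hlt.le]
    exact he.symm
  have hpos : 0 < Function.minimalPeriod next w :=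
    hper.minimalPeriod_pos (by omega)
  obtain ⟨m, hm⟩ : ∃ m, Function.minimalPeriod next w = m + 1 :=
    ⟨_, (Nat.succ_pred_eq_of_pos hpos).symm⟩
  refine ⟨m + 1, m, rfl, fun k => (next^[k.1] w).1, fun k => out (next^[k.1] w), ?_, ?_⟩
  · intro k l hkl
    have h1 : next^[k.1] w = next^[l.1] w := Subtype.ext hkl
    have := Function.iterate_injOn_Iio_minimalPeriod (f := next) (x := w)
      (by rw [hm]; exact k.2) (by rw [hm]; exact l.2) h1
    exact Fin.ext this
  · intro k
    refine ⟨hsrc _, ?_⟩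
    have h1 : D.tgt (out (next^[k.1] w)) = (next^[k.1 + 1] w).1 := by
      rw [Function.iterate_succ_apply']
    rw [h1]
    by_cases hk : k.1 = m
    · have : k = Fin.last m := Fin.ext hk
      subst this
      simp only [Fin.val_last, Fin.last_add_one, Fin.val_zero, Function.iterate_zero, id]
      -- The last arc closes the cycle because `m + 1` is the minimal period of `w`.
      rw [← hm, Function.iterate_minimalPeriod]
    · have hk' : k < Fin.last m := Fin.lt_def.2 (by have := k.2; simp; omega)
      simp only [Fin.val_add_one_of_lt hk']

theorem not_isAcyclicSet [Finite V] (D : MultiDigraph V A) (X : Set V) (B : Set A)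
    (hB : B.Nonempty) (hX : ∀ a ∈ B, D.src a ∈ X)
    (hf : ∀ a ∈ B, ∃ b ∈ B, D.src b = D.tgt a) : ¬ D.IsAcyclicSet X := by
  intro hac
  have htX : ∀ a ∈ B, D.tgt a ∈ X := fun a ha => by
    obtain ⟨b, hb, h⟩ := hf a ha
    exact h ▸ hX b hb
  obtain ⟨n, hn⟩ := exists_hasDirectedCycle (D.induce X) {a | a.1 ∈ B}
    (by obtain ⟨b, hb⟩ := hB; exact ⟨⟨b, hX b hb, htX b hb⟩, hb⟩)
    (by
      rintro ⟨a, ha⟩ haB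
      obtain ⟨b, hb, h⟩ := hf a haB
      exact ⟨⟨b, hX b hb, htX b hb⟩, hb, Subtype.ext h⟩)
  exact hac n hn

theorem isOriented_iff (D : MultiDigraph V A) :
    D.IsOriented ↔ ∀ n, D.HasDirectedCycle n → 3 ≤ n := by
  unfold IsOriented digirth
  rw [le_sInf_iff]
  constructor
  · intro h n hn
    exact_mod_cast h n ⟨n, hn, rfl⟩
  · rintro h _ ⟨n, hn, rfl⟩
    exact_mod_cast h n hn

theorem isOriented_iff_arcs (D : MultiDigraph V A) :
    D.IsOriented ↔ (∀ a, D.src a ≠ D.tgt a) ∧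
      ∀ a b, D.tgt a = D.src b → D.tgt b = D.src a → False := by
  rw [isOriented_iff]
  constructor
  · intro h
    have hl : ∀ a, D.src a ≠ D.tgt a := by
      intro a ha
      have := h 1 ⟨0, rfl, fun _ => D.src a, fun _ => a,
        fun i j _ => by omega, fun _ => ⟨rfl, ha.symm⟩⟩
      omega
    refine ⟨hl, fun a b hab hba => ?_⟩
    have := h 2 ⟨1, rfl, ![D.src a, D.src b], ![a, b], ?_, ?_⟩
    · omega
    · intro i j hij
      fin_cases i <;> fin_cases j <;> simp at hij ⊢
      · exact hl a (hij.trans hab.symm)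
      · exact hl a (hij.symm.trans hab.symm)
    · intro i
      fin_cases i <;> simp [hab, hba]
  · rintro ⟨h1, h2⟩ n ⟨m, rfl, v, e, hv, he⟩
    by_contra! hlt
    have hm : m = 0 ∨ m = 1 := by omega
    rcases hm with rfl | rfl
    · have := he 0
      exact h1 (e 0) (by rw [this.1, this.2]; congr 1)
    · have h0 := he 0
      have h1' := he 1
      exact h2 (e 0) (e 1) (by rw [h0.2, h1'.1]; rfl) (by rw [h1'.2, h0.1]; rfl)

/-! ### Degrees -/

/-- The ends at `v` of the arcs of `F`. -/
def endsIn (D : MultiDigraph V A) (F : Set A) (v : V) : Set (A × Bool) :=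
  {d | d.1 ∈ F ∧ D.endVertex d = v}

theorem degreeIn_eq_ncard [Finite A] (D : MultiDigraph V A) (F : Set A) (v : V) :
    D.degreeIn F v = (D.endsIn F v).ncard := by
  have h : D.endsIn F v = (fun a => (a, false)) '' {a | a ∈ F ∧ D.src a = v} ∪
      (fun a => (a, true)) '' {a | a ∈ F ∧ D.tgt a = v} := by
    ext ⟨a, b⟩
    cases b <;> simp [endsIn, endVertex]
  rw [h, Set.ncard_union_eq, Set.ncard_image_of_injective, Set.ncard_image_of_injective]
  · rfl
  · intro a b h; simpa using h
  · intro a b h; simpa using h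
  · rw [Set.disjoint_left]
    rintro _ ⟨a, _, rfl⟩ ⟨b, _, h⟩
    simp at h

theorem degreeIn_compl_add [Finite A] (D : MultiDigraph V A) (F : Set A) (v : V) :
    D.degreeIn F v + D.degreeIn Fᶜ v = D.degreeIn Set.univ v := by
  simp only [degreeIn_eq_ncard]
  rw [← Set.ncard_union_eq]
  · congr 1
    ext d
    simp only [endsIn, Set.mem_union, Set.mem_ofPred_eq, Set.mem_compl_iff, Set.mem_univ]
    tauto
  · rw [Set.disjoint_left]
    rintro d ⟨h, _⟩ ⟨h', _⟩
    exact h' h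

/-! ### Potentials and flows -/

/-- The tension of a potential. -/
def coboundary (K : Type*) [Field K] (D : MultiDigraph V A) : (V → K) →ₗ[K] (A → K) where
  toFun π a := π (D.tgt a) - π (D.src a)
  map_add' x y := by ext a; simp; ring
  map_smul' c x := by ext a; simp; ring

theorem coboundary_apply {K : Type*} [Field K] (D : MultiDigraph V A) (π : V → K) (a : A) :
    D.coboundary K π a = π (D.tgt a) - π (D.src a) := rfl

theorem finrank_range_coboundary [Fintype V] {K : Type*} [Field K] (D : MultiDigraph V A)
    (hD : D.IsConnected) :
    Module.finrank K (LinearMap.range (D.coboundary K)) + 1 = Nat.card V := by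
  have hker : LinearMap.ker (D.coboundary K) = Submodule.span K {fun _ => (1 : K)} := by
    ext π
    rw [LinearMap.mem_ker, Submodule.mem_span_singleton]
    constructor
    · intro h
      obtain ⟨v₀⟩ := hD.1
      refine ⟨π v₀, ?_⟩
      ext v
      have := D.mem_iff_of_component {w | π w = π v₀} (fun a => by
        have := congrFun h a
        simp only [coboundary_apply, Pi.zero_apply, sub_eq_zero] at this
        simp [this]) (hD.2 v₀ v)
      simpa using (this.1 rfl).symm
    · rintro ⟨c, rfl⟩
      ext a
      simp [coboundary_apply]
  have h1 : Module.finrank K (LinearMap.ker (D.coboundary K)) = 1 := by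
    rw [hker]
    obtain ⟨v₀⟩ := hD.1
    exact finrank_span_singleton (fun h => one_ne_zero (congrFun h v₀))
  have := (D.coboundary K).finrank_range_add_finrank_ker
  rw [h1, Module.finrank_pi] at this
  rw [this, Nat.card_eq_fintype_card]

/-- The tension spaces have dimensions `|V| - 1` and `|F| - 1`, which sum to `|A|` by `hcard`. Being
orthogonal, they are orthogonal complements for the standard bilinear form, over any field and
without topology. -/
theorem exists_coboundary_of_orthogonal [Finite V] [Fintype A] [Finite F] {K : Type*} [Field K]
    (D : MultiDigraph V A) (D' : MultiDigraph F A) (hD : D.IsConnected) (hD' : D'.IsConnected)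
    (hcard : Nat.card V + Nat.card F = Nat.card A + 2)
    (horth : ∀ π ρ, ∑ a, D.coboundary K π a * D'.coboundary K ρ a = 0)
    (g : A → K) (hg : ∀ ρ, ∑ a, g a * D'.coboundary K ρ a = 0) :
    ∃ π, g = D.coboundary K π := by
  classical
  have := Fintype.ofFinite V
  have := Fintype.ofFinite F
  let B : LinearMap.BilinForm K (A → K) := Matrix.toBilin' (1 : Matrix A A K)
  have hBapp : ∀ x y, B x y = ∑ a, x a * y a := by
    intro x y
    simp [B, Matrix.toBilin'_apply', dotProduct]
  have hBn : B.Nondegenerate := by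
    refine ⟨fun x hx => ?_, fun x hx => ?_⟩
    · ext a
      simpa [hBapp, Pi.single_apply] using hx (Pi.single a 1)
    · ext a
      simpa [hBapp, Pi.single_apply] using hx (Pi.single a 1)
  have hBr : B.IsRefl := by
    intro x y h
    rw [hBapp] at h ⊢
    rw [← h]
    exact Finset.sum_congr rfl fun a _ => mul_comm _ _
  have hle : LinearMap.range (D.coboundary K) ≤
      B.orthogonal (LinearMap.range (D'.coboundary K)) := by
    rintro _ ⟨π, rfl⟩ _ ⟨ρ, rfl⟩
    apply hBr
    rw [hBapp]
    exact horth π ρ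
  have heq := Submodule.eq_of_le_of_finrank_eq hle (by
    have h1 := D.finrank_range_coboundary (K := K) hD
    have h2 := D'.finrank_range_coboundary (K := K) hD'
    have h3 := LinearMap.BilinForm.finrank_orthogonal hBn (LinearMap.range (D'.coboundary K))
    rw [Module.finrank_pi, ← Nat.card_eq_fintype_card] at h3
    have := h3
    omega)
  have hmem : g ∈ B.orthogonal (LinearMap.range (D'.coboundary K)) := by
    rintro _ ⟨ρ, rfl⟩
    apply hBr
    rw [hBapp]
    exact hg ρ
  rw [← heq] at hmem
  obtain ⟨π, hπ⟩ := hmem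
  exact ⟨π, hπ.symm⟩

/-- A sum over arcs of differences is a signed sum over the ends of arcs. -/
theorem sum_mul_coboundary [Fintype A] {K : Type*} [Field K] (D : MultiDigraph V A)
    (w : A → K) (π : V → K) :
    ∑ a, w a * D.coboundary K π a =
      -∑ d : A × Bool, (if d.2 then -1 else 1) * w d.1 * π (D.endVertex d) := by
  rw [Fintype.sum_prod_type, ← Finset.sum_neg_distrib]
  refine Finset.sum_congr rfl fun a _ => ?_
  simp [coboundary_apply, endVertex]
  ring

/-- Tensions of a digraph are orthogonal to tensions of its dual. -/
theorem sum_coboundary_mul_coboundary [Fintype A] {K : Type*} [Field K]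
    (D : MultiDigraph V A) (D' : MultiDigraph F A) {σ : Equiv.Perm (A × Bool)}
    (hσ : ∀ d, D.endVertex (σ d) = D.endVertex d)
    (hσ' : ∀ d, D'.endVertex (σ (flipEnd A d)) = D'.endVertex d) (π : V → K) (ρ : F → K) :
    ∑ a, D.coboundary K π a * D'.coboundary K ρ a = 0 := by
  rw [sum_mul_coboundary, neg_eq_zero]
  have h1 : ∀ d : A × Bool, (if d.2 then -1 else 1) * D.coboundary K π d.1 *
      ρ (D'.endVertex d) = π (D.endVertex (flipEnd A d)) * ρ (D'.endVertex d) -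
        π (D.endVertex d) * ρ (D'.endVertex d) := by
    rintro ⟨a, b⟩
    cases b <;> simp [coboundary_apply, endVertex, flipEnd] <;> ring
  rw [Finset.sum_congr rfl fun d _ => h1 d, Finset.sum_sub_distrib, sub_eq_zero]
  -- Running along an arc and then turning keeps the face of `d` and leads to the vertex of `flipEnd
  -- A d`, so this reindexing turns one sum into the other.
  rw [← Equiv.sum_comp ((flipEnd A).trans σ) (fun d => π (D.endVertex d) * ρ (D'.endVertex d))]
  refine Finset.sum_congr rfl fun d _ => ?_
  simp [hσ, hσ']

/-! ### Dual pairs -/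

/-- `D` is a connected digraph, drawn in the sphere by the rotation system `σ`, and `D'` is its
dual. -/
structure IsDualPair (D : MultiDigraph V A) (D' : MultiDigraph F A) (σ : Equiv.Perm (A × Bool)) :
    Prop where
  endVertex_rot : ∀ d, D.endVertex (σ d) = D.endVertex d
  endVertex_face : ∀ d, D'.endVertex (σ (flipEnd A d)) = D'.endVertex d
  connected : D.IsConnected
  dual_connected : D'.IsConnected
  euler : Nat.card V + Nat.card F = Nat.card A + 2

theorem flipEnd_flipEnd (d : A × Bool) : flipEnd A (flipEnd A d) = d := by
  simp [flipEnd]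

namespace IsDualPair

variable {D : MultiDigraph V A} {D' : MultiDigraph F A} {σ : Equiv.Perm (A × Bool)}

theorem exists_potential [Finite V] [Fintype A] [Finite F] (h : IsDualPair D D' σ) {K : Type*}
    [Field K] (g : A → K) (hg : ∀ ρ, ∑ a, g a * D'.coboundary K ρ a = 0) :
    ∃ π, g = D.coboundary K π :=
  exists_coboundary_of_orthogonal D D' h.connected h.dual_connected h.euler
    (sum_coboundary_mul_coboundary D D' h.endVertex_rot h.endVertex_face) g hg

theorem exists_dual_potential [Finite V] [Fintype A] [Finite F] (h : IsDualPair D D' σ)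
    {K : Type*} [Field K] (g : A → K) (hg : ∀ π, ∑ a, g a * D.coboundary K π a = 0) :
    ∃ ρ, g = D'.coboundary K ρ :=
  exists_coboundary_of_orthogonal D' D h.dual_connected h.connected
    (by rw [add_comm]; exact h.euler)
    (fun ρ π => by
      rw [← sum_coboundary_mul_coboundary D D' h.endVertex_rot h.endVertex_face π ρ]
      exact Finset.sum_congr rfl fun a _ => mul_comm _ _) g hg

/-- A non-zero non-negative circulation of the dual contains a directed cut. -/
theorem exists_isDirectedCut [Finite V] [Fintype A] [Finite F] (h : IsDualPair D D' σ)
    (g : A → ℚ) (hg0 : ∀ a, 0 ≤ g a) (hne : ∃ a, g a ≠ 0)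
    (hg : ∀ ρ, ∑ a, g a * D'.coboundary ℚ ρ a = 0) :
    D.ContainsDirectedCut {a | g a ≠ 0} := by
  obtain ⟨π, rfl⟩ := h.exists_potential g hg
  have := h.connected.1
  obtain ⟨v, hv⟩ := Finite.exists_min π
  -- The minimum set of the potential: no arc enters it, since its tension would be negative, and
  -- every arc leaving it has positive tension.
  refine ⟨_, ?_, {u | π u = π v}, ⟨v, rfl⟩, ?_, ?_, rfl⟩
  · rintro a ⟨h1, h2⟩
    simp only [Set.mem_ofPred_eq, coboundary_apply] at *
    rw [h1]
    exact fun h3 => h2 (sub_eq_zero.1 h3)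
  · by_contra hcon
    rw [Set.not_nonempty_iff_eq_empty, Set.compl_empty_iff] at hcon
    have hc : ∀ u, π u = π v := fun u => by
      have : u ∈ {u | π u = π v} := hcon ▸ Set.mem_univ u
      exact this
    obtain ⟨a, ha⟩ := hne
    exact ha (by simp [coboundary_apply, hc])
  · rintro a ⟨h1, h2⟩
    simp only [Set.mem_ofPred_eq] at h1 h2
    have h3 := hg0 a
    have h4 := hv (D.src a)
    rw [coboundary_apply, h2] at h3
    exact h1 (le_antisymm (by linarith) h4)

/-- The arcs of a directed cut form a set of arcs of the dual in which each arc is followed by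
another one. -/
theorem exists_next_of_isDirectedCut [Finite A] (h : IsDualPair D D' σ)
    {B : Set A} (hB : D.IsDirectedCut B) (a : A) (ha : a ∈ B) :
    ∃ b ∈ B, D'.src b = D'.tgt a := by
  classical
  have := Fintype.ofFinite A
  obtain ⟨X, -, -, hX, rfl⟩ := hB
  -- The tension of the cut is paired with the tension of the indicator of the dual vertex `D'.tgt
  -- a`. If no arc of the cut left that vertex, all terms would be non-negative and that of `a`
  -- positive.
  have horth := sum_coboundary_mul_coboundary (K := ℚ) D D' h.endVertex_rot h.endVertex_face
    (fun v => if v ∈ X then 0 else 1) (fun f => if f = D'.tgt a then 1 else 0)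
  by_contra! hcon
  have hpos : 0 < ∑ b, D.coboundary ℚ (fun v => if v ∈ X then 0 else 1) b *
      D'.coboundary ℚ (fun f => if f = D'.tgt a then 1 else 0) b := by
    have hs : ∀ b, D.src b ∈ X → D.tgt b ∉ X → ¬ D'.src b = D'.tgt a := fun b h1 h2 =>
      hcon b ⟨h1, h2⟩
    refine Finset.sum_pos' (fun b _ => ?_) ⟨a, Finset.mem_univ _, ?_⟩
    · have := hX b
      have := hs b
      simp only [coboundary_apply]
      by_cases h1 : D.src b ∈ X <;> by_cases h2 : D.tgt b ∈ X
      · simp [h1, h2]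
      · simp only [h1, h2, hs b h1 h2, if_true, if_false]
        split_ifs <;> norm_num
      · exact absurd ⟨h1, h2⟩ (hX b)
      · simp [h1, h2]
    · simp only [coboundary_apply]
      simp [ha.1, ha.2, hs a ha.1 ha.2]
  exact hpos.ne' horth

end IsDualPair

/-! ### Cuts and vertex connectivity -/

theorem not_isConnected_deleteVerts (D : MultiDigraph V A) (S X : Set V)
    (hX : (X \ S).Nonempty) (hX' : (Xᶜ \ S).Nonempty)
    (hS : ∀ a ∈ D.cut X, D.src a ∈ S ∨ D.tgt a ∈ S) : ¬ (D.deleteVerts S).IsConnected := by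
  intro hcon
  obtain ⟨x, hx, hxS⟩ := hX
  obtain ⟨y, hy, hyS⟩ := hX'
  obtain ⟨⟨a, ha⟩, haX⟩ := ((isConnected_iff_cut _).1 hcon).2 {v | v.1 ∈ X}
    ⟨⟨x, hxS⟩, hx⟩ ⟨⟨y, hyS⟩, hy⟩
  rcases hS a haX with h | h
  · exact ha.1 h
  · exact ha.2 h

theorem exists_subset_pair {α : Type*} [Finite α] {S : Set α} (hS : S.Nonempty)
    (h : S.ncard < 3) : ∃ a ∈ S, ∃ b ∈ S, S ⊆ {a, b} := by
  have h0 := (Set.ncard_pos (Set.toFinite S)).2 hS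
  rcases (show S.ncard = 1 ∨ S.ncard = 2 by omega) with h | h
  · obtain ⟨a, rfl⟩ := Set.ncard_eq_one.1 h
    exact ⟨a, by simp, a, by simp, by simp⟩
  · obtain ⟨a, b, -, rfl⟩ := Set.ncard_eq_two.1 h
    exact ⟨a, by simp, b, by simp, le_rfl⟩

theorem exists_end_mem_of_mem_cut {D : MultiDigraph V A} {X : Set V} {a : A} (ha : a ∈ D.cut X) :
    ∃ v ∈ X, D.src a = v ∨ D.tgt a = v := by
  simp only [cut, Set.mem_ofPred_eq] at ha
  by_cases h : D.src a ∈ X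
  · exact ⟨_, h, Or.inl rfl⟩
  · exact ⟨D.tgt a, by tauto, Or.inr rfl⟩

/-- A cut with at most two arcs is destroyed by deleting one end of each of them. The ends are
chosen so that a vertex survives on both sides, which is possible with at least four vertices. -/
theorem IsVertexConnected.isEdgeConnected [Finite V] [Finite A] {D : MultiDigraph V A}
    (h : D.IsVertexConnected 3) : D.IsEdgeConnected 3 := by
  rw [isEdgeConnected_iff_cut]
  refine ⟨by have := h.1; omega, fun X hX hX' => ?_⟩
  by_contra! hlt
  wlog hle : Xᶜ.ncard ≤ X.ncard generalizing X
  · refine this Xᶜ hX' (by rwa [compl_compl]) (by rwa [cut_compl]) ?_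
    rw [compl_compl]; omega
  have hsum := Set.ncard_add_ncard_compl X
  have hcard := h.1
  rcases (D.cut X).eq_empty_or_nonempty with he | hne
  · refine not_isConnected_deleteVerts D ∅ X (by simpa) (by simpa) ?_ (h.2 ∅ (by simp))
    simp [he]
  obtain ⟨a, ha, b, hb, hab⟩ := exists_subset_pair hne hlt
  obtain ⟨xa, hxa, hxa'⟩ := exists_end_mem_of_mem_cut ha
  have hpair : ∀ x y : V, ({x, y} : Set V).ncard < 3 := fun x y =>
    (Set.ncard_insert_le x {y}).trans_lt (by simp)
  by_cases h3 : 3 ≤ X.ncard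
  · obtain ⟨xb, hxb, hxb'⟩ := exists_end_mem_of_mem_cut hb
    refine not_isConnected_deleteVerts D {xa, xb} X ?_ ?_ ?_ (h.2 _ (hpair _ _))
    · by_contra hcon
      rw [Set.not_nonempty_iff_eq_empty, Set.sdiff_eq_empty] at hcon
      have := Set.ncard_le_ncard hcon
      have := hpair xa xb
      omega
    · obtain ⟨y, hy⟩ := hX'
      refine ⟨y, hy, ?_⟩
      rintro (rfl | rfl) <;> exact hy (by assumption)
    · intro c hc
      rcases hab hc with rfl | rfl
      · rcases hxa' with h | h <;> simp [h]
      · rcases hxb' with h | h <;> simp [h]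
  -- Here both sides have exactly two vertices, so one end is deleted on each side.
  · rw [← cut_compl] at hb
    obtain ⟨xb, hxb, hxb'⟩ := exists_end_mem_of_mem_cut hb
    refine not_isConnected_deleteVerts D {xa, xb} X ?_ ?_ ?_ (h.2 _ (hpair _ _))
    · obtain ⟨x, hx, hne⟩ := Set.exists_ne_of_one_lt_ncard (s := X) (by omega) xa
      refine ⟨x, hx, ?_⟩
      rintro (rfl | rfl)
      · exact hne rfl
      · exact hxb hx
    · obtain ⟨x, hx, hne⟩ := Set.exists_ne_of_one_lt_ncard (s := Xᶜ) (by omega) xb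
      refine ⟨x, hx, ?_⟩
      rintro (rfl | rfl)
      · exact hx hxa
      · exact hne rfl
    · intro c hc
      rcases hab hc with rfl | rfl
      · rcases hxa' with h | h <;> simp [h]
      · rcases hxb' with h | h <;> simp [h]

theorem ncard_le_degreeIn [Finite A] (D : MultiDigraph V A) (v : V) (C : Set A)
    (hC : ∀ a ∈ C, D.src a = v ∨ D.tgt a = v) : C.ncard ≤ D.degreeIn Set.univ v := by
  have : C ⊆ {a | a ∈ Set.univ ∧ D.src a = v} ∪ {a | a ∈ Set.univ ∧ D.tgt a = v} := by
    intro a ha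
    simpa using hC a ha
  exact (Set.ncard_le_ncard this).trans (Set.ncard_union_le _ _)

/-- In a subcubic graph, two vertices whose deletion separates two other parts give an edge cut
of size at most two. -/
theorem false_of_separation [Finite A] (p q : A → Fin 4)
    (hno : ∀ a, ¬ (p a = 0 ∧ q a = 1) ∧ ¬ (p a = 1 ∧ q a = 0))
    (hdeg : ∀ i : Fin 4, 2 ≤ i → {a | p a = i ∨ q a = i}.ncard ≤ 3)
    (hcut : ∀ Q : Finset (Fin 4), 0 ∈ Q → 1 ∉ Q → 3 ≤ {a | ¬ (p a ∈ Q ↔ q a ∈ Q)}.ncard) :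
    False := by
  -- Classes `0` and `1` are the separated parts; classes `2` and `3` hold at most the deleted
  -- vertices. `n i j` is the set of arcs between two classes.
  let n (i j : Fin 4) : Set A := {a | (p a = i ∧ q a = j) ∨ (p a = j ∧ q a = i)}
  have hsub : ∀ C C₁ C₂ : Set A, C ⊆ C₁ ∪ C₂ → C.ncard ≤ C₁.ncard + C₂.ncard :=
    fun C C₁ C₂ hC => (Set.ncard_le_ncard hC).trans (Set.ncard_union_le _ _)
  have hd : ∀ i, 2 ≤ i → ∀ j,
      (n 0 i).ncard + (n 1 i).ncard + (n i j).ncard ≤ 3 ∨ j < 2 ∨ j = i := by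
    intro i hi j
    by_cases hj : j < 2 ∨ j = i
    · exact Or.inr hj
    refine Or.inl ?_
    rw [← Set.ncard_union_eq, ← Set.ncard_union_eq]
    · refine (Set.ncard_le_ncard ?_).trans (hdeg i hi)
      intro a
      simp only [n, Set.mem_union, Set.mem_ofPred_eq]
      tauto
    · rw [Set.disjoint_left]
      intro a
      simp only [n, Set.mem_union, Set.mem_ofPred_eq]
      generalize p a = x
      generalize q a = y
      revert i j x y
      decide
    · rw [Set.disjoint_left]
      intro a
      simp only [n, Set.mem_ofPred_eq]
      generalize p a = x
      generalize q a = y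
      clear hj
      revert i x y
      decide
  have h2 := hd 2 (by decide) 3
  have h3 := hd 3 (by decide) 2
  have hsymm : n 3 2 = n 2 3 := by
    ext a
    simp only [n, Set.mem_ofPred_eq]
    tauto
  rw [hsymm] at h3
  have c1 : ({a | ¬ (p a ∈ ({0} : Finset (Fin 4)) ↔ q a ∈ ({0} : Finset (Fin 4)))}).ncard ≤
      (n 0 2).ncard + (n 0 3).ncard := by
    refine hsub _ _ _ fun a => ?_
    have := hno a
    simp only [n, Set.mem_union, Set.mem_ofPred_eq]
    generalize p a = x at *
    generalize q a = y at *
    revert x y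
    decide
  have c2 : ({a | ¬ (p a ∈ ({0, 2, 3} : Finset (Fin 4)) ↔
      q a ∈ ({0, 2, 3} : Finset (Fin 4)))}).ncard ≤
      (n 1 2).ncard + (n 1 3).ncard := by
    refine hsub _ _ _ fun a => ?_
    have := hno a
    simp only [n, Set.mem_union, Set.mem_ofPred_eq]
    generalize p a = x at *
    generalize q a = y at *
    revert x y
    decide
  have c3 : ({a | ¬ (p a ∈ ({0, 2} : Finset (Fin 4)) ↔ q a ∈ ({0, 2} : Finset (Fin 4)))}).ncard ≤
      (n 0 3).ncard + ((n 1 2).ncard + (n 2 3).ncard) := by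
    refine (hsub _ (n 0 3) (n 1 2 ∪ n 2 3) fun a => ?_).trans
      (Nat.add_le_add_left (Set.ncard_union_le _ _) _)
    have := hno a
    simp only [n, Set.mem_union, Set.mem_ofPred_eq]
    generalize p a = x at *
    generalize q a = y at *
    revert x y
    decide
  have c4 : ({a | ¬ (p a ∈ ({0, 3} : Finset (Fin 4)) ↔ q a ∈ ({0, 3} : Finset (Fin 4)))}).ncard ≤
      (n 0 2).ncard + ((n 1 3).ncard + (n 2 3).ncard) := by
    refine (hsub _ (n 0 2) (n 1 3 ∪ n 2 3) fun a => ?_).trans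
      (Nat.add_le_add_left (Set.ncard_union_le _ _) _)
    have := hno a
    simp only [n, Set.mem_union, Set.mem_ofPred_eq]
    generalize p a = x at *
    generalize q a = y at *
    revert x y
    decide
  have k1 := hcut {0} (by decide) (by decide)
  have k2 := hcut {0, 2, 3} (by decide) (by decide)
  have k3 := hcut {0, 2} (by decide) (by decide)
  have k4 := hcut {0, 3} (by decide) (by decide)
  have e2 : ¬ ((3 : Fin 4) < 2 ∨ (3 : Fin 4) = 2) := by decide
  have e3 : ¬ ((2 : Fin 4) < 2 ∨ (2 : Fin 4) = 3) := by decide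
  have h2 := h2.resolve_right e2
  have h3 := h3.resolve_right e3
  -- The cuts around classes `0` and `1` need six arcs in all, so the degree bounds are tight and `n
  -- 2 3` is empty. Then `n 0 3` and `n 1 2` have equal size, as do `n 0 2` and `n 1 3`; each pair
  -- must contribute exactly three arcs, which is odd.
  omega

theorem IsCubic.isVertexConnected [Finite V] [Finite A] {D : MultiDigraph V A}
    (h3 : D.IsCubic) (h : D.IsEdgeConnected 3) (hcard : 3 < Nat.card V) :
    D.IsVertexConnected 3 := by
  classical
  rw [isEdgeConnected_iff_cut] at h
  refine ⟨hcard, fun S hS => ?_⟩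
  rw [isConnected_iff_cut]
  have hne : ∃ v, v ∉ S := by
    by_contra! hcon
    rw [(Set.eq_univ_iff_forall.2 hcon : S = Set.univ), Set.ncard_univ] at hS
    omega
  refine ⟨⟨hne.choose, hne.choose_spec⟩, ?_⟩
  intro X ⟨x, hx⟩ ⟨y, hy⟩
  by_contra hcut
  obtain ⟨s, t, hst⟩ : ∃ s t, S ⊆ {s, t} := by
    rcases S.eq_empty_or_nonempty with rfl | hSne
    · exact ⟨x, x, by simp⟩
    · obtain ⟨s, -, t, -, hst⟩ := exists_subset_pair hSne hS
      exact ⟨s, t, hst⟩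
  -- If at most one vertex is deleted, one of the classes `2` and `3` is empty, which does no harm.
  let ℓ : V → Fin 4 := fun v => if hv : v ∈ S then (if v = s then 2 else 3) else
    if (⟨v, hv⟩ : {v // v ∈ Sᶜ}) ∈ X then 0 else 1
  have hℓx : ℓ x = 0 := by
    have : x.1 ∉ S := x.2
    simp [ℓ, this, hx]
  have hℓy : ℓ y = 1 := by
    have : y.1 ∉ S := y.2
    simp only [ℓ, this, dif_neg, not_false_eq_true]
    rw [if_neg hy]
  refine false_of_separation (fun a => ℓ (D.src a)) (fun a => ℓ (D.tgt a)) ?_ ?_ ?_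
  · have key : ∀ a, (hs : D.src a ∉ S) → (ht : D.tgt a ∉ S) → (ℓ (D.src a) = ℓ (D.tgt a)) := by
      intro a hs ht
      have : ¬ ¬ ((⟨D.src a, hs⟩ : {v // v ∈ Sᶜ}) ∈ X ↔ (⟨D.tgt a, ht⟩ : {v // v ∈ Sᶜ}) ∈ X) :=
        fun hcon => hcut ⟨⟨a, hs, ht⟩, hcon⟩
      rw [not_not] at this
      simp only [ℓ, hs, ht, dif_neg, not_false_eq_true, this]
    have hS2 : ∀ v, v ∈ S → 2 ≤ ℓ v := by
      intro v hv
      simp only [ℓ, hv, dif_pos]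
      split_ifs <;> decide
    intro a
    have h1 := hS2 (D.src a)
    have h2 := hS2 (D.tgt a)
    have h3 := key a
    constructor
    · rintro ⟨e1, e2⟩
      rw [e1] at h1 h3
      rw [e2] at h2 h3
      exact absurd (h3 (fun h => absurd (h1 h) (by decide)) (fun h => absurd (h2 h) (by decide)))
        (by decide)
    · rintro ⟨e1, e2⟩
      rw [e1] at h1 h3
      rw [e2] at h2 h3
      exact absurd (h3 (fun h => absurd (h1 h) (by decide)) (fun h => absurd (h2 h) (by decide)))
        (by decide)
  · intro i hi
    have hi' : ∃ w, ∀ v, ℓ v = i → v = w := by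
      have : i = 2 ∨ i = 3 := by revert i; decide
      rcases this with rfl | rfl
      · refine ⟨s, fun v hv => ?_⟩
        simp only [ℓ] at hv
        split_ifs at hv with h1 h2 h2
        · exact h2
        all_goals exact absurd hv (by decide)
      · refine ⟨t, fun v hv => ?_⟩
        simp only [ℓ] at hv
        split_ifs at hv with h1 h2 h2
        · exact absurd hv (by decide)
        · rcases hst h1 with h | h
          · exact absurd h h2
          · exact h
        all_goals exact absurd hv (by decide)
    obtain ⟨w, hw⟩ := hi'
    rw [← h3 w]
    refine D.ncard_le_degreeIn w _ fun a ha => ?_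
    exact ha.imp (hw _) (hw _)
  · intro Q h0 h1
    exact h.2 {v | ℓ v ∈ Q} ⟨x, by simpa [hℓx] using h0⟩ ⟨y, by simpa [hℓy] using h1⟩

/-! ### Orbits of permutations -/

theorem eq_of_sameCycle {π : Equiv.Perm Δ} {l : Δ → F} (h : ∀ x, l (π x) = l x) {x y : Δ}
    (hxy : π.SameCycle x y) : l x = l y := by
  obtain ⟨i, rfl⟩ := hxy
  induction i using Int.induction_on with
  | zero => rfl
  | succ n ih => rw [ih, add_comm, zpow_one_add, Equiv.Perm.mul_apply, h]
  | pred n ih =>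
    rw [ih, ← h ((π ^ (-(n : ℤ) - 1)) x), ← Equiv.Perm.mul_apply, ← zpow_one_add]
    congr 3
    ring

theorem sameCycle_next (π : Equiv.Perm Δ) (x : Δ) : π.SameCycle x (π x) := ⟨1, by simp⟩

theorem SameCycle.of_setoid {π : Equiv.Perm Δ} (r : Setoid Δ) (h : ∀ x, r x (π x)) {x y : Δ}
    (hxy : π.SameCycle x y) : r x y :=
  Quotient.exact (eq_of_sameCycle (l := Quotient.mk r)
    (fun x => Quotient.sound (r.symm (h x))) hxy)

theorem sameCycle_permCongr {Δ' : Type*} (e : Δ ≃ Δ') (π : Equiv.Perm Δ) (x y : Δ') :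
    (e.permCongr π).SameCycle x y ↔ π.SameCycle (e.symm x) (e.symm y) := by
  have h : ∀ n : ℤ, (e.permCongr π) ^ n = e.permCongr (π ^ n) := fun n =>
    (map_zpow (Equiv.permCongrHom e) π n).symm
  refine exists_congr fun n => ?_
  rw [h, Equiv.permCongr_apply, ← Equiv.eq_symm_apply]

theorem card_sameCycle_quotient {π : Equiv.Perm Δ} {l : Δ → F}
    (hl : ∀ x y, π.SameCycle x y ↔ l x = l y) (hs : Function.Surjective l) :
    Nat.card (Quotient (Equiv.Perm.SameCycle.setoid π)) = Nat.card F := by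
  refine Nat.card_congr (Equiv.ofBijective (Quotient.lift l fun x y h => (hl x y).1 h) ⟨?_, ?_⟩)
  · rintro ⟨x⟩ ⟨y⟩ h
    exact Quotient.sound ((hl x y).2 h)
  · intro f
    obtain ⟨x, rfl⟩ := hs f
    exact ⟨Quotient.mk _ x, rfl⟩

/-! ### Connected planar digraphs and their duals -/

theorem component_endVertex_flip (D : MultiDigraph V A) (d : A × Bool) :
    D.componentSetoid (D.endVertex d) (D.endVertex (flipEnd A d)) := by
  obtain ⟨a, b⟩ := d
  cases b
  · exact D.component_src_tgt a
  · exact D.componentSetoid.symm (D.component_src_tgt a)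

/-- Consecutive faces around a vertex are the two ends of a dual arc, so all faces at one vertex are
connected; faces at adjacent vertices are linked through the arc between these. -/
theorem isConnected_dual [Nonempty A] {D : MultiDigraph V A} {D' : MultiDigraph F A}
    {σ : Equiv.Perm (A × Bool)} (hσ : D.IsRotationSystem σ) (hD : D.IsConnected)
    (hface : ∀ d, D'.endVertex (σ (flipEnd A d)) = D'.endVertex d)
    (hs : Function.Surjective D'.endVertex) : D'.IsConnected := by
  obtain ⟨a₀⟩ := ‹Nonempty A›
  have hstep : ∀ e, D'.componentSetoid (D'.endVertex e) (D'.endVertex (σ e)) := by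
    intro e
    have := hface (flipEnd A e)
    rw [flipEnd_flipEnd] at this
    rw [this]
    exact D'.component_endVertex_flip e
  have hcyc : ∀ d d', D.endVertex d = D.endVertex d' →
      D'.componentSetoid (D'.endVertex d) (D'.endVertex d') := fun d d' h =>
    SameCycle.of_setoid (D'.componentSetoid.comap D'.endVertex) hstep ((hσ d d').2 h)
  have hall : ∀ d, D'.componentSetoid (D'.endVertex (a₀, false)) (D'.endVertex d) := by
    intro d
    have := D.mem_iff_of_component
      {v | ∀ d, D.endVertex d = v →
        D'.componentSetoid (D'.endVertex (a₀, false)) (D'.endVertex d)} (fun a => by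
        constructor
        · intro h e he
          refine D'.componentSetoid.trans (h (a, false) rfl) (D'.componentSetoid.trans
            (D'.component_endVertex_flip (a, false)) (hcyc (a, true) e he.symm))
        · intro h e he
          refine D'.componentSetoid.trans (h (a, true) rfl) (D'.componentSetoid.trans
            (D'.component_endVertex_flip (a, true)) (hcyc (a, false) e he.symm)))
      (hD.2 (D.endVertex (a₀, false)) (D.endVertex d))
    exact this.1 (fun e he => hcyc _ _ he.symm) d rfl
  refine ⟨⟨D'.endVertex (a₀, false)⟩, fun f g => ?_⟩
  obtain ⟨d, rfl⟩ := hs f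
  obtain ⟨d', rfl⟩ := hs g
  exact D'.componentSetoid.trans (D'.componentSetoid.symm (hall d)) (hall d')

theorem exists_end_of_isConnected [Nonempty A] {D : MultiDigraph V A} (hD : D.IsConnected)
    (v : V) : ∃ d, D.endVertex d = v := by
  by_contra! hcon
  obtain ⟨a⟩ := ‹Nonempty A›
  obtain ⟨b, hb⟩ := ((isConnected_iff_cut D).1 hD).2 {v} ⟨v, rfl⟩
    ⟨D.src a, fun h => hcon (a, false) h⟩
  refine hb ⟨fun h => absurd h (hcon (b, false)), fun h => absurd h (hcon (b, true))⟩

theorem isolated_eq_empty {D : MultiDigraph V A} (h : ∀ v, ∃ d, D.endVertex d = v) :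
    {v | ∀ a, D.src a ≠ v ∧ D.tgt a ≠ v} = ∅ := by
  ext v
  simp only [Set.mem_ofPred_eq, Set.mem_empty_iff_false, iff_false]
  intro hv
  obtain ⟨⟨a, b⟩, hd⟩ := h v
  cases b
  · exact (hv a).1 hd
  · exact (hv a).2 hd

theorem card_component_eq_one {D : MultiDigraph V A} (hD : D.IsConnected) :
    Nat.card (Quotient D.componentSetoid) = 1 := by
  rw [Nat.card_eq_one_iff_unique]
  obtain ⟨v⟩ := hD.1
  refine ⟨⟨?_⟩, ⟨Quotient.mk _ v⟩⟩
  rintro ⟨x⟩ ⟨y⟩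
  exact Quotient.sound (hD.2 x y)

/-- The face containing an arc-end, in the drawing given by `σ`. -/
def faceOf (σ : Equiv.Perm (A × Bool)) (d : A × Bool) :
    Quotient (Equiv.Perm.SameCycle.setoid (σ * flipEnd A)) :=
  Quotient.mk _ d

/-- The dual digraph of a drawing. -/
def dual (σ : Equiv.Perm (A × Bool)) :
    MultiDigraph (Quotient (Equiv.Perm.SameCycle.setoid (σ * flipEnd A))) A where
  src a := faceOf σ (a, false)
  tgt a := faceOf σ (a, true)

theorem dual_endVertex (σ : Equiv.Perm (A × Bool)) (d : A × Bool) :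
    (dual σ).endVertex d = faceOf σ d := by
  obtain ⟨a, b⟩ := d
  cases b <;> rfl

theorem faceOf_next (σ : Equiv.Perm (A × Bool)) (d : A × Bool) :
    faceOf σ (σ (flipEnd A d)) = faceOf σ d :=
  Quotient.sound (sameCycle_next (σ * flipEnd A) d).symm

theorem faceOf_rot (σ : Equiv.Perm (A × Bool)) (d : A × Bool) :
    faceOf σ (σ d) = faceOf σ (flipEnd A d) := by
  rw [← faceOf_next σ (flipEnd A d), flipEnd_flipEnd]

theorem faceOf_eq_iff (σ : Equiv.Perm (A × Bool)) (d d' : A × Bool) :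
    (σ * flipEnd A).SameCycle d d' ↔ faceOf σ d = faceOf σ d' :=
  ⟨fun h => Quotient.sound h, fun h => Quotient.exact h⟩

theorem faceOf_surjective (σ : Equiv.Perm (A × Bool)) : Function.Surjective (faceOf σ) :=
  fun f => Quotient.inductionOn f fun d => ⟨d, rfl⟩

theorem IsPlanar.exists_isDualPair [Nonempty A] {D : MultiDigraph V A} (hD : D.IsConnected)
    (hp : D.IsPlanar) : ∃ σ, D.IsRotationSystem σ ∧ IsDualPair D (dual σ) σ := by
  obtain ⟨σ, hσ, hc⟩ := hp
  have hface : ∀ d, (dual σ).endVertex (σ (flipEnd A d)) = (dual σ).endVertex d := fun d => by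
    rw [dual_endVertex, dual_endVertex, faceOf_next]
  refine ⟨σ, hσ, ⟨fun d => ((hσ d (σ d)).1 (sameCycle_next σ d)).symm, hface, hD,
    isConnected_dual hσ hD hface ?_, ?_⟩⟩
  · intro f
    obtain ⟨d, rfl⟩ := faceOf_surjective σ f
    exact ⟨d, dual_endVertex σ d⟩
  · rw [isolated_eq_empty (exists_end_of_isConnected hD), card_component_eq_one hD] at hc
    simpa [faceCount] using hc

/-! ### Digraphs from permutations of arc-ends -/

/-- The digraph whose arc-ends are the elements of `Δ`: the permutation `α` exchanges the two ends
of every arc, `o` singles out the tail ends, and `vt` tells at which vertex an end lies. -/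
def ofEnds (α : Equiv.Perm Δ) (o : Δ → Prop) (vt : Δ → W) : MultiDigraph W {δ // o δ} where
  src δ := vt δ.1
  tgt δ := vt (α δ.1)

/-- `α` is an involution that exchanges tail ends and head ends. -/
structure IsReversal (α : Equiv.Perm Δ) (o : Δ → Prop) : Prop where
  invol : ∀ δ, α (α δ) = δ
  tail : ∀ δ, o (α δ) ↔ ¬ o δ

open Classical in
/-- The arc-ends of `ofEnds α o vt` are the elements of `Δ`. -/
noncomputable def IsReversal.ends {α : Equiv.Perm Δ} {o : Δ → Prop} (h : IsReversal α o) :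
    {δ // o δ} × Bool ≃ Δ where
  toFun x := if x.2 then α x.1 else x.1
  invFun δ := if hδ : o δ then (⟨δ, hδ⟩, false) else (⟨α δ, (h.tail δ).2 hδ⟩, true)
  left_inv := by
    rintro ⟨⟨δ, hδ⟩, b⟩
    cases b
    · simp [hδ]
    · have : ¬ o (α δ) := fun h' => (h.tail δ).1 h' hδ
      simp [this, h.invol]
  right_inv := by
    intro δ
    by_cases hδ : o δ <;> simp [hδ, h.invol]

section ofEnds

variable {α : Equiv.Perm Δ} {o : Δ → Prop}

theorem IsReversal.endVertex (h : IsReversal α o) (vt : Δ → W) (x : {δ // o δ} × Bool) :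
    (ofEnds α o vt).endVertex x = vt (h.ends x) := by
  obtain ⟨δ, b⟩ := x
  cases b <;> rfl

theorem IsReversal.ends_flip (h : IsReversal α o) (x : {δ // o δ} × Bool) :
    h.ends (flipEnd _ x) = α (h.ends x) := by
  obtain ⟨δ, b⟩ := x
  cases b
  · rfl
  · exact (h.invol _).symm

theorem IsReversal.card [Finite Δ] (h : IsReversal α o) : 2 * Nat.card {δ // o δ} = Nat.card Δ := by
  rw [← Nat.card_congr h.ends, Nat.card_prod, Nat.card_eq_fintype_card (α := Bool),
    Fintype.card_bool, mul_comm]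

theorem IsReversal.rot_face (h : IsReversal α o) (τ : Equiv.Perm Δ) :
    h.ends.symm.permCongr τ * flipEnd _ = h.ends.symm.permCongr (τ * α) := by
  ext1 x
  simp [Equiv.permCongr_apply, h.ends_flip]

theorem IsReversal.isRotationSystem (h : IsReversal α o) {vt : Δ → W} {τ : Equiv.Perm Δ}
    (hvt : ∀ x y, τ.SameCycle x y ↔ vt x = vt y) :
    (ofEnds α o vt).IsRotationSystem (h.ends.symm.permCongr τ) := by
  intro x y
  rw [sameCycle_permCongr, h.endVertex, h.endVertex, hvt]
  rfl

/-- The labellings `vt` and `lab` name the orbits of `τ` and of `τ * α`, so that vertices and faces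
can be counted on explicit types. -/
theorem IsReversal.isPlanar (h : IsReversal α o) {vt : Δ → W} {lab : Δ → F} {τ : Equiv.Perm Δ}
    (hvt : ∀ x y, τ.SameCycle x y ↔ vt x = vt y)
    (hlab : ∀ x y, (τ * α).SameCycle x y ↔ lab x = lab y) (hlabs : Function.Surjective lab)
    (hvts : Function.Surjective vt) (hcon : (ofEnds α o vt).IsConnected)
    (heuler : Nat.card W + Nat.card F = Nat.card {δ // o δ} + 2) :
    (ofEnds α o vt).IsPlanar := by
  refine ⟨_, h.isRotationSystem hvt, ?_⟩
  rw [isolated_eq_empty, card_component_eq_one hcon]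
  · rw [faceCount, h.rot_face, card_sameCycle_quotient (l := fun x => lab (h.ends x)),
      Set.ncard_empty, add_zero, mul_one, heuler]
    · intro x y
      rw [sameCycle_permCongr, hlab]
      rfl
    · exact hlabs.comp h.ends.surjective
  · intro v
    obtain ⟨δ, rfl⟩ := hvts v
    exact ⟨h.ends.symm δ, by rw [h.endVertex, Equiv.apply_symm_apply]⟩

/-- For the faces, invariance of `lab` suffices: orthogonality of tensions needs nothing more, and
Euler's formula supplies the dimension count. -/
theorem IsReversal.isDualPair (h : IsReversal α o) [Nonempty Δ] {vt : Δ → W} {lab : Δ → F}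
    {τ : Equiv.Perm Δ}
    (hvt : ∀ x y, τ.SameCycle x y ↔ vt x = vt y)
    (hlab : ∀ x, lab (τ (α x)) = lab x) (hlabs : Function.Surjective lab)
    (hcon : (ofEnds α o vt).IsConnected)
    (heuler : Nat.card W + Nat.card F = Nat.card {δ // o δ} + 2) :
    IsDualPair (ofEnds α o vt) (ofEnds α o lab) (h.ends.symm.permCongr τ) := by
  have hface : ∀ d, (ofEnds α o lab).endVertex
      (h.ends.symm.permCongr τ (flipEnd _ d)) = (ofEnds α o lab).endVertex d := by
    intro d
    rw [h.endVertex, h.endVertex, Equiv.permCongr_apply, Equiv.symm_symm, Equiv.apply_symm_apply,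
      h.ends_flip, hlab]
  have hrot := h.isRotationSystem hvt
  have : Nonempty {δ // o δ} := by
    obtain ⟨δ⟩ := ‹Nonempty Δ›
    exact ⟨(h.ends.symm δ).1⟩
  refine ⟨fun d => ((hrot d _).1 (sameCycle_next _ d)).symm, hface, hcon,
    isConnected_dual hrot hcon hface ?_, heuler⟩
  intro f
  obtain ⟨δ, rfl⟩ := hlabs f
  exact ⟨h.ends.symm δ, by rw [h.endVertex, Equiv.apply_symm_apply]⟩

/-- The degree in `ofEnds`, counted on `Δ`. -/
theorem IsReversal.degreeIn (h : IsReversal α o) [Finite Δ] (vt : Δ → W)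
    (M : Set {δ // o δ}) (w : W) :
    (ofEnds α o vt).degreeIn M w = {δ | vt δ = w ∧ (h.ends.symm δ).1 ∈ M}.ncard := by
  rw [degreeIn_eq_ncard, ← Set.ncard_image_of_injective _ h.ends.injective]
  congr 1
  ext δ
  simp only [endsIn, h.endVertex, Set.mem_image, Set.mem_ofPred_eq]
  constructor
  · rintro ⟨x, ⟨h1, h2⟩, rfl⟩
    exact ⟨h2, by simpa using h1⟩
  · rintro ⟨h1, h2⟩
    exact ⟨h.ends.symm δ, ⟨h2, by simpa using h1⟩, by simp⟩

end ofEnds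

/-! ### Even subgraphs -/

theorem degreeIn_union [Finite A] (D : MultiDigraph V A) {E E' : Set A} (h : Disjoint E E')
    (v : V) : D.degreeIn (E ∪ E') v = D.degreeIn E v + D.degreeIn E' v := by
  simp only [degreeIn_eq_ncard]
  rw [← Set.ncard_union_eq]
  · congr 1
    ext d
    simp only [endsIn, Set.mem_union, Set.mem_ofPred_eq]
    tauto
  · rw [Set.disjoint_left] at h ⊢
    rintro d ⟨h1, _⟩ ⟨h2, _⟩
    exact h h1 h2

theorem IsCycle.even_degreeIn {D : MultiDigraph V A} {C : Set A} (hC : D.IsCycle C) (v : V) :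
    Even (D.degreeIn C v) := by
  classical
  obtain ⟨m, w, e, -, he, hj, rfl⟩ := hC
  have h1 : ∀ f : A → V, {a | a ∈ Set.range e ∧ f a = v}.ncard =
      ∑ i, if f (e i) = v then 1 else 0 := by
    intro f
    have : {a | a ∈ Set.range e ∧ f a = v} = e '' {i | f (e i) = v} := by
      ext a
      constructor
      · rintro ⟨⟨i, rfl⟩, h⟩
        exact ⟨i, h, rfl⟩
      · rintro ⟨i, h, rfl⟩
        exact ⟨⟨i, rfl⟩, h⟩
    rw [this, Set.ncard_image_of_injective _ he, Finset.sum_boole]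
    rw [← Set.ncard_coe_finset]
    simp
  rw [degreeIn, h1, h1, ← Finset.sum_add_distrib]
  -- Whatever its direction, `e i` has its ends at `w i` and `w (i + 1)`, so every index of the
  -- cycle is counted twice.
  have h2 : ∀ i, ((if D.src (e i) = v then 1 else 0) + if D.tgt (e i) = v then 1 else 0) =
      (if w i = v then 1 else 0) + if w (i + 1) = v then 1 else 0 := by
    intro i
    rcases hj i with ⟨h, h'⟩ | ⟨h, h'⟩
    · rw [h, h']
    · rw [h, h', add_comm]
  rw [Finset.sum_congr rfl fun i _ => h2 i, Finset.sum_add_distrib]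
  exact ⟨_, congrArg _ (Equiv.sum_comp (Equiv.addRight (1 : Fin (m + 1)))
    (fun i => if w i = v then 1 else 0))⟩

theorem IsEvenSubgraph.even_degreeIn [Finite A] {D : MultiDigraph V A} {E : Set A}
    (hE : D.IsEvenSubgraph E) (v : V) : Even (D.degreeIn E v) := by
  obtain ⟨𝒞, h𝒞, hd, rfl⟩ := hE
  induction 𝒞, Set.toFinite 𝒞 using Set.Finite.induction_on with
  | empty => simp [degreeIn]
  | @insert C 𝒞 hC _ ih =>
    rw [Set.sUnion_insert, degreeIn_union]
    · exact (IsCycle.even_degreeIn (h𝒞 C (by simp)) v).add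
        (ih (fun C' h => h𝒞 C' (by simp [h])) (hd.subset (by simp)))
    · rw [Set.disjoint_sUnion_right]
      intro C' hC'
      exact hd (by simp) (by simp [hC']) (fun h => hC (h ▸ hC'))

theorem joins_endVertex (D : MultiDigraph V A) (d : A × Bool) :
    D.Joins d.1 (D.endVertex d) (D.endVertex (flipEnd A d)) := by
  obtain ⟨a, b⟩ := d
  cases b
  · exact Or.inl ⟨rfl, rfl⟩
  · exact Or.inr ⟨rfl, rfl⟩

theorem eq_or_eq_flipEnd {d d' : A × Bool} (h : d.1 = d'.1) : d' = d ∨ d' = flipEnd A d := by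
  obtain ⟨a, b⟩ := d
  obtain ⟨a', b'⟩ := d'
  obtain rfl : a = a' := h
  cases b <;> cases b' <;> simp [flipEnd]

/-- Without vertices of degree one, a walk in `E` can always continue without turning back along the
same arc. Its first repeated vertex closes a cycle. -/
theorem exists_isCycle [Finite V] [Finite A] (D : MultiDigraph V A) {E : Set A}
    (hE : E.Nonempty) (hdeg : ∀ v, D.degreeIn E v ≠ 1) : ∃ C ⊆ E, D.IsCycle C := by
  classical
  by_cases hloop : ∃ a ∈ E, D.src a = D.tgt a
  · obtain ⟨a, ha, hl⟩ := hloop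
    exact ⟨{a}, by simpa, 0, fun _ => D.src a, fun _ => a, fun i j _ => by omega,
      fun i j _ => by omega, fun _ => Or.inl ⟨rfl, hl.symm⟩, by simp⟩
  push Not at hloop
  have hnext : ∀ d : {d : A × Bool // d.1 ∈ E}, ∃ d' : {d : A × Bool // d.1 ∈ E},
      D.endVertex d'.1 = D.endVertex (flipEnd A d.1) ∧ d'.1 ≠ flipEnd A d.1 := by
    rintro ⟨d, hd⟩
    have h1 := hdeg (D.endVertex (flipEnd A d))
    rw [degreeIn_eq_ncard] at h1
    have h2 : flipEnd A d ∈ D.endsIn E (D.endVertex (flipEnd A d)) := ⟨hd, rfl⟩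
    have h3 := (Set.ncard_pos (Set.toFinite _)).2 ⟨_, h2⟩
    obtain ⟨d', h4, h5⟩ :=
      Set.exists_ne_of_one_lt_ncard (s := D.endsIn E (D.endVertex (flipEnd A d)))
      (by omega) (flipEnd A d)
    exact ⟨⟨d', h4.1⟩, h4.2, h5⟩
  choose next hn1 hn2 using hnext
  obtain ⟨a₀, ha₀⟩ := hE
  let s : ℕ → {d : A × Bool // d.1 ∈ E} := fun n => next^[n] ⟨(a₀, false), ha₀⟩
  have hs : ∀ n, s (n + 1) = next (s n) := fun n => Function.iterate_succ_apply' _ _ _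
  let u : ℕ → V := fun n => D.endVertex (s n).1
  have hu : ∀ n, D.endVertex (flipEnd A (s n).1) = u (n + 1) := fun n => by
    simp only [u]; rw [hs, hn1]
  have hex : ∃ j, ∃ i < j, u i = u j := by
    obtain ⟨i, j, hij, he⟩ := Finite.exists_ne_map_eq_of_infinite u
    rcases lt_or_gt_of_ne hij with h | h
    · exact ⟨j, i, h, he⟩
    · exact ⟨i, j, h, he.symm⟩
  obtain ⟨i, hij, he⟩ := Nat.find_spec hex
  have hmin : ∀ k l, k < l → l < Nat.find hex → u k ≠ u l := fun k l hkl hl h =>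
    Nat.find_min hex hl ⟨k, hkl, h⟩
  generalize Nat.find hex = j at *
  obtain ⟨m, rfl⟩ : ∃ m, j = i + m + 1 := ⟨j - i - 1, by omega⟩
  have hinj : ∀ k l, k < i + m + 1 → l < i + m + 1 → u k = u l → k = l := by
    intro k l hk hl h
    by_contra hne
    rcases lt_or_gt_of_ne hne with h' | h'
    · exact hmin k l h' hl h
    · exact hmin l k h' hk h.symm
  -- An arc repeated in the same direction repeats a vertex too early; one repeated in the opposite
  -- direction forces `l = k + 1`, an immediate reversal.
  have harc : ∀ k l, k < l → l < i + m + 1 → (s k).1.1 ≠ (s l).1.1 := by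
    intro k l hkl hl h
    rcases eq_or_eq_flipEnd h with h' | h'
    · exact hmin k l hkl hl (by simp only [u, h'])
    · have h2 : u l = u (k + 1) := by rw [← hu k, ← h']
      have h3 := hinj l (k + 1) hl (by omega) h2
      subst h3
      exact hn2 (s k) (by rw [← hs, h'])
  refine ⟨_, ?_, m, fun k => u (i + k.1), fun k => (s (i + k.1)).1.1, ?_, ?_, ?_, rfl⟩
  · rintro _ ⟨k, rfl⟩
    exact (s _).2
  · intro k l h
    have := hinj _ _ (by omega) (by omega) h
    exact Fin.ext (by omega)
  · intro k l h
    by_contra hne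
    have hne' : k.1 ≠ l.1 := fun h => hne (Fin.ext h)
    rcases lt_or_gt_of_ne hne' with h' | h'
    · exact harc _ _ (by omega) (by omega) h
    · exact harc _ _ (by omega) (by omega) h.symm
  · intro k
    have h1 := D.joins_endVertex (s (i + k.1)).1
    rw [hu] at h1
    have h2 : u (i + (k + 1).1) = u (i + k.1 + 1) := by
      by_cases hk : k.1 = m
      · have : k = Fin.last m := Fin.ext hk
        subst this
        simpa using he
      · have hk' : k < Fin.last m := Fin.lt_def.2 (by have := k.2; simp; omega)
        rw [Fin.val_add_one_of_lt hk', add_assoc]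
    simp only [h2]
    exact h1

/-- Cycles are split off one at a time; removing a cycle keeps all degrees even. -/
theorem isEvenSubgraph_of_even [Finite V] [Finite A] (D : MultiDigraph V A) (E : Set A)
    (hE : ∀ v, Even (D.degreeIn E v)) : D.IsEvenSubgraph E := by
  induction hn : E.ncard using Nat.strong_induction_on generalizing E with
  | _ n ih =>
    rcases E.eq_empty_or_nonempty with rfl | hne
    · exact ⟨∅, by simp, by simp, by simp⟩
    obtain ⟨C, hCE, hC⟩ := D.exists_isCycle hne fun v h => by
      have := hE v
      rw [h] at this
      exact absurd this (by decide)
    have hCne : C.Nonempty := by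
      obtain ⟨m, w, e, -, -, -, rfl⟩ := hC
      exact ⟨e 0, 0, rfl⟩
    have hun : C ∪ E \ C = E := Set.union_sdiff_cancel hCE
    have hdisj : Disjoint C (E \ C) := Set.disjoint_sdiff_right
    obtain ⟨𝒞, h1, h2, h3⟩ := ih (E \ C).ncard (by
        rw [← hn]
        refine Set.ncard_lt_ncard ⟨Set.sdiff_subset, fun h => ?_⟩
        obtain ⟨a, ha⟩ := hCne
        exact (h (hCE ha)).2 ha) (E \ C) (by
        intro v
        have h1 := hE v
        rw [← hun, degreeIn_union _ hdisj] at h1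
        exact (Nat.even_add.1 h1).1 (hC.even_degreeIn v)) rfl
    refine ⟨insert C 𝒞, ?_, ?_, ?_⟩
    · rintro C' (rfl | h)
      · exact hC
      · exact h1 C' h
    · refine Set.PairwiseDisjoint.insert h2 fun C' hC' _ => ?_
      exact hdisj.mono_right (by
        show C' ⊆ E \ C
        rw [← h3]; exact Set.subset_sUnion_of_mem hC')
    · rw [Set.sUnion_insert, h3, hun]

/-! ### Strong connectivity of contractions -/

/-- The directed cuts of `D / E` are those directed cuts of `D` that contain no arc of `E`, and
strong connectivity means that there are none. -/
theorem isStronglyConnected_contract_iff (D : MultiDigraph V A) (E : Set A) :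
    (D.contract E).IsStronglyConnected ↔ Nonempty V ∧ ¬ D.ContainsDirectedCut Eᶜ := by
  constructor
  · rintro ⟨hV, h⟩
    refine ⟨hV.elim fun q => Quotient.inductionOn q fun v => ⟨v⟩, ?_⟩
    rintro ⟨_, hBE, X, ⟨x, hx⟩, ⟨y, hy⟩, hX, rfl⟩
    have hcl : ∀ u v, D.contractSetoid E u v → (u ∈ X ↔ v ∈ X) := by
      intro u v huv
      change Relation.EqvGen _ u v at huv
      induction huv with
      | rel u v h =>
        obtain ⟨a, ha, rfl, rfl⟩ := h
        by_contra hcon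
        by_cases h1 : D.src a ∈ X
        · exact hBE ⟨h1, by tauto⟩ ha
        · exact hX a ⟨h1, by tauto⟩
      | refl => rfl
      | symm _ _ _ ih => exact ih.symm
      | trans _ _ _ _ _ ih₁ ih₂ => exact ih₁.trans ih₂
    have hreach : ∀ q, Relation.ReflTransGen (D.contract E).Adj (Quotient.mk _ y) q →
        ∀ v, Quotient.mk (D.contractSetoid E) v = q → v ∉ X := by
      intro q hq
      induction hq with
      | refl => exact fun v hv hvX => hy ((hcl v y (Quotient.exact hv)).1 hvX)
      | tail _ h ih =>
        obtain ⟨⟨a, ha⟩, rfl, rfl⟩ := h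
        intro v hv hvX
        exact hX a ⟨ih _ rfl, (hcl v _ (Quotient.exact hv)).1 hvX⟩
    exact hreach _ (h _ (Quotient.mk _ x)) x rfl hx
  · rintro ⟨⟨v₀⟩, h⟩
    refine ⟨⟨Quotient.mk _ v₀⟩, ?_⟩
    rintro ⟨u⟩ ⟨w⟩
    by_contra hcon
    -- No arc leaves the set reachable from `u`, so all arcs between it and its complement run from
    -- the complement into it.
    refine h ⟨_, ?_, {v | ¬ Relation.ReflTransGen (D.contract E).Adj (Quotient.mk _ u)
      (Quotient.mk _ v)}, ⟨w, hcon⟩, ⟨u, fun h => h .refl⟩, ?_, rfl⟩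
    · rintro a ⟨h1, h2⟩ ha
      refine h2 fun h3 => h1 ?_
      rwa [Quotient.sound (s := D.contractSetoid E) (Relation.EqvGen.rel _ _ ⟨a, ha, rfl, rfl⟩)]
    · rintro a ⟨h1, h2⟩
      simp only [Set.mem_ofPred_eq, not_not] at h1 h2
      by_cases ha : a ∈ E
      · rw [Quotient.sound (s := D.contractSetoid E)
          (Relation.EqvGen.rel _ _ ⟨a, ha, rfl, rfl⟩)] at h1
        exact h2 h1
      · exact h2 (h1.tail ⟨⟨a, ha⟩, rfl, rfl⟩)

/-! ### Arcs of `ofEnds` -/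

section arcOf

variable {α : Equiv.Perm Δ} {o : Δ → Prop}

/-- The arc to which an end belongs. -/
noncomputable def IsReversal.arcOf (h : IsReversal α o) (δ : Δ) : {δ // o δ} := (h.ends.symm δ).1

theorem IsReversal.arcOf_tail (h : IsReversal α o) (a : {δ // o δ}) : h.arcOf a.1 = a := by
  have : h.ends.symm a.1 = (a, false) := by
    rw [Equiv.symm_apply_eq]; rfl
  rw [arcOf, this]

theorem IsReversal.arcOf_of_tail (h : IsReversal α o) {δ : Δ} (hδ : o δ) :
    h.arcOf δ = ⟨δ, hδ⟩ := h.arcOf_tail ⟨δ, hδ⟩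

theorem IsReversal.arcOf_flip (h : IsReversal α o) (δ : Δ) : h.arcOf (α δ) = h.arcOf δ := by
  obtain ⟨x, rfl⟩ := h.ends.surjective δ
  rw [← h.ends_flip]
  simp [arcOf, flipEnd]

theorem IsReversal.arcOf_eq (h : IsReversal α o) {δ δ' : Δ} (he : h.arcOf δ = h.arcOf δ') :
    δ' = δ ∨ δ' = α δ := by
  obtain ⟨x, rfl⟩ := h.ends.surjective δ
  obtain ⟨y, rfl⟩ := h.ends.surjective δ'
  simp only [arcOf, Equiv.symm_apply_apply] at he
  rw [← h.ends_flip]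
  rcases eq_or_eq_flipEnd he with rfl | rfl <;> simp

theorem IsReversal.arcOf_mem_cut (h : IsReversal α o) (vt : Δ → W) (X : Set W) (δ : Δ) :
    h.arcOf δ ∈ (ofEnds α o vt).cut X ↔ ¬ (vt δ ∈ X ↔ vt (α δ) ∈ X) := by
  by_cases hδ : o δ
  · rw [h.arcOf_of_tail hδ]; rfl
  · rw [← h.arcOf_flip, h.arcOf_of_tail ((h.tail δ).2 hδ)]
    change ¬ (vt (α δ) ∈ X ↔ vt (α (α δ)) ∈ X) ↔ _
    rw [h.invol]
    tauto

end arcOf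

/-! ### Cubic digraphs on ports -/

theorem isCubic_ofEnds_fst [Finite W] {α : Equiv.Perm (W × Fin 3)} {o : W × Fin 3 → Prop}
    (h : IsReversal α o) : (ofEnds α o Prod.fst).IsCubic := by
  intro w
  rw [h.degreeIn]
  have : {δ : W × Fin 3 | δ.1 = w ∧ (h.ends.symm δ).1 ∈ Set.univ} =
      (fun j => (w, j)) '' Set.univ := by
    ext ⟨w', j⟩
    simp [eq_comm]
  rw [this, Set.ncard_image_of_injective _ (fun i j h => by simpa using h), Set.ncard_univ]
  simp

open Classical in
/-- The indicator of an arc set, read at the ends of arcs. -/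
noncomputable def IsReversal.indicator {α : Equiv.Perm Δ} {o : Δ → Prop} (h : IsReversal α o)
    (E : Set {δ // o δ}) (δ : Δ) : ZMod 2 := if h.arcOf δ ∈ E then 1 else 0

theorem degreeIn_cast_eq_sum [Fintype A] (D : MultiDigraph V A) (E : Set A) (v : V)
    [DecidableEq V] [DecidablePred (· ∈ E)] :
    (D.degreeIn E v : ZMod 2) =
      ∑ d : A × Bool with D.endVertex d = v, if d.1 ∈ E then 1 else 0 := by
  rw [degreeIn_eq_ncard, Finset.sum_boole, ← Set.ncard_coe_finset]
  congr 2
  ext d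
  simp [endsIn, and_comm]

theorem degreeIn_fst_cast [Finite W] {α : Equiv.Perm (W × Fin 3)} {o : W × Fin 3 → Prop}
    (h : IsReversal α o) (E : Set {δ // o δ}) (w : W) :
    ((ofEnds α o Prod.fst).degreeIn E w : ZMod 2) = ∑ j, h.indicator E (w, j) := by
  classical
  rw [h.degreeIn]
  have : {δ : W × Fin 3 | δ.1 = w ∧ (h.ends.symm δ).1 ∈ E} =
      (fun j => (w, j)) '' {j | h.arcOf (w, j) ∈ E} := by
    ext ⟨w', j⟩
    simp only [Set.mem_ofPred_eq, Set.mem_image, Prod.mk.injEq, IsReversal.arcOf]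
    constructor
    · rintro ⟨rfl, h⟩
      exact ⟨j, h, rfl, rfl⟩
    · rintro ⟨j, h, rfl, rfl⟩
      exact ⟨rfl, h⟩
  rw [this, Set.ncard_image_of_injective _ (fun i j h => by simpa using h)]
  simp only [IsReversal.indicator]
  rw [Finset.sum_boole, ← Set.ncard_coe_finset]
  congr 2
  ext j
  simp

/-! ### Rotation systems exist -/

theorem exists_isRotationSystem [Finite A] (D : MultiDigraph V A) :
    ∃ σ, D.IsRotationSystem σ := by
  classical
  have := Fintype.ofFinite A
  have hc : ∀ v, ∃ c : Equiv.Perm {d : A × Bool // D.endVertex d = v}, ∀ x y, c.SameCycle x y := by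
    intro v
    obtain ⟨f, hf, -⟩ := Finset.exists_cycleOn
      (Finset.univ : Finset {d : A × Bool // D.endVertex d = v})
    exact ⟨f, fun x y => hf.2 (by simp) (by simp)⟩
  choose c hc using hc
  let e := Equiv.sigmaFiberEquiv D.endVertex
  refine ⟨e.permCongr (Equiv.Perm.sigmaCongrRight c), fun d d' => ?_⟩
  rw [sameCycle_permCongr]
  have hfst : ∀ d, (e.symm d).1 = D.endVertex d := fun d => rfl
  constructor
  · intro h
    rw [← hfst d, ← hfst d']
    exact eq_of_sameCycle (l := Sigma.fst) (fun _ => rfl) h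
  · intro h
    obtain ⟨n, hn⟩ := hc _ ⟨d, rfl⟩ ⟨d', h.symm⟩
    refine ⟨n, ?_⟩
    have hpow : ∀ n : ℤ, (Equiv.Perm.sigmaCongrRight c) ^ n =
        Equiv.Perm.sigmaCongrRight (fun v => c v ^ n) := fun n =>
      (map_zpow (Equiv.Perm.sigmaCongrRightHom
        (fun v => {d : A × Bool // D.endVertex d = v})) c n).symm
    rw [hpow]
    apply e.injective
    rw [Equiv.apply_symm_apply]
    change (((c (D.endVertex d)) ^ n) ⟨d, rfl⟩).1 = d'
    rw [hn]

theorem IsRotationSystem.endVertex {D : MultiDigraph V A} {σ : Equiv.Perm (A × Bool)}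
    (hσ : D.IsRotationSystem σ) (d : A × Bool) : D.endVertex (σ d) = D.endVertex d :=
  ((hσ d _).1 (sameCycle_next σ d)).symm

theorem IsRotationSystem.endVertex_symm {D : MultiDigraph V A} {σ : Equiv.Perm (A × Bool)}
    (hσ : D.IsRotationSystem σ) (d : A × Bool) : D.endVertex (σ.symm d) = D.endVertex d := by
  rw [← hσ.endVertex, Equiv.apply_symm_apply]

theorem sum_fiber_rotation [Fintype A] {D : MultiDigraph V A} {σ : Equiv.Perm (A × Bool)}
    (hσ : D.IsRotationSystem σ) {M : Type*} [AddCommMonoid M] (f : A × Bool → M) (v : V)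
    [DecidableEq V] :
    ∑ d with D.endVertex d = v, f (σ.symm d) = ∑ d with D.endVertex d = v, f d := by
  refine Finset.sum_bijective σ.symm σ.symm.bijective ?_ fun _ _ => rfl
  intro d
  simp [hσ.endVertex_symm]

theorem exists_change_of_sameCycle {σ : Equiv.Perm Δ} [Finite Δ] {P : Δ → Prop} {x y : Δ}
    (h : σ.SameCycle x y) (hx : P x) (hy : ¬ P y) :
    ∃ z, σ.SameCycle x z ∧ P z ∧ ¬ P (σ z) := by
  by_contra! hcon
  obtain ⟨n, rfl⟩ := h.exists_nat_pow_eq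
  refine hy ?_
  clear h hy
  have : ∀ n : ℕ, P ((σ ^ n) x) := by
    intro n
    induction n with
    | zero => exact hx
    | succ n ih =>
      rw [pow_succ', Equiv.Perm.mul_apply]
      exact hcon _ ⟨n, by simp⟩ ih
  exact this n

/-! ### The subdivided prism expansion -/

/-- The involution of the prism expansion: the vertex `(d, 0)` carries the arc-end `d`, and the
vertices `(d, 1)` and `(d, 2)` form two cycles around every vertex. -/
def prismFun (σ : Equiv.Perm (A × Bool)) :
    ((A × Bool) × Fin 3) × Fin 3 → ((A × Bool) × Fin 3) × Fin 3
  | ((d, 0), 0) => ((flipEnd A d, 0), 0)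
  | ((d, 0), 1) => ((d, 1), 2)
  | ((d, 0), 2) => ((d, 2), 2)
  | ((d, 1), 0) => ((σ d, 1), 1)
  | ((d, 1), 1) => ((σ.symm d, 1), 0)
  | ((d, 1), 2) => ((d, 0), 1)
  | ((d, 2), 0) => ((σ d, 2), 1)
  | ((d, 2), 1) => ((σ.symm d, 2), 0)
  | ((d, 2), 2) => ((d, 0), 2)

theorem prismFun_involutive (σ : Equiv.Perm (A × Bool)) :
    Function.Involutive (prismFun σ) := by
  rintro ⟨⟨d, i⟩, j⟩
  fin_cases i <;> fin_cases j <;> simp [prismFun, flipEnd_flipEnd]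

/-- The permutation exchanging the ends of the arcs of the prism expansion. -/
def prismPerm (σ : Equiv.Perm (A × Bool)) : Equiv.Perm (((A × Bool) × Fin 3) × Fin 3) :=
  (prismFun_involutive σ).toPerm

/-- The tail ends of the prism expansion: every vertex `(d, 0)` is a source or a sink. -/
def prismTail : ((A × Bool) × Fin 3) × Fin 3 → Prop
  | ((d, 0), _) => d.2 = false
  | ((d, 1), 2) => d.2 = true
  | ((d, 2), 2) => d.2 = true
  | ((_, 1), 0) => True
  | ((_, 2), 0) => True
  | ((_, 1), 1) => False
  | ((_, 2), 1) => False

theorem prism_isReversal (σ : Equiv.Perm (A × Bool)) :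
    IsReversal (prismPerm σ) prismTail := by
  refine ⟨prismFun_involutive σ, ?_⟩
  rintro ⟨⟨⟨a, b⟩, i⟩, j⟩
  fin_cases i <;> fin_cases j <;> simp [prismPerm, prismFun, prismTail, flipEnd]

/-- The prism expansion of a digraph. -/
def prism (σ : Equiv.Perm (A × Bool)) :
    MultiDigraph ((A × Bool) × Fin 3)
      {δ : ((A × Bool) × Fin 3) × Fin 3 // prismTail δ} :=
  ofEnds (prismPerm σ) prismTail Prod.fst

theorem prismPerm_boundary (σ : Equiv.Perm (A × Bool)) (d : A × Bool) :
    prismPerm σ ((d, 0), 0) = ((flipEnd A d, 0), 0) := rfl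

theorem prismPerm_rim (σ : Equiv.Perm (A × Bool)) (d : A × Bool) {i : Fin 3} (hi : i ≠ 0) :
    prismPerm σ ((d, i), 0) = ((σ d, i), 1) := by
  fin_cases i
  · exact absurd rfl hi
  · rfl
  · rfl

theorem prismPerm_rim' (σ : Equiv.Perm (A × Bool)) (d : A × Bool) {i : Fin 3} (hi : i ≠ 0) :
    prismPerm σ ((d, i), 1) = ((σ.symm d, i), 0) := by
  fin_cases i
  · exact absurd rfl hi
  · rfl
  · rfl

theorem prismPerm_spoke (σ : Equiv.Perm (A × Bool)) (d : A × Bool) {i : Fin 3} (hi : i ≠ 0) :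
    prismPerm σ ((d, i), 2) = ((d, 0), i) := by
  fin_cases i
  · exact absurd rfl hi
  · rfl
  · rfl

theorem prism_isCubic [Finite A] (σ : Equiv.Perm (A × Bool)) : (prism σ).IsCubic :=
  isCubic_ofEnds_fst (prism_isReversal σ)

theorem exists_three_ends [Finite A] [Finite V] {D : MultiDigraph V A}
    (hD : D.IsEdgeConnected 3) (v : V) : ∃ d₁ d₂ d₃ : A × Bool, D.endVertex d₁ = v ∧
      D.endVertex d₂ = v ∧ D.endVertex d₃ = v ∧ d₁ ≠ d₂ ∧ d₁ ≠ d₃ ∧ d₂ ≠ d₃ := by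
  rw [isEdgeConnected_iff_cut] at hD
  have : Nontrivial V := Finite.one_lt_card_iff_nontrivial.1 hD.1
  obtain ⟨w, hw⟩ := exists_ne v
  obtain ⟨a, ha, b, hb, c, hc, hab, hac, hbc⟩ :=
    exists_three_of_le_ncard (hD.2 {v} ⟨v, rfl⟩ ⟨w, hw⟩)
  have key : ∀ a ∈ D.cut {v}, ∃ x, D.endVertex (a, x) = v := by
    intro a ha
    obtain ⟨w, rfl, h | h⟩ := exists_end_mem_of_mem_cut ha
    · exact ⟨false, h⟩
    · exact ⟨true, h⟩
  obtain ⟨x, hx⟩ := key a ha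
  obtain ⟨y, hy⟩ := key b hb
  obtain ⟨z, hz⟩ := key c hc
  exact ⟨_, _, _, hx, hy, hz, by simp [hab], by simp [hac], by simp [hbc]⟩

/-- A cut with at most two arcs cannot split a rim cycle, nor separate the two rims at a vertex, as
there are at least three rungs. Up to a single subdividing vertex it therefore comes from a cut of
`D`, which has at least three arcs. -/
theorem prism_isEdgeConnected [Finite A] [Finite V] {D : MultiDigraph V A}
    {σ : Equiv.Perm (A × Bool)} (hσ : D.IsRotationSystem σ) (hD : D.IsEdgeConnected 3) :
    (prism σ).IsEdgeConnected 3 := by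
  classical
  have hrev := prism_isReversal σ
  have hends := exists_three_ends hD
  have hV : Nonempty V := by
    by_contra hne
    rw [not_nonempty_iff] at hne
    have := hD.1
    simp at this
  have hdart : Nonempty (A × Bool) := by
    obtain ⟨v⟩ := hV
    obtain ⟨d, -⟩ := hends v
    exact ⟨d⟩
  rw [isEdgeConnected_iff_cut] at hD ⊢
  constructor
  · rw [Finite.one_lt_card_iff_nontrivial]
    infer_instance
  intro X hX hX'
  by_contra hlt
  -- no three ends on distinct arcs of the cut
  have hno : ∀ δ₁ δ₂ δ₃ : ((A × Bool) × Fin 3) × Fin 3,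
      ¬ (δ₁.1 ∈ X ↔ (prismPerm σ δ₁).1 ∈ X) → ¬ (δ₂.1 ∈ X ↔ (prismPerm σ δ₂).1 ∈ X) →
      ¬ (δ₃.1 ∈ X ↔ (prismPerm σ δ₃).1 ∈ X) → δ₁ ≠ δ₂ → δ₁ ≠ δ₃ → δ₂ ≠ δ₃ →
      δ₂ ≠ prismPerm σ δ₁ → δ₃ ≠ prismPerm σ δ₁ → δ₃ ≠ prismPerm σ δ₂ → False := by
    intro δ₁ δ₂ δ₃ h1 h2 h3 h12 h13 h23 h12' h13' h23'
    refine hlt (three_le_ncard ((hrev.arcOf_mem_cut Prod.fst X δ₁).2 h1)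
      ((hrev.arcOf_mem_cut Prod.fst X δ₂).2 h2) ((hrev.arcOf_mem_cut Prod.fst X δ₃).2 h3)
      (fun h => ?_) (fun h => ?_) (fun h => ?_))
    · exact (hrev.arcOf_eq h).elim (fun h => h12 h.symm) h12'
    · exact (hrev.arcOf_eq h).elim (fun h => h13 h.symm) h13'
    · exact (hrev.arcOf_eq h).elim (fun h => h23 h.symm) h23'
  -- each of the two cycles around a vertex lies on one side
  have hrim : ∀ i i' : Fin 3, i ≠ 0 → i' ≠ 0 → i ≠ i' → ∀ d e, D.endVertex d = D.endVertex e →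
      (d, i) ∈ X → (e, i) ∈ X := by
    intro i i' hi hi' hii' d e hde hd
    by_contra he
    obtain ⟨d₁, -, h1, h1'⟩ := exists_change_of_sameCycle (P := fun d => (d, i) ∈ X)
      ((hσ d e).2 hde) hd he
    obtain ⟨d₂, -, h2, h2'⟩ := exists_change_of_sameCycle (P := fun d => (d, i) ∉ X)
      ((hσ e d).2 hde.symm) he (not_not.2 hd)
    have h12 : d₁ ≠ d₂ := fun h => h2 (h ▸ h1)
    have key := fun δ h3 h13 h23 h13' h23' => hno ((d₁, i), 0) ((d₂, i), 0) δ
      (by rw [prismPerm_rim σ _ hi]; exact fun h => h1' (h.1 h1))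
      (by rw [prismPerm_rim σ _ hi]; exact fun h => h2' (fun h' => h2 (h.2 h'))) h3
      (by simp [h12]) h13 h23 (by rw [prismPerm_rim σ _ hi]; simp) h13' h23'
    -- A split rim already uses two cut arcs. A third is found on a rung at `d` or `e` if the other
    -- rim does not separate them, and on the other rim if it does.
    by_cases hi'c : (d, i') ∈ X ↔ (e, i') ∈ X
    · obtain ⟨f, hf⟩ : ∃ f, ¬ ((f, i) ∈ X ↔ (f, i') ∈ X) := by
        by_contra! hcon
        exact he ((hcon e).2 (hi'c.1 ((hcon d).1 hd)))
      by_cases hf0 : (f, i) ∈ X ↔ (f, 0) ∈ X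
      · refine key ((f, i'), 2) ?_ ?_ ?_ ?_ ?_
        · rw [prismPerm_spoke σ _ hi']
          dsimp only
          tauto
        · simp
        · simp
        · rw [prismPerm_rim σ _ hi]; simp
        · rw [prismPerm_rim σ _ hi]; simp
      · refine key ((f, i), 2) ?_ ?_ ?_ ?_ ?_
        · rw [prismPerm_spoke σ _ hi]
          exact hf0
        · simp
        · simp
        · rw [prismPerm_rim σ _ hi]; simp
        · rw [prismPerm_rim σ _ hi]; simp
    · obtain ⟨f, -, h3, h3'⟩ := exists_change_of_sameCycle
        (P := fun f => (f, i') ∈ X ↔ (d, i') ∈ X) ((hσ d e).2 hde) Iff.rfl (fun h => hi'c h.symm)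
      refine key ((f, i'), 0) ?_ ?_ ?_ ?_ ?_
      · rw [prismPerm_rim σ _ hi']
        dsimp only
        tauto
      · simp [hii']
      · simp [hii']
      · rw [prismPerm_rim σ _ hi]; simp
      · rw [prismPerm_rim σ _ hi]; simp
  have hrim1 := hrim 1 2 (by decide) (by decide) (by decide)
  have hrim2 := hrim 2 1 (by decide) (by decide) (by decide)
  -- and the two cycles lie on the same side
  have hsame : ∀ d, (d, 1) ∈ X ↔ (d, 2) ∈ X := by
    intro d
    by_contra hcon
    have hrung : ∀ e, D.endVertex e = D.endVertex d → ∃ i : Fin 3, i ≠ 0 ∧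
        ¬ ((e, i) ∈ X ↔ (e, 0) ∈ X) := by
      intro e he
      by_contra! h
      have h1 := h 1 (by decide)
      have h2 := h 2 (by decide)
      have h3 := hrim1 d e he.symm
      have h4 := hrim1 e d he
      have h5 := hrim2 d e he.symm
      have h6 := hrim2 e d he
      tauto
    obtain ⟨d₁, d₂, d₃, h1, h2, h3, h12, h13, h23⟩ := hends (D.endVertex d)
    obtain ⟨i₁, hi₁, hc₁⟩ := hrung d₁ h1
    obtain ⟨i₂, hi₂, hc₂⟩ := hrung d₂ h2
    obtain ⟨i₃, hi₃, hc₃⟩ := hrung d₃ h3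
    refine hno ((d₁, i₁), 2) ((d₂, i₂), 2) ((d₃, i₃), 2) ?_ ?_ ?_ (by simp [h12]) (by simp [h13])
      (by simp [h23]) ?_ ?_ ?_
    · rwa [prismPerm_spoke σ _ hi₁]
    · rwa [prismPerm_spoke σ _ hi₂]
    · rwa [prismPerm_spoke σ _ hi₃]
    · rw [prismPerm_spoke σ _ hi₁]; simp [h12.symm]
    · rw [prismPerm_spoke σ _ hi₁]; simp [h13.symm]
    · rw [prismPerm_spoke σ _ hi₂]; simp [h23.symm]
  let Z : Set V := {v | ∃ d, D.endVertex d = v ∧ (d, 1) ∈ X}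
  have hZ : ∀ d, D.endVertex d ∈ Z ↔ (d, 1) ∈ X := fun d =>
    ⟨fun ⟨e, he, h⟩ => hrim1 e d he h, fun h => ⟨d, rfl, h⟩⟩
  -- A subdividing vertex separated from its rims uses up both cut arcs, so no original arc is cut
  -- in the expansion. Then `d.1` is the only arc of `D.cut Z`, contradicting 3-edge-connectivity.
  by_cases hlonely : ∃ d, ¬ ((d, 0) ∈ X ↔ (d, 1) ∈ X)
  · obtain ⟨d, hd⟩ := hlonely
    have hno' := fun δ h3 h13 h23 h13' h23' => hno ((d, 1), 2) ((d, 2), 2) δ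
      (by rw [prismPerm_spoke σ _ (by decide)]; exact fun h => hd h.symm)
      (by
        rw [prismPerm_spoke σ _ (by decide)]
        exact fun h => hd (h.symm.trans (hsame d).symm)) h3
      (by simp) h13 h23 (by rw [prismPerm_spoke σ _ (by decide)]; simp) h13' h23'
    have huniq : ∀ e, e ≠ d → ((e, 0) ∈ X ↔ (e, 1) ∈ X) := by
      intro e he
      by_contra hcon
      refine hno' ((e, 1), 2) ?_ (by simp [he.symm]) (by simp) ?_ ?_
      · rw [prismPerm_spoke σ _ (by decide)]; exact fun h => hcon h.symm
      · rw [prismPerm_spoke σ _ (by decide)]; simp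
      · rw [prismPerm_spoke σ _ (by decide)]; simp
    have hbd : ∀ e, ((e, 0) ∈ X ↔ (flipEnd A e, 0) ∈ X) := by
      intro e
      by_contra hcon
      refine hno' ((e, 0), 0) hcon (by simp) (by simp) ?_ ?_
      · rw [prismPerm_spoke σ _ (by decide)]; simp
      · rw [prismPerm_spoke σ _ (by decide)]; simp
    have hflip : flipEnd A d ≠ d := by
      intro h
      have := congrArg Prod.snd h
      simp [flipEnd] at this
    have hdZ : ¬ (D.endVertex d ∈ Z ↔ D.endVertex (flipEnd A d) ∈ Z) := by
      rw [hZ, hZ, ← huniq _ hflip, ← hbd]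
      exact fun h => hd h.symm
    have hcut : D.cut Z ⊆ {d.1} := by
      intro a ha
      by_contra hne
      have h1 : (a, false) ≠ d := fun h => hne (congrArg Prod.fst h)
      have h2 : flipEnd A (a, false) ≠ d := fun h => hne (congrArg Prod.fst h)
      have h3 := hbd (a, false)
      rw [huniq _ h1, huniq _ h2, ← hZ, ← hZ] at h3
      exact ha h3
    have h4 := Set.ncard_le_ncard hcut
    rw [Set.ncard_singleton] at h4
    have h5 := hD.2 Z
    by_cases h6 : D.endVertex d ∈ Z
    · have := h5 ⟨_, h6⟩ ⟨D.endVertex (flipEnd A d), fun h => hdZ (by tauto)⟩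
      omega
    · have := h5 ⟨D.endVertex (flipEnd A d), by tauto⟩ ⟨_, h6⟩
      omega
  · push Not at hlonely
    have hall : ∀ d (i : Fin 3), (d, i) ∈ X ↔ D.endVertex d ∈ Z := by
      intro d i
      rw [hZ]
      fin_cases i
      · exact hlonely d
      · exact Iff.rfl
      · exact (hsame d).symm
    obtain ⟨⟨d, i⟩, hd⟩ := hX
    obtain ⟨⟨e, j⟩, he⟩ := hX'
    have h5 := hD.2 Z ⟨_, (hall d i).1 hd⟩ ⟨D.endVertex e, fun h => he ((hall e j).2 h)⟩
    obtain ⟨a, ha, b, hb, c, hc, hab, hac, hbc⟩ := exists_three_of_le_ncard h5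
    have hbd : ∀ a ∈ D.cut Z, ¬ ((((a, false), 0) : (A × Bool) × Fin 3) ∈ X ↔
        (flipEnd A (a, false), 0) ∈ X) := by
      intro a ha
      rw [hall, hall]
      exact ha
    refine hno (((a, false), 0), 0) (((b, false), 0), 0) (((c, false), 0), 0) (hbd a ha)
      (hbd b hb) (hbd c hc) (by simp [hab]) (by simp [hac]) (by simp [hbc]) ?_ ?_ ?_
    all_goals
      rw [prismPerm_boundary]
      simp [flipEnd]

/-- The arc of the prism expansion that comes from the arc `a`. -/
def prismArc (a : A) : {δ : ((A × Bool) × Fin 3) × Fin 3 // prismTail δ} :=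
  ⟨(((a, false), 0), 0), rfl⟩

theorem arcOf_boundary (σ : Equiv.Perm (A × Bool)) (d : A × Bool) :
    (prism_isReversal σ).arcOf ((d, 0), 0) = prismArc d.1 := by
  obtain ⟨a, b⟩ := d
  cases b
  · exact (prism_isReversal σ).arcOf_of_tail _
  · rw [← IsReversal.arcOf_flip]
    exact (prism_isReversal σ).arcOf_of_tail (δ := (((a, false), 0), 0)) _

theorem even_iff_sum_indicator [Finite W] {α : Equiv.Perm (W × Fin 3)} {o : W × Fin 3 → Prop}
    (h : IsReversal α o) (E : Set {δ // o δ}) (w : W) :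
    Even ((ofEnds α o Prod.fst).degreeIn E w) ↔ ∑ j, h.indicator E (w, j) = 0 := by
  rw [← degreeIn_fst_cast, ZMod.natCast_eq_zero_iff_even]

theorem IsReversal.indicator_flip {α : Equiv.Perm Δ} {o : Δ → Prop} (h : IsReversal α o)
    (E : Set {δ // o δ}) (δ : Δ) : h.indicator E (α δ) = h.indicator E δ := by
  classical
  exact if_congr (by rw [h.arcOf_flip]) rfl rfl

/-! ### Parity and directed cuts in the prism expansion -/

section prism

variable {D : MultiDigraph V A} {σ : Equiv.Perm (A × Bool)}

/-- At a rim vertex the spoke equals the sum of the two rim arcs modulo two. Around the rim every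
rim arc occurs twice. -/
theorem sum_spokes_eq_zero [Fintype A] (hσ : D.IsRotationSystem σ)
    {E : Set {δ : ((A × Bool) × Fin 3) × Fin 3 // prismTail δ}}
    (hE : ∀ w, Even ((prism σ).degreeIn E w)) (v : V) [DecidableEq V] {i : Fin 3} (hi : i ≠ 0) :
    ∑ d with D.endVertex d = v, (prism_isReversal σ).indicator E ((d, 0), i) = 0 := by
  set h := prism_isReversal σ
  have h1 : ∀ d, h.indicator E ((d, 0), i) =
      h.indicator E ((d, i), 0) + h.indicator E ((σ.symm d, i), 0) := by
    intro d
    have := (even_iff_sum_indicator h E (d, i)).1 (hE (d, i))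
    rw [Fin.sum_univ_three] at this
    rw [← prismPerm_spoke σ d hi, h.indicator_flip, ← prismPerm_rim' σ d hi, h.indicator_flip]
    have h2 := CharTwo.add_eq_zero.1 this
    exact h2.symm
  rw [Finset.sum_congr rfl fun d _ => h1 d, Finset.sum_add_distrib,
    sum_fiber_rotation hσ (fun d => h.indicator E ((d, i), 0)), CharTwo.add_self_eq_zero]

theorem indicator_boundary (E : Set {δ : ((A × Bool) × Fin 3) × Fin 3 // prismTail δ})
    (d : A × Bool) [Decidable (d.1 ∈ {a | prismArc a ∈ E})] :
    (prism_isReversal σ).indicator E ((d, 0), 0) = if d.1 ∈ {a | prismArc a ∈ E} then 1 else 0 := by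
  classical
  exact if_congr (by rw [arcOf_boundary]; rfl) rfl rfl

/-- At a subdividing vertex the original arc is the sum of the two spokes, and spokes of either kind
sum to zero around `v`. -/
theorem even_degreeIn_of_prism [Fintype A] (hσ : D.IsRotationSystem σ)
    {E : Set {δ : ((A × Bool) × Fin 3) × Fin 3 // prismTail δ}}
    (hE : ∀ w, Even ((prism σ).degreeIn E w)) (v : V) :
    Even (D.degreeIn {a | prismArc a ∈ E} v) := by
  classical
  set h := prism_isReversal σ
  rw [← ZMod.natCast_eq_zero_iff_even, degreeIn_cast_eq_sum]
  have h1 : ∀ d, (if d.1 ∈ {a | prismArc a ∈ E} then (1 : ZMod 2) else 0) =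
      h.indicator E ((d, 0), 1) + h.indicator E ((d, 0), 2) := by
    intro d
    have := (even_iff_sum_indicator h E (d, 0)).1 (hE (d, 0))
    rw [Fin.sum_univ_three, add_assoc] at this
    rw [← CharTwo.add_eq_zero.1 this]
    exact (indicator_boundary E d).symm
  rw [Finset.sum_congr rfl fun d _ => h1 d, Finset.sum_add_distrib,
    sum_spokes_eq_zero hσ hE v (by decide), sum_spokes_eq_zero hσ hE v (by decide), add_zero]

/-- If no original arc at `v` were in `E`, then every covered subdividing vertex would use both of
its spokes. All three spokes to one rim would be in `E`, against their even number. -/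
theorem exists_boundary_mem_of_prism [Fintype A] (hσ : D.IsRotationSystem σ) (hD : D.IsCubic)
    {E : Set {δ : ((A × Bool) × Fin 3) × Fin 3 // prismTail δ}}
    (hE : ∀ w, Even ((prism σ).degreeIn E w))
    (hcov : ∀ d : A × Bool, (prism σ).degreeIn E (d, 0) ≠ 0) (v : V) :
    D.degreeIn {a | prismArc a ∈ E} v ≠ 0 := by
  classical
  set h := prism_isReversal σ
  intro h0
  rw [degreeIn_eq_ncard, Set.ncard_eq_zero] at h0
  have h1 : ∀ d, D.endVertex d = v → h.indicator E ((d, 0), 1) = 1 := by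
    intro d hd
    have hz : h.indicator E ((d, 0), 0) = 0 := by
      rw [indicator_boundary, if_neg]
      intro hmem
      have : d ∈ D.endsIn {a | prismArc a ∈ E} v := ⟨hmem, hd⟩
      rw [h0] at this
      exact this
    have hs := (even_iff_sum_indicator h E (d, 0)).1 (hE (d, 0))
    rw [Fin.sum_univ_three, hz, zero_add] at hs
    have heq := CharTwo.add_eq_zero.1 hs
    by_contra hne
    have hno : ∀ j, h.arcOf ((d, 0), j) ∉ E := by
      have hi : ∀ j, h.indicator E ((d, 0), j) = 0 → h.arcOf ((d, 0), j) ∉ E := by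
        intro j hj hmem
        simp [IsReversal.indicator, hmem] at hj
      have h1z : h.indicator E ((d, 0), 1) = 0 := by
        have : ∀ x : ZMod 2, x ≠ 1 → x = 0 := by decide
        exact this _ hne
      intro j
      apply hi
      fin_cases j
      · exact hz
      · exact h1z
      · exact heq ▸ h1z
    refine hcov d ?_
    rw [prism, h.degreeIn, Set.ncard_eq_zero]
    ext ⟨w, j⟩
    simp only [Set.mem_ofPred_eq, Set.mem_empty_iff_false, iff_false]
    rintro ⟨rfl, hmem⟩
    exact hno j hmem
  have hsum := sum_spokes_eq_zero hσ hE v (i := 1) (by decide)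
  have hsum' : ∑ d with D.endVertex d = v, (1 : ZMod 2) = 0 := by
    rw [← hsum]
    exact Finset.sum_congr rfl fun d hd => (h1 d (by simpa using hd)).symm
  have h3 := degreeIn_cast_eq_sum D Set.univ v
  simp only [Set.mem_univ, if_true] at h3
  rw [hsum', hD v] at h3
  exact absurd h3 (by decide)

/-- The side of the cut is pulled back along the map collapsing each prism to its vertex; only
original arcs cross. -/
theorem prism_containsDirectedCut (hσ : D.IsRotationSystem σ) [Nonempty A] (hD : D.IsConnected)
    {M : Set A} {M' : Set {δ : ((A × Bool) × Fin 3) × Fin 3 // prismTail δ}}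
    (hM : ∀ a ∈ M, prismArc a ∈ M') (h : D.ContainsDirectedCut M) :
    (prism σ).ContainsDirectedCut M' := by
  have hend := exists_end_of_isConnected hD
  obtain ⟨_, hBM, X, ⟨x, hx⟩, ⟨y, hy⟩, hX, rfl⟩ := h
  obtain ⟨d, rfl⟩ := hend x
  obtain ⟨e, rfl⟩ := hend y
  have key : ∀ δ : ((A × Bool) × Fin 3) × Fin 3,
      ¬ (D.endVertex δ.1.1 ∈ X ↔ D.endVertex (prismPerm σ δ).1.1 ∈ X) → δ.1.2 = 0 ∧ δ.2 = 0 := by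
    rintro ⟨⟨d, i⟩, j⟩
    fin_cases i <;> fin_cases j <;>
      simp [prismPerm, prismFun, hσ.endVertex, hσ.endVertex_symm]
  have key' : ∀ a : {δ : ((A × Bool) × Fin 3) × Fin 3 // prismTail δ},
      ¬ (D.endVertex ((prism σ).src a).1 ∈ X ↔ D.endVertex ((prism σ).tgt a).1 ∈ X) →
      ∃ b, a = prismArc b := by
    rintro ⟨⟨⟨⟨b, c⟩, i⟩, j⟩, ha⟩ hcut
    obtain ⟨rfl, rfl⟩ : i = 0 ∧ j = 0 := key (((b, c), i), j) hcut
    obtain rfl : c = false := ha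
    exact ⟨b, rfl⟩
  refine ⟨_, ?_, {w | D.endVertex w.1 ∈ X}, ⟨(d, 0), hx⟩, ⟨(e, 0), hy⟩, ?_, rfl⟩
  · rintro a ⟨h1, h2⟩
    obtain ⟨b, rfl⟩ := key' a (fun h => h2 (h.1 h1))
    exact hM b (hBM ⟨h1, h2⟩)
  · rintro a ⟨h1, h2⟩
    obtain ⟨b, rfl⟩ := key' a (fun h => h1 (h.2 h2))
    exact hX b ⟨h1, h2⟩

/-- This is what the orientation of the spokes is for: an arc set whose complement contains no
directed cut must meet every subdividing vertex. -/
theorem prism_source_or_sink (σ : Equiv.Perm (A × Bool)) (d : A × Bool) :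
    (prism σ).ContainsDirectedCut {a | (prism σ).src a = (d, 0) ∨ (prism σ).tgt a = (d, 0)} := by
  have htail : ∀ j, prismTail ((d, 0), j) ↔ d.2 = false := fun j => Iff.rfl
  have hne : ((d, 1) : (A × Bool) × Fin 3) ≠ (d, 0) := by simp
  by_cases hd : d.2 = false
  · refine ⟨_, ?_, {(d, 0)}, ⟨_, rfl⟩, ⟨_, hne⟩, ?_, rfl⟩
    · rintro a ⟨h, -⟩
      exact Or.inl h
    · rintro ⟨δ, hδ⟩ ⟨-, h⟩
      have h1 := ((prism_isReversal σ).tail δ).not.2 (not_not.2 hδ)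
      change (prismPerm σ δ).1 = (d, 0) at h
      rw [← Prod.mk.eta (p := prismPerm σ δ), h] at h1
      exact h1 hd
  · refine ⟨_, ?_, {(d, 0)}ᶜ, ⟨_, hne⟩, ⟨(d, 0), by simp⟩, ?_, rfl⟩
    · rintro a ⟨-, h⟩
      exact Or.inr (not_not.1 h)
    · rintro ⟨δ, hδ⟩ ⟨h, -⟩
      have h : δ.1 = (d, 0) := not_not.1 h
      rw [← Prod.mk.eta (p := δ), h] at hδ
      exact hd hδ

end prism

/-! ### Hochstättler's conjecture and its cubic form -/

theorem nonempty_of_isEdgeConnected {D : MultiDigraph V A} (hD : D.IsEdgeConnected 3) :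
    Nonempty A ∧ D.IsConnected := by
  have h0 := hD.2 ∅ (by simp)
  have hne : ¬ Subsingleton V := by
    intro h
    have h1 := hD.1
    rcases isEmpty_or_nonempty V with h2 | ⟨⟨v⟩⟩
    · simp at h1
    · rw [Nat.card_eq_one_iff_unique.2 ⟨h, ⟨v⟩⟩] at h1
      omega
  obtain ⟨u, v, huv⟩ := (not_subsingleton_iff_nontrivial.1 hne).exists_pair_ne
  constructor
  · obtain ⟨a, -⟩ := ((isConnected_iff_cut _).1 h0).2 {u} ⟨u, rfl⟩ ⟨v, huv.symm⟩
    exact ⟨a.1⟩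
  · rw [isConnected_iff_cut] at h0 ⊢
    refine ⟨h0.1, fun X hX hX' => ?_⟩
    obtain ⟨a, ha⟩ := h0.2 X hX hX'
    exact ⟨a.1, ha⟩

/-- The two forms of Hochstättler's conjecture are equivalent. -/
theorem hochstaettler_iff :
    (∀ (V A : Type) [Finite V] [Finite A] (D : MultiDigraph V A),
        D.IsEdgeConnected 3 →
          ∃ E : Set A, D.IsEvenSubgraph E ∧ (D.contract E).IsStronglyConnected) ↔
      (∀ (V A : Type) [Finite V] [Finite A] (D : MultiDigraph V A),
        D.IsEdgeConnected 3 → D.IsCubic →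
          ∃ M : Set A, D.IsPerfectMatching M ∧ ¬ D.ContainsDirectedCut M) := by
  constructor
  · intro hyp V A _ _ D hD h3
    have := Fintype.ofFinite A
    obtain ⟨hA, hcon⟩ := nonempty_of_isEdgeConnected hD
    obtain ⟨σ, hσ⟩ := D.exists_isRotationSystem
    obtain ⟨E, hE, hstr⟩ := hyp _ _ (prism σ) (prism_isEdgeConnected hσ hD)
    have heven := hE.even_degreeIn
    rw [isStronglyConnected_contract_iff] at hstr
    have hcov : ∀ d : A × Bool, (prism σ).degreeIn E (d, 0) ≠ 0 := by
      intro d h0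
      refine hstr.2 ?_
      obtain ⟨B, hB, hcut⟩ := prism_source_or_sink σ d
      refine ⟨B, fun a ha haE => ?_, hcut⟩
      rw [degreeIn_eq_ncard, Set.ncard_eq_zero] at h0
      rcases hB ha with h | h
      · have : (a, false) ∈ (prism σ).endsIn E (d, 0) := ⟨haE, h⟩
        rw [h0] at this
        exact this
      · have : (a, true) ∈ (prism σ).endsIn E (d, 0) := ⟨haE, h⟩
        rw [h0] at this
        exact this
    refine ⟨{a | prismArc a ∈ E}ᶜ, fun v => ?_, fun hcut => hstr.2 ?_⟩
    · have h1 := exists_boundary_mem_of_prism hσ h3 heven hcov v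
      have h2 := even_degreeIn_of_prism hσ heven v
      have h4 := D.degreeIn_compl_add {a | prismArc a ∈ E} v
      rw [h3 v] at h4
      obtain ⟨k, hk⟩ := h2
      -- The degree in the restricted even subgraph is even, non-zero and at most three, hence two;
      -- one arc-end is left for the matching.
      omega
    · exact prism_containsDirectedCut hσ hcon (fun a ha => ha) hcut
  · intro hyp V A _ _ D hD
    have := Fintype.ofFinite A
    obtain ⟨hA, hcon⟩ := nonempty_of_isEdgeConnected hD
    obtain ⟨σ, hσ⟩ := D.exists_isRotationSystem
    obtain ⟨M, hM, hcut⟩ := hyp _ _ (prism σ) (prism_isEdgeConnected hσ hD) (prism_isCubic σ)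
    refine ⟨{a | prismArc a ∈ Mᶜ}, isEvenSubgraph_of_even _ _ fun v => ?_, ?_⟩
    · refine even_degreeIn_of_prism hσ (fun w => ?_) v
      have h1 := (prism σ).degreeIn_compl_add M w
      rw [hM w, prism_isCubic σ w] at h1
      exact ⟨1, by omega⟩
    · rw [isStronglyConnected_contract_iff]
      refine ⟨hcon.1, fun h => hcut (prism_containsDirectedCut hσ hcon (fun a ha => ?_) h)⟩
      exact not_not.1 ha

/-! ### Duals of 3-edge-connected digraphs are oriented -/

theorem IsEdgeConnected.three_le_of_containsDirectedCut [Finite A] {D : MultiDigraph V A}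
    (hD : D.IsEdgeConnected 3) {S : Set A} (hS : D.ContainsDirectedCut S) : 3 ≤ S.ncard := by
  obtain ⟨_, hBS, X, hX, hX', hno, rfl⟩ := hS
  rw [isEdgeConnected_iff_cut] at hD
  refine (hD.2 X hX hX').trans (Set.ncard_le_ncard fun a ha => hBS ?_)
  have h1 := hno a
  simp only [cut, Set.mem_ofPred_eq] at ha ⊢
  tauto

/-- A directed cycle of length at most two in the dual is a non-negative circulation whose support
would contain a directed cut with at most two arcs. -/
theorem IsDualPair.isOriented [Finite V] [Finite A] [Finite F] {D : MultiDigraph V A}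
    {D' : MultiDigraph F A} {σ : Equiv.Perm (A × Bool)} (h : IsDualPair D D' σ)
    (hD : D.IsEdgeConnected 3) : D'.IsOriented := by
  classical
  have := Fintype.ofFinite A
  have key : ∀ a b, D'.tgt a = D'.src b → D'.tgt b = D'.src a → False := by
    intro a b hab hba
    have h1 := h.exists_isDirectedCut
      (fun c => (Pi.single a 1 : A → ℚ) c + (Pi.single b 1 : A → ℚ) c)
      (fun c => add_nonneg
        (by rw [Pi.single_apply]; split_ifs <;> norm_num)
        (by rw [Pi.single_apply]; split_ifs <;> norm_num))
      ⟨a, by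
        have : (0 : ℚ) ≤ (Pi.single b 1 : A → ℚ) a := by
          rw [Pi.single_apply]; split_ifs <;> norm_num
        simp only [Pi.single_eq_same]
        positivity⟩
      (by
        intro ρ
        simp only [add_mul, Finset.sum_add_distrib, Pi.single_apply, ite_mul, one_mul, zero_mul,
          Finset.sum_ite_eq', Finset.mem_univ, if_true, coboundary_apply, hab, hba]
        ring)
    have h2 := hD.three_le_of_containsDirectedCut h1
    have h3 : {c | (Pi.single a 1 : A → ℚ) c + (Pi.single b 1 : A → ℚ) c ≠ 0} ⊆ {a, b} := by
      intro c hc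
      by_contra hcon
      simp only [Set.mem_insert_iff, Set.mem_singleton_iff, not_or] at hcon
      exact hc (by simp [hcon.1, hcon.2])
    have h4 := Set.ncard_le_ncard h3
    have h5 := Set.ncard_insert_le a {b}
    rw [Set.ncard_singleton] at h5
    omega
  rw [isOriented_iff_arcs]
  -- A loop is the case `a = b`, where the circulation has the value two on `a`.
  exact ⟨fun a ha => key a a ha.symm ha.symm, key⟩

/-! ### The octahedral refinement of a planar dual -/

section gadget

variable (σ : Equiv.Perm (A × Bool))

/-- The corners of the refined triangulation, in positive order around each triangle. -/
def octaRot : Equiv.Perm ((A × Bool) × Fin 7) where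
  toFun
    | (d, 0) => (d, 1)
    | (d, 1) => (d, 2)
    | (d, 2) => (d, 0)
    | (d, 3) => (d, 4)
    | (d, 4) => (d, 5)
    | (d, 5) => (d, 3)
    | (d, 6) => (σ d, 6)
  invFun
    | (d, 0) => (d, 2)
    | (d, 1) => (d, 0)
    | (d, 2) => (d, 1)
    | (d, 3) => (d, 5)
    | (d, 4) => (d, 3)
    | (d, 5) => (d, 4)
    | (d, 6) => (σ.symm d, 6)
  left_inv := by
    rintro ⟨d, i⟩
    fin_cases i <;> simp
  right_inv := by
    rintro ⟨d, i⟩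
    fin_cases i <;> simp

/-- The gluing of the corners of the refined triangulation along its edges. -/
def octaFun : (A × Bool) × Fin 7 → (A × Bool) × Fin 7
  | (d, 0) => (flipEnd A d, 0)
  | (d, 1) => (d, 3)
  | (d, 2) => (σ.symm d, 4)
  | (d, 3) => (d, 1)
  | (d, 4) => (σ d, 2)
  | (d, 5) => (d, 6)
  | (d, 6) => (d, 5)

theorem octaFun_involutive : Function.Involutive (octaFun σ) := by
  rintro ⟨d, i⟩
  fin_cases i <;> simp [octaFun, flipEnd_flipEnd]

/-- The permutation given by `octaFun`. -/
def octaPerm : Equiv.Perm ((A × Bool) × Fin 7) := (octaFun_involutive σ).toPerm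

/-- The tail ends in the refined triangulation. -/
def octaTail : (A × Bool) × Fin 7 → Prop
  | (d, 0) => d.2 = false
  | (d, 1) => d.2 = false
  | (d, 2) => d.2 = false
  | (d, 3) => d.2 = true
  | (d, 4) => (σ d).2 = true
  | (_, 5) => False
  | (_, 6) => True

/-- The vertex of the refined triangulation at a corner: a face or an inner vertex. -/
def octaVertex : (A × Bool) × Fin 7 →
    Quotient (Equiv.Perm.SameCycle.setoid (σ * flipEnd A)) ⊕ (A × Bool)
  | (d, 0) => Sum.inl (faceOf σ d)
  | (d, 1) => Sum.inl (faceOf σ (σ d))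
  | (d, 2) => Sum.inr d
  | (d, 3) => Sum.inr d
  | (d, 4) => Sum.inl (faceOf σ (σ d))
  | (d, 5) => Sum.inr (σ d)
  | (d, 6) => Sum.inr d

/-- The triangle of a corner. -/
def octaTriangle (D : MultiDigraph V A) : (A × Bool) × Fin 7 → (A × Bool) ⊕ (A × Bool) ⊕ V
  | (d, 0) => Sum.inl d
  | (d, 1) => Sum.inl d
  | (d, 2) => Sum.inl d
  | (d, 3) => Sum.inr (Sum.inl d)
  | (d, 4) => Sum.inr (Sum.inl d)
  | (d, 5) => Sum.inr (Sum.inl d)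
  | (d, 6) => Sum.inr (Sum.inr (D.endVertex d))

theorem octa_isReversal : IsReversal (octaPerm σ) (octaTail σ) := by
  refine ⟨octaFun_involutive σ, ?_⟩
  rintro ⟨⟨a, b⟩, i⟩
  fin_cases i <;> simp [octaPerm, octaFun, octaTail, flipEnd]

theorem octaTriangle_iff {D : MultiDigraph V A} (hσ : D.IsRotationSystem σ)
    (x y : (A × Bool) × Fin 7) :
    (octaRot σ).SameCycle x y ↔ octaTriangle D x = octaTriangle D y := by
  have hstep : ∀ x, (octaRot σ).SameCycle x (octaRot σ x) := sameCycle_next _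
  have h01 : ∀ d, (octaRot σ).SameCycle (d, 0) (d, 1) := fun d => hstep (d, 0)
  have h02 : ∀ d, (octaRot σ).SameCycle (d, 0) (d, 2) := fun d => (h01 d).trans (hstep (d, 1))
  have h34 : ∀ d, (octaRot σ).SameCycle (d, 3) (d, 4) := fun d => hstep (d, 3)
  have h35 : ∀ d, (octaRot σ).SameCycle (d, 3) (d, 5) := fun d => (h34 d).trans (hstep (d, 4))
  have h6 : ∀ d d', D.endVertex d = D.endVertex d' → (octaRot σ).SameCycle (d, 6) (d', 6) := by
    intro d d' h
    exact SameCycle.of_setoid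
      ((Equiv.Perm.SameCycle.setoid (octaRot σ)).comap fun d => (d, (6 : Fin 7)))
      (fun d => hstep (d, 6)) ((hσ d d').2 h)
  constructor
  · refine eq_of_sameCycle ?_
    rintro ⟨d, i⟩
    fin_cases i <;> simp [octaRot, octaTriangle, hσ.endVertex]
  · obtain ⟨d, i⟩ := x
    obtain ⟨d', j⟩ := y
    intro h
    have hl : ∀ x : (A × Bool) × Fin 7, (octaRot σ).SameCycle x
        (match octaTriangle D x with
          | Sum.inl d => (d, 0)
          | Sum.inr (Sum.inl d) => (d, 3)
          | Sum.inr (Sum.inr _) => (x.1, 6)) := by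
      rintro ⟨d, i⟩
      fin_cases i
      · exact .refl _ _
      · exact (h01 d).symm
      · exact (h02 d).symm
      · exact .refl _ _
      · exact (h34 d).symm
      · exact (h35 d).symm
      · exact .refl _ _
    have h1 := hl (d, i)
    have h2 := hl (d', j)
    rw [← h] at h2
    rcases hc : octaTriangle D (d, i) with e | e | v
    · rw [hc] at h1 h2
      exact h1.trans h2.symm
    · rw [hc] at h1 h2
      exact h1.trans h2.symm
    · rw [hc] at h1 h2 h
      have hv : ∀ d i, octaTriangle D (d, i) = Sum.inr (Sum.inr v) → D.endVertex d = v := by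
        intro d i hd
        fin_cases i <;> simp [octaTriangle] at hd
        exact hd
      exact h1.trans ((h6 d d' ((hv d i hc).trans (hv d' j h.symm).symm)).trans h2.symm)

/-- The corners at a face vertex are traversed in the cyclic order of the old face, three for each
arc-end; those at an inner vertex form one cycle of four corners. -/
theorem octaVertex_iff (x y : (A × Bool) × Fin 7) :
    (octaRot σ * octaPerm σ).SameCycle x y ↔ octaVertex σ x = octaVertex σ y := by
  set π := octaRot σ * octaPerm σ with hπ
  have hstep : ∀ x y, octaRot σ (octaFun σ x) = y → π.SameCycle x y := fun x y h =>
    h ▸ sameCycle_next π x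
  have f1 : ∀ d, π.SameCycle (d, 0) (flipEnd A d, 1) := fun d => hstep _ _ rfl
  have f2 : ∀ d, π.SameCycle (d, 1) (d, 4) := fun d => hstep _ _ rfl
  have f3 : ∀ d, π.SameCycle (d, 4) (σ d, 0) := fun d => hstep _ _ rfl
  have p1 : ∀ d, π.SameCycle (σ d, 2) (d, 5) := fun d => hstep _ _ (by
    change octaRot σ (σ.symm (σ d), 4) = _
    rw [Equiv.symm_apply_apply]; rfl)
  have p2 : ∀ d, π.SameCycle (d, 5) (σ d, 6) := fun d => hstep _ _ rfl
  have p3 : ∀ d, π.SameCycle (d, 6) (d, 3) := fun d => hstep _ _ rfl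
  have p4 : ∀ d, π.SameCycle (d, 3) (d, 2) := fun d => hstep _ _ rfl
  have hface : ∀ d d', faceOf σ d = faceOf σ d' → π.SameCycle (d, 0) (d', 0) := by
    intro d d' h
    refine SameCycle.of_setoid
      ((Equiv.Perm.SameCycle.setoid π).comap fun d => (d, (0 : Fin 7))) (fun d => ?_)
      ((faceOf_eq_iff σ d d').2 h)
    exact (f1 d).trans ((f2 _).trans (f3 _))
  constructor
  · refine eq_of_sameCycle ?_
    rintro ⟨d, i⟩
    fin_cases i
    · exact congrArg Sum.inl (faceOf_next σ d)
    · rfl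
    · exact congrArg Sum.inr (σ.apply_symm_apply d)
    · rfl
    · rfl
    · rfl
    · rfl
  · have hl : ∀ x : (A × Bool) × Fin 7, (∃ d, π.SameCycle x (d, 0) ∧
        octaVertex σ x = Sum.inl (faceOf σ d)) ∨
        ∃ d, π.SameCycle x (d, 2) ∧ octaVertex σ x = Sum.inr d := by
      rintro ⟨d, i⟩
      fin_cases i
      · exact Or.inl ⟨d, .refl _ _, rfl⟩
      · exact Or.inl ⟨σ d, (f2 d).trans (f3 d), rfl⟩
      · exact Or.inr ⟨d, .refl _ _, rfl⟩
      · exact Or.inr ⟨d, p4 d, rfl⟩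
      · exact Or.inl ⟨σ d, f3 d, rfl⟩
      · exact Or.inr ⟨σ d, (p1 d).symm, rfl⟩
      · exact Or.inr ⟨d, (p3 d).trans (p4 d), rfl⟩
    intro h
    rcases hl x with ⟨d, hd, hd'⟩ | ⟨d, hd, hd'⟩ <;>
      rcases hl y with ⟨e, he, he'⟩ | ⟨e, he, he'⟩ <;>
      rw [hd', he'] at h
    · exact hd.trans ((hface d e (Sum.inl.inj h)).trans he.symm)
    · exact absurd h (by simp)
    · exact absurd h (by simp)
    · rw [Sum.inr.inj h] at hd
      exact hd.trans he.symm

/-- The dual of a cubic plane digraph, with an octahedron inserted into every triangle. -/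
def octa : MultiDigraph (Quotient (Equiv.Perm.SameCycle.setoid (σ * flipEnd A)) ⊕ (A × Bool))
    {x // octaTail σ x} :=
  ofEnds (octaPerm σ) (octaTail σ) (octaVertex σ)

theorem octa_adj_dual (a : A) :
    (octa σ).Adj (Sum.inl (faceOf σ (a, false))) (Sum.inl (faceOf σ (a, true))) :=
  ⟨⟨((a, false), 0), rfl⟩, rfl, rfl⟩

theorem octa_adj_inner (d : A × Bool) : (octa σ).Adj (Sum.inr d) (Sum.inr (σ d)) :=
  ⟨⟨(d, 6), trivial⟩, rfl, rfl⟩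

theorem octa_adj_in (d : A × Bool) :
    (octa σ).Adj (Sum.inl (faceOf σ (d.1, true))) (Sum.inr d) := by
  obtain ⟨a, b⟩ := d
  cases b
  · exact ⟨⟨((a, false), 1), rfl⟩, congrArg Sum.inl (faceOf_rot σ (a, false)), rfl⟩
  · refine ⟨⟨(σ.symm (a, true), 4), ?_⟩, ?_, ?_⟩
    · change (σ (σ.symm (a, true))).2 = true
      rw [Equiv.apply_symm_apply]
    · change Sum.inl (faceOf σ (σ (σ.symm (a, true)))) = _
      rw [Equiv.apply_symm_apply]
    · change Sum.inr (σ (σ.symm (a, true))) = _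
      rw [Equiv.apply_symm_apply]

theorem octa_adj_out (d : A × Bool) :
    (octa σ).Adj (Sum.inr d) (Sum.inl (faceOf σ (d.1, false))) := by
  obtain ⟨a, b⟩ := d
  cases b
  · refine ⟨⟨((a, false), 2), rfl⟩, rfl, ?_⟩
    change Sum.inl (faceOf σ (σ (σ.symm (a, false)))) = _
    rw [Equiv.apply_symm_apply]
  · exact ⟨⟨((a, true), 3), rfl⟩, rfl, congrArg Sum.inl (faceOf_rot σ (a, true))⟩

theorem octa_arc_cases (x : {x // octaTail σ x}) :
    (∃ a, (octa σ).src x = Sum.inl (faceOf σ (a, false)) ∧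
      (octa σ).tgt x = Sum.inl (faceOf σ (a, true))) ∨
    (∃ d, (octa σ).src x = Sum.inr d ∧ (octa σ).tgt x = Sum.inr (σ d)) ∨
    (∃ d, (octa σ).src x = Sum.inl (faceOf σ (d.1, true)) ∧ (octa σ).tgt x = Sum.inr d) ∨
    (∃ d, (octa σ).src x = Sum.inr d ∧ (octa σ).tgt x = Sum.inl (faceOf σ (d.1, false))) := by
  obtain ⟨⟨d, i⟩, hx⟩ := x
  fin_cases i
  · obtain ⟨a, b⟩ := d
    obtain rfl : b = false := hx
    exact Or.inl ⟨a, rfl, rfl⟩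
  · obtain ⟨a, b⟩ := d
    obtain rfl : b = false := hx
    exact Or.inr (Or.inr (Or.inl ⟨(a, false), congrArg Sum.inl (faceOf_rot σ (a, false)), rfl⟩))
  · obtain ⟨a, b⟩ := d
    obtain rfl : b = false := hx
    refine Or.inr (Or.inr (Or.inr ⟨(a, false), rfl, ?_⟩))
    change Sum.inl (faceOf σ (σ (σ.symm (a, false)))) = _
    rw [Equiv.apply_symm_apply]
  · obtain ⟨a, b⟩ := d
    obtain rfl : b = true := hx
    exact Or.inr (Or.inr (Or.inr ⟨(a, true), rfl, congrArg Sum.inl (faceOf_rot σ (a, true))⟩))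
  · refine Or.inr (Or.inr (Or.inl ⟨σ d, ?_, rfl⟩))
    have h : σ d = ((σ d).1, true) := Prod.ext rfl hx
    change Sum.inl (faceOf σ (σ d)) = _
    rw [← h]
  · exact absurd hx id
  · exact Or.inr (Or.inl ⟨d, rfl, rfl⟩)

end gadget

/-- An inner vertex receives an arc from the head of its dual arc and sends one to the tail, so a
2-cycle between an inner vertex and a face would require a dual loop. The inner cycles are too long
for loops or 2-cycles by `h1` and `h2`. -/
theorem octa_isOriented {σ : Equiv.Perm (A × Bool)} (hd : (dual σ).IsOriented)
    (h1 : ∀ d, σ d ≠ d) (h2 : ∀ d, σ (σ d) ≠ d) : (octa σ).IsOriented := by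
  rw [isOriented_iff_arcs] at hd ⊢
  have hl : ∀ a, faceOf σ (a, false) ≠ faceOf σ (a, true) := hd.1
  constructor
  · intro x hx
    rcases octa_arc_cases σ x with ⟨a, e1, e2⟩ | ⟨a, e1, e2⟩ | ⟨a, e1, e2⟩ | ⟨a, e1, e2⟩ <;>
      rw [e1, e2] at hx <;> simp at hx
    · exact hl a hx
    · exact h1 a hx.symm
  · intro x y hxy hyx
    rcases octa_arc_cases σ x with ⟨a, e1, e2⟩ | ⟨a, e1, e2⟩ | ⟨a, e1, e2⟩ | ⟨a, e1, e2⟩ <;>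
    rcases octa_arc_cases σ y with ⟨b, e3, e4⟩ | ⟨b, e3, e4⟩ | ⟨b, e3, e4⟩ | ⟨b, e3, e4⟩ <;>
      rw [e2, e3] at hxy <;> rw [e1, e4] at hyx <;> simp at hxy hyx
    · exact hd.2 a b hxy hyx
    · exact h2 a (by rw [hxy, hyx])
    · rw [hxy] at hyx
      exact hl _ hyx
    · rw [hyx] at hxy
      exact hl _ hxy

theorem octa_isConnected {σ : Equiv.Perm (A × Bool)} (h : (dual σ).IsConnected) :
    (octa σ).IsConnected := by
  rw [isConnected_iff_cut]
  obtain ⟨f₀⟩ := h.1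
  refine ⟨⟨Sum.inl f₀⟩, fun X ⟨x, hx⟩ ⟨y, hy⟩ => ?_⟩
  by_contra hcon
  have hadj : ∀ u v, (octa σ).Adj u v → (u ∈ X ↔ v ∈ X) := by
    rintro _ _ ⟨a, rfl, rfl⟩
    by_contra ha
    exact hcon ⟨a, ha⟩
  have hF : ∀ f, Sum.inl f ∈ X ↔ Sum.inl f₀ ∈ X := fun f =>
    (dual σ).mem_iff_of_component {f | Sum.inl f ∈ X} (fun a => hadj _ _ (octa_adj_dual σ a))
      (h.2 f f₀)
  have hall : ∀ z, z ∈ X ↔ Sum.inl f₀ ∈ X := by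
    rintro (f | d)
    · exact hF f
    · rw [hadj _ _ (octa_adj_out σ d), hF]
  exact hy ((hall y).2 ((hall x).1 hx))

theorem octa_isPlanar [Finite A] [Finite V] [Nonempty A] {D : MultiDigraph V A}
    {σ : Equiv.Perm (A × Bool)}
    (hσ : D.IsRotationSystem σ) (h : IsDualPair D (dual σ) σ) : (octa σ).IsPlanar := by
  have hrev := octa_isReversal σ
  refine hrev.isPlanar (τ := octaRot σ * octaPerm σ) (lab := octaTriangle D)
    (octaVertex_iff σ) ?_ ?_ ?_
    (octa_isConnected h.dual_connected) ?_
  · intro x y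
    -- The rotation is chosen as `octaRot σ * octaPerm σ` so that its faces are the orbits of
    -- `octaRot σ`, namely the prescribed triangles and inner faces.
    have : octaRot σ * octaPerm σ * octaPerm σ = octaRot σ := by
      ext1 x
      simp [hrev.invol]
    rw [this]
    exact octaTriangle_iff σ hσ x y
  · rintro (d | d | v)
    · exact ⟨(d, 0), rfl⟩
    · exact ⟨(d, 3), rfl⟩
    · obtain ⟨d, rfl⟩ := exists_end_of_isConnected h.connected v
      exact ⟨(d, 6), rfl⟩
  · rintro (f | d)
    · obtain ⟨d, rfl⟩ := faceOf_surjective σ f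
      exact ⟨(d, 0), rfl⟩
    · exact ⟨(d, 2), rfl⟩
  -- With `v`, `f`, `a` the numbers for `D`, the count is `(f + 2a) + (4a + v) = 7a + 2`, which is
  -- Euler's formula for `D`.
  · have h1 := hrev.card
    have h2 := h.euler
    have hb : Nat.card Bool = 2 := by simp
    have h7 : Nat.card (Fin 7) = 7 := by simp
    rw [Nat.card_prod, Nat.card_prod, hb, h7] at h1
    rw [Nat.card_sum, Nat.card_sum, Nat.card_sum, Nat.card_prod, hb]
    omega

/-! ### From acyclic colourings to perfect matchings -/

theorem IsAcyclicSet.false_of_adj [Finite V] {D : MultiDigraph V A} {X : Set V}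
    (hX : D.IsAcyclicSet X) (U : Set V) (hU : U ⊆ X) (hne : U.Nonempty)
    (h : ∀ u ∈ U, ∃ v ∈ U, D.Adj u v) : False := by
  refine not_isAcyclicSet D X {a | D.src a ∈ U ∧ D.tgt a ∈ U} ?_ (fun a ha => hU ha.1) ?_ hX
  · obtain ⟨u, hu⟩ := hne
    obtain ⟨v, hv, a, rfl, rfl⟩ := h u hu
    exact ⟨a, hu, hv⟩
  · rintro a ⟨-, ha⟩
    obtain ⟨v, hv, b, hb, rfl⟩ := h _ ha
    exact ⟨b, ⟨hb ▸ ha, hv⟩, hb⟩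

/-- Each inner vertex closes a directed triangle with its dual arc, so if all faces around a vertex
lie in `X`, then all inner vertices there lie in `Y`. These contain the directed inner cycle. -/
theorem octa_not_monochromatic [Finite A] {D : MultiDigraph V A}
    {σ : Equiv.Perm (A × Bool)} (hσ : D.IsRotationSystem σ)
    {X Y : Set (Quotient (Equiv.Perm.SameCycle.setoid (σ * flipEnd A)) ⊕ (A × Bool))}
    (hXY : X ∪ Y = Set.univ) (hX : (octa σ).IsAcyclicSet X) (hY : (octa σ).IsAcyclicSet Y)
    (d₀ : A × Bool) (h : ∀ d, D.endVertex d = D.endVertex d₀ →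
      Sum.inl (faceOf σ (d.1, false)) ∈ X ∧ Sum.inl (faceOf σ (d.1, true)) ∈ X) : False := by
  have hin : ∀ d, D.endVertex d = D.endVertex d₀ → Sum.inr d ∈ Y := by
    intro d hd
    by_contra hdY
    have hdX : Sum.inr d ∈ X := by
      have : Sum.inr d ∈ X ∪ Y := hXY ▸ Set.mem_univ _
      exact this.resolve_right hdY
    obtain ⟨h1, h2⟩ := h d hd
    refine hX.false_of_adj {Sum.inl (faceOf σ (d.1, false)), Sum.inl (faceOf σ (d.1, true)),
      Sum.inr d} ?_ ⟨_, Or.inl rfl⟩ ?_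
    · rintro _ (rfl | rfl | rfl) <;> assumption
    · rintro _ (rfl | rfl | rfl)
      · exact ⟨_, Or.inr (Or.inl rfl), octa_adj_dual σ d.1⟩
      · exact ⟨_, Or.inr (Or.inr rfl), octa_adj_in σ d⟩
      · exact ⟨_, Or.inl rfl, octa_adj_out σ d⟩
  refine hY.false_of_adj (Sum.inr '' {d | D.endVertex d = D.endVertex d₀}) ?_ ⟨_, d₀, rfl, rfl⟩ ?_
  · rintro _ ⟨d, hd, rfl⟩
    exact hin d hd
  · rintro _ ⟨d, hd, rfl⟩
    exact ⟨_, ⟨σ d, (hσ.endVertex d).trans hd, rfl⟩, octa_adj_inner σ d⟩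

/-- A 2-periodic point of the rotation would leave at most two arc-ends at its vertex, but
3-edge-connectivity gives three. -/
theorem rotation_ne {D : MultiDigraph V A} [Finite A] [Finite V] {σ : Equiv.Perm (A × Bool)}
    (hσ : D.IsRotationSystem σ) (hD : D.IsEdgeConnected 3) (d : A × Bool) : σ (σ d) ≠ d := by
  intro h
  have hcyc : ∀ e, D.endVertex e = D.endVertex d → e = d ∨ e = σ d := by
    intro e he
    have := SameCycle.of_setoid (π := σ)
      (Setoid.mk (fun x y => (x = d ∨ x = σ d) ↔ (y = d ∨ y = σ d))
        ⟨fun _ => Iff.rfl, fun h => h.symm, fun h h' => h.trans h'⟩) (fun x => by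
          constructor
          · rintro (rfl | rfl)
            · exact Or.inr rfl
            · exact Or.inl h
          · rintro (h' | h')
            · exact Or.inr (σ.injective (h'.trans h.symm))
            · exact Or.inl (σ.injective h')) ((hσ d e).2 he.symm)
    exact this.1 (Or.inl rfl)
  obtain ⟨d₁, d₂, d₃, h1, h2, h3, h12, h13, h23⟩ := exists_three_ends hD (D.endVertex d)
  rcases hcyc _ h1 with rfl | rfl <;> rcases hcyc _ h2 with rfl | rfl <;>
    rcases hcyc _ h3 with rfl | rfl <;> simp_all

/-- If planar oriented graphs have acyclic 2-colourings, then 3-connected cubic planar digraphs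
have perfect matchings without directed cuts. -/
theorem exists_perfectMatching_of_colouring
    (hyp : ∀ (V A : Type) [Finite V] [Finite A] (D : MultiDigraph V A),
        D.IsPlanar → D.IsOriented →
          ∃ X Y : Set V, X ∪ Y = Set.univ ∧ Disjoint X Y ∧
            D.IsAcyclicSet X ∧ D.IsAcyclicSet Y)
    {V A : Type} [Finite V] [Finite A] (D : MultiDigraph V A) (hD : D.IsVertexConnected 3)
    (h3 : D.IsCubic) (hp : D.IsPlanar) :
    ∃ M : Set A, D.IsPerfectMatching M ∧ ¬ D.ContainsDirectedCut M := by
  classical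
  have := Fintype.ofFinite A
  have hE := hD.isEdgeConnected
  obtain ⟨hA, hcon⟩ := nonempty_of_isEdgeConnected hE
  obtain ⟨σ, hσ, hpair⟩ := hp.exists_isDualPair hcon
  have h2 := rotation_ne hσ hE
  have h1 : ∀ d, σ d ≠ d := fun d hd => h2 d (by rw [hd, hd])
  obtain ⟨X, Y, hXY, hdisj, hX, hY⟩ := hyp _ _ (octa σ) (octa_isPlanar hσ hpair)
    (octa_isOriented (hpair.isOriented hE) h1 h2)
  have hYX : ∀ z, z ∈ Y ↔ z ∉ X := by
    intro z
    have h1 : z ∈ X ∪ Y := hXY ▸ Set.mem_univ z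
    exact ⟨fun h h' => Set.disjoint_left.1 hdisj h' h, fun h => h1.resolve_left h⟩
  -- The matching consists of the arcs whose two faces have the same colour.
  let M : Set A := {a | Sum.inl (faceOf σ (a, false)) ∈ X ↔ Sum.inl (faceOf σ (a, true)) ∈ X}
  have hMrot : ∀ d : A × Bool, d.1 ∈ M ↔
      (Sum.inl (faceOf σ d) ∈ X ↔ Sum.inl (faceOf σ (σ d)) ∈ X) := by
    rintro ⟨a, b⟩
    rw [faceOf_rot]
    cases b
    · exact Iff.rfl
    · exact Iff.comm
  refine ⟨M, fun v => ?_, ?_⟩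
  · have hsum := D.degreeIn_compl_add M v
    rw [h3 v] at hsum
    have heven : Even (D.degreeIn Mᶜ v) := by
      rw [← ZMod.natCast_eq_zero_iff_even, degreeIn_cast_eq_sum]
      let χ : A × Bool → ZMod 2 := fun d => if Sum.inl (faceOf σ d) ∈ X then 1 else 0
      -- The arcs outside `M` are the colour changes between consecutive faces around `v`; a closed
      -- cyclic sequence has an even number of them.
      have : ∀ d : A × Bool, (if d.1 ∈ Mᶜ then (1 : ZMod 2) else 0) = χ d + χ (σ d) := by
        intro d
        have := hMrot d
        simp only [χ, Set.mem_compl_iff]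
        by_cases h1 : Sum.inl (faceOf σ d) ∈ X <;> by_cases h2 : Sum.inl (faceOf σ (σ d)) ∈ X <;>
          simp [this, h1, h2]
        decide
      rw [Finset.sum_congr rfl fun d _ => this d, Finset.sum_add_distrib]
      have hrot := sum_fiber_rotation hσ (fun d => χ (σ d)) v
      simp only [Equiv.apply_symm_apply] at hrot
      exact CharTwo.add_eq_zero.2 hrot
    have hne : D.degreeIn Mᶜ v ≠ 0 := by
      intro h0
      rw [degreeIn_eq_ncard, Set.ncard_eq_zero] at h0
      have hM : ∀ d, D.endVertex d = v → d.1 ∈ M := by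
        intro d hd
        by_contra hcon
        have : d ∈ D.endsIn Mᶜ v := ⟨hcon, hd⟩
        rw [h0] at this
        exact this
      obtain ⟨d₀, rfl⟩ := exists_end_of_isConnected hcon v
      have hcol : ∀ d, D.endVertex d = D.endVertex d₀ →
          (Sum.inl (faceOf σ d) ∈ X ↔ Sum.inl (faceOf σ d₀) ∈ X) := by
        intro d hd
        refine (SameCycle.of_setoid (π := σ)
          (Setoid.mk (fun x y => D.endVertex x = D.endVertex y ∧ (D.endVertex x = D.endVertex d₀ →
            (Sum.inl (faceOf σ x) ∈ X ↔ Sum.inl (faceOf σ y) ∈ X)))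
          ⟨fun _ => ⟨rfl, fun _ => Iff.rfl⟩,
            fun h => ⟨h.1.symm, fun h' => (h.2 (h.1.trans h')).symm⟩,
            fun h h' => ⟨h.1.trans h'.1, fun h'' =>
              (h.2 h'').trans (h'.2 (h.1.symm.trans h''))⟩⟩)
          (fun x => ⟨(hσ.endVertex x).symm, fun hx => (hMrot x).1 (hM x hx)⟩)
          ((hσ d d₀).2 hd)).2 hd
      have hcol' : ∀ d, D.endVertex d = D.endVertex d₀ →
          (Sum.inl (faceOf σ (d.1, false)) ∈ X ↔ Sum.inl (faceOf σ d₀) ∈ X) ∧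
          (Sum.inl (faceOf σ (d.1, true)) ∈ X ↔ Sum.inl (faceOf σ d₀) ∈ X) := by
        rintro ⟨a, b⟩ hd
        have h1 := hcol _ hd
        have h2 : Sum.inl (faceOf σ (a, false)) ∈ X ↔ Sum.inl (faceOf σ (a, true)) ∈ X := hM _ hd
        cases b
        · exact ⟨h1, h2.symm.trans h1⟩
        · exact ⟨h2.trans h1, h1⟩
      by_cases hc : Sum.inl (faceOf σ d₀) ∈ X
      · exact octa_not_monochromatic hσ hXY hX hY d₀ fun d hd =>
          ⟨(hcol' d hd).1.2 hc, (hcol' d hd).2.2 hc⟩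
      · exact octa_not_monochromatic hσ (by rwa [Set.union_comm]) hY hX d₀ fun d hd =>
          ⟨(hYX _).2 (fun h => hc ((hcol' d hd).1.1 h)),
            (hYX _).2 (fun h => hc ((hcol' d hd).2.1 h))⟩
    obtain ⟨k, hk⟩ := heven
    -- The degree in `Mᶜ` is even, non-zero and at most three, hence two.
    omega
  · rintro ⟨B, hBM, hB⟩
    have hnext := hpair.exists_next_of_isDirectedCut hB
    have hBne : B.Nonempty := by
      obtain ⟨Z, hZ, hZ', hno, rfl⟩ := hB
      obtain ⟨a, ha⟩ := ((isConnected_iff_cut D).1 hcon).2 Z hZ hZ'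
      have := hno a
      exact ⟨a, by simp only [cut, Set.mem_ofPred_eq] at *; tauto⟩
    -- Dual arcs of `B` preserve the colour, and each is followed by another dual arc of `B`;
    -- starting in `Z`, they trap a directed cycle inside `Z`.
    have key : ∀ Z, (octa σ).IsAcyclicSet Z → (∀ a ∈ B, Sum.inl (faceOf σ (a, false)) ∈ Z →
        Sum.inl (faceOf σ (a, true)) ∈ Z) → ∀ b ∈ B, Sum.inl (faceOf σ (b, false)) ∈ Z → False := by
      intro Z hZ hmono b hb hbZ
      refine hZ.false_of_adj {z | z ∈ Z ∧ ∃ a ∈ B, z = Sum.inl (faceOf σ (a, false))}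
        (fun z hz => hz.1) ⟨_, hbZ, b, hb, rfl⟩ ?_
      rintro _ ⟨hz, a, ha, rfl⟩
      obtain ⟨c, hc, hca⟩ := hnext a ha
      exact ⟨_, ⟨hmono a ha hz, c, hc, congrArg Sum.inl hca.symm⟩, octa_adj_dual σ a⟩
    obtain ⟨b, hb⟩ := hBne
    by_cases hbX : Sum.inl (faceOf σ (b, false)) ∈ X
    · exact key X hX (fun a ha => (hBM ha).1) b hb hbX
    · refine key Y hY (fun a ha h => ?_) b hb ((hYX _).2 hbX)
      rw [hYX] at h ⊢
      exact fun h' => h ((hBM ha).2 h')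

/-! ### Simple duals -/

/-- The tension of a cut is a circulation of the dual. If it were supported on one or two arcs,
these would form a loop or a pair of parallel or antiparallel arcs of the dual. -/
theorem IsDualPair.isEdgeConnected_of_simple [Finite V] [Finite A] [Finite F]
    {D : MultiDigraph V A} {D' : MultiDigraph F A} {σ : Equiv.Perm (A × Bool)}
    (h : IsDualPair D D' σ) (hV : 1 < Nat.card V) (hl : ∀ a, D'.src a ≠ D'.tgt a)
    (hs : ∀ a b, D'.Joins b (D'.src a) (D'.tgt a) → a = b) : D.IsEdgeConnected 3 := by
  classical
  have := Fintype.ofFinite A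
  rw [isEdgeConnected_iff_cut]
  refine ⟨hV, fun X hX hX' => ?_⟩
  by_contra! hlt
  obtain ⟨a, ha, b, hb, hab⟩ :=
    exists_subset_pair (((isConnected_iff_cut D).1 h.connected).2 X hX hX') hlt
  let g : A → ℚ := D.coboundary ℚ (fun v => if v ∈ X then 0 else 1)
  have hg : ∀ c, g c ≠ 0 ↔ c ∈ D.cut X := by
    intro c
    simp only [g, coboundary_apply, cut, Set.mem_ofPred_eq]
    by_cases h1 : D.src c ∈ X <;> by_cases h2 : D.tgt c ∈ X <;> simp [h1, h2]
  have horth : ∀ ρ, ∑ c, g c * D'.coboundary ℚ ρ c = 0 := fun ρ =>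
    sum_coboundary_mul_coboundary D D' h.endVertex_rot h.endVertex_face _ ρ
  have hga := (hg a).2 ha
  have hgc : ∀ c, c ≠ a → c ≠ b → g c = 0 := by
    intro c hca hcb
    by_contra hc
    rcases hab ((hg c).1 hc) with h | h
    · exact hca h
    · exact hcb h
  -- Orthogonality to the indicator of a dual vertex `w`: the non-zero contribution of `a` at its
  -- end `w` can be cancelled only by `b`.
  have hinc : ∀ w, (w = D'.src a ∨ w = D'.tgt a) → a ≠ b ∧ (w = D'.src b ∨ w = D'.tgt b) := by
    intro w hw
    have h1 := horth (fun x => if x = w then 1 else 0)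
    have hsa : D'.coboundary ℚ (fun x => if x = w then 1 else 0) a ≠ 0 := by
      rw [coboundary_apply]
      rcases hw with rfl | rfl
      · simp [(hl a).symm]
      · simp [hl a]
    have hne : a ≠ b := by
      rintro rfl
      rw [Finset.sum_eq_single a (fun c _ hc => by rw [hgc c hc hc, zero_mul]) (by simp)] at h1
      exact mul_ne_zero hga hsa h1
    refine ⟨hne, ?_⟩
    by_contra hw'
    push Not at hw'
    have hb0 : D'.coboundary ℚ (fun x => if x = w then 1 else 0) b = 0 := by
      rw [coboundary_apply, if_neg hw'.1.symm, if_neg hw'.2.symm, sub_zero]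
    rw [Finset.sum_eq_single a (fun c _ hc => by
      by_cases hcb : c = b
      · rw [hcb, hb0, mul_zero]
      · rw [hgc c hc hcb, zero_mul]) (by simp)] at h1
    exact mul_ne_zero hga hsa h1
  obtain ⟨hne, h1⟩ := hinc _ (Or.inl rfl)
  obtain ⟨-, h2⟩ := hinc _ (Or.inr rfl)
  refine hne (hs a b ?_)
  have h3 := hl a
  rcases h1 with h1 | h1 <;> rcases h2 with h2 | h2
  · exact absurd (h1.trans h2.symm) h3
  · exact Or.inl ⟨h1.symm, h2.symm⟩
  · exact Or.inr ⟨h2.symm, h1.symm⟩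
  · exact absurd (h1.trans h2.symm) h3

-- Modulo two the signs disappear, and the sum groups by vertices into degrees times potentials.
-- This turns even subgraphs into tensions of the dual, that is, into 2-colourings.
open Classical in
theorem sum_indicator_mul_coboundary_eq_zero [Finite V] [Fintype A] (D : MultiDigraph V A)
    (E : Set A) (hE : ∀ v, Even (D.degreeIn E v)) (π : V → ZMod 2) :
    ∑ a, (if a ∈ E then 1 else 0) * D.coboundary (ZMod 2) π a = 0 := by
  have := Fintype.ofFinite V
  have h1 : ∀ d : A × Bool, (if d.2 then (-1 : ZMod 2) else 1) = 1 := by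
    rintro ⟨a, _ | _⟩
    · rfl
    · rfl
  rw [sum_mul_coboundary, neg_eq_zero, ← Finset.sum_fiberwise Finset.univ D.endVertex]
  refine Finset.sum_eq_zero fun v _ => ?_
  have h2 : ∀ d ∈ Finset.univ.filter (fun d => D.endVertex d = v),
      (if d.2 then (-1 : ZMod 2) else 1) * (if d.1 ∈ E then 1 else 0) * π (D.endVertex d) =
        (if d.1 ∈ E then 1 else 0) * π v := by
    intro d hd
    rw [h1, one_mul, (Finset.mem_filter.1 hd).2]
  have h3 := (degreeIn_cast_eq_sum D E v).symm.trans ((ZMod.natCast_eq_zero_iff_even).2 (hE v))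
  rw [Finset.sum_congr rfl h2, ← Finset.sum_mul]
  exact (congrArg (· * π v) h3).trans (zero_mul _)

/-! ### Triangulating a plane digraph -/

/-- The cyclic rotation of the three ends at every vertex. -/
def portRot (W : Type*) : Equiv.Perm (W × Fin 3) :=
  Equiv.prodCongrRight fun _ => Equiv.addRight 1

theorem portRot_iff (x y : W × Fin 3) : (portRot W).SameCycle x y ↔ x.1 = y.1 := by
  constructor
  · exact eq_of_sameCycle fun _ => rfl
  · obtain ⟨w, i⟩ := x
    obtain ⟨w', j⟩ := y
    rintro ⟨⟩
    have h : ∀ i, (portRot W).SameCycle (w, 0) (w, i) := by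
      have h0 : (portRot W).SameCycle (w, 0) (w, 1) := sameCycle_next _ _
      have h1 : (portRot W).SameCycle (w, 1) (w, 2) := sameCycle_next _ _
      intro i
      fin_cases i
      · exact .refl _ _
      · exact h0
      · exact h0.trans h1
    exact (h i).symm.trans (h j)

section triangulation

variable (σ : Equiv.Perm (A × Bool)) (K : A → Bool)

/-- The next arc-end along a face. -/
def faceNext : Equiv.Perm (A × Bool) := σ * flipEnd A

/-- The gluing of the corners of a triangulation that refines the drawing `σ`. Inside every face
there is a cycle on the vertices `x d`, `y d`, and a centre. The triangle on the side of an arc-end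
`d` has the apex `x d`; if the arc is not in `K`, it is flipped. -/
def triFun : ((A × Bool) × Fin 5) × Fin 3 → ((A × Bool) × Fin 5) × Fin 3
  | ((d, 0), 0) => ((flipEnd A d, 0), 0)
  | ((d, 0), 1) => if K d.1 then ((d, 1), 0) else (((faceNext σ).symm d, 2), 1)
  | ((d, 0), 2) => if K d.1 then (((faceNext σ).symm d, 2), 1) else ((flipEnd A d, 1), 0)
  | ((d, 1), 0) => if K d.1 then ((d, 0), 1) else ((flipEnd A d, 0), 2)
  | ((d, 1), 1) => ((d, 2), 0)
  | ((d, 1), 2) => ((d, 3), 0)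
  | ((d, 2), 0) => ((d, 1), 1)
  | ((d, 2), 1) => if K (faceNext σ d).1 then ((faceNext σ d, 0), 2) else ((faceNext σ d, 0), 1)
  | ((d, 2), 2) => ((d, 4), 0)
  | ((d, 3), 0) => ((d, 1), 2)
  | ((d, 3), 1) => ((d, 4), 2)
  | ((d, 3), 2) => (((faceNext σ).symm d, 4), 1)
  | ((d, 4), 0) => ((d, 2), 2)
  | ((d, 4), 1) => ((faceNext σ d, 3), 2)
  | ((d, 4), 2) => ((d, 3), 1)

theorem flipEnd_fst (d : A × Bool) : (flipEnd A d).1 = d.1 := rfl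

theorem triFun_involutive : Function.Involutive (triFun σ K) := by
  rintro ⟨⟨d, i⟩, j⟩
  fin_cases i <;> fin_cases j <;> simp only [triFun] <;> try split_ifs
  all_goals simp_all [flipEnd_flipEnd, flipEnd_fst]

/-- The permutation given by `triFun`. -/
def triPerm : Equiv.Perm (((A × Bool) × Fin 5) × Fin 3) := (triFun_involutive σ K).toPerm

/-- The tail ends in the triangulation. -/
def triTail : ((A × Bool) × Fin 5) × Fin 3 → Prop
  | ((d, 0), 0) => d.2 = false
  | ((_, 0), 1) => True
  | ((_, 0), 2) => True
  | ((_, 1), 0) => False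
  | ((_, 1), 1) => True
  | ((_, 1), 2) => True
  | ((_, 2), 0) => False
  | ((_, 2), 1) => False
  | ((_, 2), 2) => True
  | ((_, 3), 0) => False
  | ((_, 3), 1) => True
  | ((_, 3), 2) => True
  | ((_, 4), 0) => False
  | ((_, 4), 1) => False
  | ((_, 4), 2) => False

theorem tri_isReversal : IsReversal (triPerm σ K) (triTail (A := A)) := by
  refine ⟨triFun_involutive σ K, ?_⟩
  rintro ⟨⟨⟨a, b⟩, i⟩, j⟩
  fin_cases i <;> fin_cases j <;> simp only [triPerm, Function.Involutive.coe_toPerm, triFun] <;>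
    try split_ifs
  all_goals simp [triTail, flipEnd]

/-- The vertices of the triangulation: the old vertices, the cycle vertices `x d` and `y d` inside
the faces, and the centres of the faces. -/
inductive TriVertex (V A : Type*) (F : Type*)
  | old (v : V)
  | x (d : A × Bool)
  | y (d : A × Bool)
  | centre (f : F)

/-- The triangulation vertices as a sum type. -/
def triVertexEquiv (V A F : Type*) :
    TriVertex V A F ≃ V ⊕ (A × Bool) ⊕ (A × Bool) ⊕ F where
  toFun
    | .old v => .inl v
    | .x d => .inr (.inl d)
    | .y d => .inr (.inr (.inl d))
    | .centre f => .inr (.inr (.inr f))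
  invFun
    | .inl v => .old v
    | .inr (.inl d) => .x d
    | .inr (.inr (.inl d)) => .y d
    | .inr (.inr (.inr f)) => .centre f
  left_inv := by rintro (_ | _ | _ | _) <;> rfl
  right_inv := by rintro (_ | _ | _ | _) <;> rfl

/-- The vertex of the triangulation at a corner. -/
def triVertex (D : MultiDigraph V A) : ((A × Bool) × Fin 5) × Fin 3 →
    TriVertex V A (Quotient (Equiv.Perm.SameCycle.setoid (σ * flipEnd A)))
  | ((d, 0), 0) => if K d.1 then .old (D.endVertex d) else .x (flipEnd A d)
  | ((d, 0), 1) => if K d.1 then .old (D.endVertex (flipEnd A d)) else .x d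
  | ((d, 0), 2) => if K d.1 then .x d else .old (D.endVertex d)
  | ((d, 1), 0) => .x d
  | ((d, 1), 1) => .old (D.endVertex (flipEnd A d))
  | ((d, 1), 2) => .y d
  | ((d, 2), 0) => .y d
  | ((d, 2), 1) => .old (D.endVertex (flipEnd A d))
  | ((d, 2), 2) => .x (faceNext σ d)
  | ((d, 3), 0) => .x d
  | ((d, 3), 1) => .y d
  | ((d, 3), 2) => .centre (faceOf σ d)
  | ((d, 4), 0) => .y d
  | ((d, 4), 1) => .x (faceNext σ d)
  | ((d, 4), 2) => .centre (faceOf σ d)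

theorem faceOf_faceNext (d : A × Bool) : faceOf σ (faceNext σ d) = faceOf σ d := faceOf_next σ d

theorem faceOf_faceNext_symm (d : A × Bool) :
    faceOf σ ((faceNext σ).symm d) = faceOf σ d := by
  rw [← faceOf_faceNext, Equiv.apply_symm_apply]

theorem endVertex_faceNext {D : MultiDigraph V A} {σ : Equiv.Perm (A × Bool)}
    (hσ : D.IsRotationSystem σ) (d : A × Bool) :
    D.endVertex (faceNext σ d) = D.endVertex (flipEnd A d) := hσ.endVertex _

theorem triVertex_next {D : MultiDigraph V A} {σ : Equiv.Perm (A × Bool)}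
    (hσ : D.IsRotationSystem σ) (x : ((A × Bool) × Fin 5) × Fin 3) :
    triVertex σ K D (portRot _ (triPerm σ K x)) = triVertex σ K D x := by
  obtain ⟨⟨d, i⟩, j⟩ := x
  have h01 : (0 : Fin 3) + 1 = 1 := rfl
  have h12 : (1 : Fin 3) + 1 = 2 := rfl
  have h20 : (2 : Fin 3) + 1 = 0 := rfl
  fin_cases i <;> fin_cases j <;>
    simp only [triPerm, Function.Involutive.coe_toPerm, triFun] <;> try split_ifs
  all_goals
    simp_all [portRot, triVertex, flipEnd_flipEnd, flipEnd_fst,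
      faceOf_faceNext_symm, endVertex_faceNext]

end triangulation

/-! ### Edges and vertex orbits of the triangulation -/

section triangulation

variable {D : MultiDigraph V A} {σ : Equiv.Perm (A × Bool)} {K : A → Bool}

/-- The edges of the triangulation: the corner at which an edge starts and its two ends, in
order. -/
inductive TriEdge (σ : Equiv.Perm (A × Bool)) (K : A → Bool) (D : MultiDigraph V A) :
    ((A × Bool) × Fin 5) × Fin 3 →
    TriVertex V A (Quotient (Equiv.Perm.SameCycle.setoid (σ * flipEnd A))) →
    TriVertex V A (Quotient (Equiv.Perm.SameCycle.setoid (σ * flipEnd A))) → Prop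
  | kept (d) : K d.1 →
      TriEdge σ K D ((d, 0), 0) (.old (D.endVertex d)) (.old (D.endVertex (flipEnd A d)))
  | flipped (d) : TriEdge σ K D ((d, 0), 0) (.x (flipEnd A d)) (.x d)
  | old_far_x (d) : TriEdge σ K D (if K d.1 then ((d, 0), 1) else ((flipEnd A d, 0), 2))
      (.old (D.endVertex (flipEnd A d))) (.x d)
  | x_old_near (d) : TriEdge σ K D (if K d.1 then ((d, 0), 2) else ((d, 0), 1))
      (.x d) (.old (D.endVertex d))
  | x_old_far (d) : TriEdge σ K D ((d, 1), 0) (.x d) (.old (D.endVertex (flipEnd A d)))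
  | old_y (d) : TriEdge σ K D ((d, 1), 1) (.old (D.endVertex (flipEnd A d))) (.y d)
  | y_x (d) : TriEdge σ K D ((d, 1), 2) (.y d) (.x d)
  | y_old (d) : TriEdge σ K D ((d, 2), 0) (.y d) (.old (D.endVertex (flipEnd A d)))
  | old_near_x (d) : TriEdge σ K D ((d, 2), 1) (.old (D.endVertex (flipEnd A d)))
      (.x (faceNext σ d))
  | x_next_y (d) : TriEdge σ K D ((d, 2), 2) (.x (faceNext σ d)) (.y d)
  | x_y (d) : TriEdge σ K D ((d, 3), 0) (.x d) (.y d)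
  | y_centre (d) : TriEdge σ K D ((d, 3), 1) (.y d) (.centre (faceOf σ d))
  | centre_x (d) : TriEdge σ K D ((d, 3), 2) (.centre (faceOf σ d)) (.x d)
  | y_x_next (d) : TriEdge σ K D ((d, 4), 0) (.y d) (.x (faceNext σ d))
  | x_centre (d) : TriEdge σ K D ((d, 4), 1) (.x (faceNext σ d)) (.centre (faceOf σ d))
  | centre_y (d) : TriEdge σ K D ((d, 4), 2) (.centre (faceOf σ d)) (.y d)

theorem triEdge_of_corner (hσ : D.IsRotationSystem σ) (x : ((A × Bool) × Fin 5) × Fin 3) :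
    TriEdge σ K D x (triVertex σ K D x) (triVertex σ K D (triPerm σ K x)) := by
  have hff : ∀ d, D.endVertex (flipEnd A ((faceNext σ).symm d)) = D.endVertex d := fun d => by
    rw [← endVertex_faceNext hσ, Equiv.apply_symm_apply]
  obtain ⟨⟨d, i⟩, j⟩ := x
  fin_cases i <;> fin_cases j <;>
    simp only [triPerm, Function.Involutive.coe_toPerm, triFun, triVertex]
  · cases hk : K d.1
    · have := TriEdge.flipped (σ := σ) (K := K) (D := D) d
      simpa [triVertex, flipEnd_fst, flipEnd_flipEnd, hk] using this
    · have := TriEdge.kept (σ := σ) (K := K) (D := D) d hk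
      simpa [triVertex, flipEnd_fst, flipEnd_flipEnd, hk] using this
  · cases hk : K d.1
    · have := TriEdge.x_old_near (σ := σ) (K := K) (D := D) d
      simpa [triVertex, hk, hff] using this
    · have := TriEdge.old_far_x (σ := σ) (K := K) (D := D) d
      simpa [triVertex, hk] using this
  · cases hk : K d.1
    · have := TriEdge.old_far_x (σ := σ) (K := K) (D := D) (flipEnd A d)
      simpa [triVertex, flipEnd_fst, flipEnd_flipEnd, hk] using this
    · have := TriEdge.x_old_near (σ := σ) (K := K) (D := D) d
      simpa [triVertex, hk, hff] using this
  · cases hk : K d.1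
    · simpa [triVertex, flipEnd_fst, hk] using TriEdge.x_old_far (σ := σ) (K := K) (D := D) d
    · simpa [triVertex, hk] using TriEdge.x_old_far (σ := σ) (K := K) (D := D) d
  · exact .old_y d
  · exact .y_x d
  · exact .y_old d
  · cases hk : K (faceNext σ d).1
    · simpa [triVertex, hk] using TriEdge.old_near_x (σ := σ) (K := K) (D := D) d
    · simpa [triVertex, hk] using TriEdge.old_near_x (σ := σ) (K := K) (D := D) d
  · exact .x_next_y d
  · exact .x_y d
  · exact .y_centre d
  · have := TriEdge.centre_x (σ := σ) (K := K) (D := D) d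
    simpa using this
  · exact .y_x_next d
  · have := TriEdge.x_centre (σ := σ) (K := K) (D := D) d
    simpa [faceOf_faceNext] using this
  · exact .centre_y d

/-- The two vertices along an edge of the triangulation, in order, determine the edge. -/
theorem TriEdge.eq (hσ : D.IsRotationSystem σ)
    (hl : ∀ d, D.endVertex d ≠ D.endVertex (flipEnd A d))
    (hK : ∀ d d' : A × Bool, K d.1 → K d'.1 → D.endVertex d = D.endVertex d' →
      D.endVertex (flipEnd A d) = D.endVertex (flipEnd A d') → d = d')
    {x y : ((A × Bool) × Fin 5) × Fin 3}
    {p q p' q' : TriVertex V A (Quotient (Equiv.Perm.SameCycle.setoid (σ * flipEnd A)))}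
    (hx : TriEdge σ K D x p q) (hy : TriEdge σ K D y p' q') (hp : p = p') (hq : q = q') :
    x = y := by
  -- A face with a single side would make its arc a loop.
  have hn : ∀ d, faceNext σ d ≠ d := fun d h => hl d (by
    rw [← endVertex_faceNext hσ, h])
  have hfn : ∀ d, D.endVertex (flipEnd A d) = D.endVertex (faceNext σ d) :=
    fun d => (endVertex_faceNext hσ d).symm
  cases hx <;> cases hy <;>
    simp only [TriVertex.old.injEq, TriVertex.x.injEq, TriVertex.y.injEq,
      TriVertex.centre.injEq, reduceCtorEq, EmbeddingLike.apply_eq_iff_eq] at hp hq <;>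
    first
    | (subst hp; rfl)
    | (subst hq; rfl)
    | skip
  -- The remaining coincidences are parallel kept arcs, excluded by `hK`; an `x d` whose two old
  -- neighbours agree, excluded by `hl`; and a `y d` whose two cycle neighbours agree, excluded by
  -- `hn`. Consecutive vertices `x` in a face are separated by a `y`, so a face with two sides also
  -- creates no parallel edges.
  case kept.kept h _ h' => rw [hK _ _ h h' hp hq]
  case old_far_x.old_near_x d e => exact absurd (by rw [hp, hfn, ← hq]) (hl d)
  case x_old_near.x_old_far d e => exact absurd (hp ▸ hq) (hl d)
  case x_old_far.x_old_near d e => exact absurd (hp ▸ hq.symm) (hl d)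
  case old_near_x.old_far_x d e => exact absurd (by rw [← hp, hfn, hq]) (hl e)
  case x_next_y.x_y d e => exact absurd (hp.trans hq.symm) (hn d)
  case x_y.x_next_y d e => exact absurd (hp.symm.trans hq) (hn e)
  case y_x_next.y_x d e => exact absurd (hq.trans hp.symm) (hn d)
  case y_x.y_x_next d e => exact absurd (hq.symm.trans hp) (hn e)

theorem tri_isConnected [Finite A] [Nonempty A] (hσ : D.IsRotationSystem σ) (hD : D.IsConnected) :
    (ofEnds (triPerm σ K) triTail Prod.fst).IsConnected := by
  have hrev := tri_isReversal σ K
  rw [isConnected_iff_cut]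
  obtain ⟨a₀⟩ := ‹Nonempty A›
  refine ⟨⟨((a₀, false), 0)⟩, fun X ⟨x, hx⟩ ⟨y, hy⟩ => ?_⟩
  by_contra hcon
  have hadj : ∀ δ, δ.1 ∈ X ↔ (triFun σ K δ).1 ∈ X := by
    intro δ
    by_contra h
    exact hcon ⟨_, (hrev.arcOf_mem_cut Prod.fst X δ).2 h⟩
  have h00 : ∀ d, (d, 0) ∈ X ↔ (flipEnd A d, 0) ∈ X := fun d => hadj ((d, 0), 0)
  have h12 : ∀ d, (d, 1) ∈ X ↔ (d, 2) ∈ X := fun d => hadj ((d, 1), 1)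
  have h13 : ∀ d, (d, 1) ∈ X ↔ (d, 3) ∈ X := fun d => hadj ((d, 1), 2)
  have h34 : ∀ d, (d, 3) ∈ X ↔ (d, 4) ∈ X := fun d => hadj ((d, 3), 1)
  have h43 : ∀ d, (d, 4) ∈ X ↔ (faceNext σ d, 3) ∈ X := fun d => hadj ((d, 4), 1)
  have h10 : ∀ d, (d, 1) ∈ X ↔ (d, 0) ∈ X := by
    intro d
    have := hadj ((d, 1), 0)
    simp only [triFun] at this
    split_ifs at this
    · exact this
    · rw [h00]; exact this
  have hnext : ∀ d, (d, 0) ∈ X ↔ (faceNext σ d, 0) ∈ X := fun d => by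
    rw [← h10, ← h10, h13, h13, h34, h43]
  have hrot : ∀ d, (d, 0) ∈ X ↔ (σ d, 0) ∈ X := fun d => by
    have := hnext (flipEnd A d)
    rw [← h00] at this
    rw [this, faceNext, Equiv.Perm.mul_apply, flipEnd_flipEnd]
  have hcyc : ∀ d d', D.endVertex d = D.endVertex d' → ((d, 0) ∈ X ↔ (d', 0) ∈ X) := by
    intro d d' h
    have := eq_of_sameCycle (π := σ) (l := fun d => (d, (0 : Fin 5)) ∈ X)
      (fun d => propext (hrot d).symm) ((hσ d d').2 h)
    exact iff_of_eq this
  have hall : ∀ d d', (d, 0) ∈ X ↔ (d', 0) ∈ X := by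
    intro d d'
    have := D.mem_iff_of_component {v | ∃ d, D.endVertex d = v ∧ (d, 0) ∈ X} (fun a => by
      constructor
      · rintro ⟨e, he, h⟩
        exact ⟨(a, true), rfl, (h00 (a, false)).1 ((hcyc e (a, false) he).1 h)⟩
      · rintro ⟨e, he, h⟩
        exact ⟨(a, false), rfl, (h00 (a, true)).1 ((hcyc e (a, true) he).1 h)⟩)
      (hD.2 (D.endVertex d) (D.endVertex d'))
    constructor
    · intro h
      obtain ⟨e, he, h'⟩ := this.1 ⟨d, rfl, h⟩
      exact (hcyc e d' he).1 h'
    · intro h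
      obtain ⟨e, he, h'⟩ := this.2 ⟨d', rfl, h⟩
      exact (hcyc e d he).1 h'
  have hto : ∀ w : (A × Bool) × Fin 5, w ∈ X ↔ (w.1, 0) ∈ X := by
    rintro ⟨d, i⟩
    fin_cases i
    · exact Iff.rfl
    · exact h10 d
    · exact (h12 d).symm.trans (h10 d)
    · exact (h13 d).symm.trans (h10 d)
    · exact (h34 d).symm.trans ((h13 d).symm.trans (h10 d))
  exact hy ((hto y).2 ((hall _ _).1 ((hto x).1 hx)))

/-- Every corner is moved along its orbit to a standard corner: one type each for old vertices, `x`,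
`y` and centres. Standard corners for `x` and `y` are determined by their label, while those at an
old vertex or a centre are linked by the rotation `σ` or by face tracing. -/
theorem triVertex_iff (hσ : D.IsRotationSystem σ) (x y : ((A × Bool) × Fin 5) × Fin 3) :
    (portRot _ * triPerm σ K).SameCycle x y ↔ triVertex σ K D x = triVertex σ K D y := by
  set π := portRot _ * triPerm σ K with hπ
  have hinv : ∀ {x y}, π.SameCycle x y → triVertex σ K D x = triVertex σ K D y :=
    fun h => eq_of_sameCycle (triVertex_next K hσ) h
  refine ⟨hinv, ?_⟩
  have hstep : ∀ x y, portRot _ (triFun σ K x) = y → π.SameCycle x y := fun x y h =>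
    h ▸ sameCycle_next π x
  have y1 : ∀ d, π.SameCycle ((d, 1), 2) ((d, 3), 1) := fun d => hstep _ _ rfl
  have y2 : ∀ d, π.SameCycle ((d, 3), 1) ((d, 4), 0) := fun d => hstep _ _ (by
    simp only [triFun]; rfl)
  have y3 : ∀ d, π.SameCycle ((d, 4), 0) ((d, 2), 0) := fun d => hstep _ _ (by
    simp only [triFun]; rfl)
  have x1 : ∀ d, π.SameCycle ((d, 2), 2) ((d, 4), 1) := fun d => hstep _ _ rfl
  have x2 : ∀ d, π.SameCycle ((d, 4), 1) ((faceNext σ d, 3), 0) := fun d => hstep _ _ (by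
    simp only [triFun]; rfl)
  have x3 : ∀ d, π.SameCycle ((d, 3), 0) ((d, 1), 0) := fun d => hstep _ _ (by
    simp only [triFun]; rfl)
  have z1 : ∀ d, π.SameCycle ((d, 4), 2) ((d, 3), 2) := fun d => hstep _ _ (by
    simp only [triFun]; rfl)
  have z2 : ∀ d, π.SameCycle ((faceNext σ d, 3), 2) ((d, 4), 2) := fun d => hstep _ _ (by
    simp only [triFun, Equiv.symm_apply_apply]; rfl)
  have v1 : ∀ d, π.SameCycle ((d, 1), 1) ((d, 2), 1) := fun d => hstep _ _ rfl
  have kt : ∀ d : A × Bool, K d.1 →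
      π.SameCycle ((d, 0), 0) ((flipEnd A d, 1), 1) ∧ π.SameCycle ((d, 0), 1) ((d, 1), 1) ∧
      π.SameCycle ((d, 0), 2) ((d, 1), 0) := by
    intro d hd
    have h1 : ∀ d, π.SameCycle ((d, 0), 0) ((flipEnd A d, 0), 1) := fun d => hstep _ _ rfl
    have h2 : ∀ d : A × Bool, K d.1 → π.SameCycle ((d, 0), 1) ((d, 1), 1) := fun d hd =>
      hstep _ _ (by simp only [triFun, hd, if_true]; rfl)
    have h3 : π.SameCycle ((d, 1), 0) ((d, 0), 2) :=
      hstep _ _ (by simp only [triFun, hd, if_true]; rfl)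
    exact ⟨(h1 d).trans (h2 _ hd), h2 d hd, h3.symm⟩
  have kf : ∀ d : A × Bool, K d.1 = false →
      π.SameCycle ((d, 0), 0) ((flipEnd A d, 1), 0) ∧ π.SameCycle ((d, 0), 1) ((d, 1), 0) ∧
      π.SameCycle ((d, 0), 2) ((flipEnd A d, 1), 1) := by
    intro d hd
    have h1 : ∀ d, π.SameCycle ((d, 0), 0) ((flipEnd A d, 0), 1) := fun d => hstep _ _ rfl
    have h2 : ∀ d : A × Bool, K d.1 = false → π.SameCycle ((d, 1), 0) ((flipEnd A d, 0), 0) :=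
      fun d hd => hstep _ _ (by simp only [triFun, hd, Bool.false_eq_true, if_false]; rfl)
    have h3 : π.SameCycle ((d, 0), 2) ((flipEnd A d, 1), 1) :=
      hstep _ _ (by simp only [triFun, hd, Bool.false_eq_true, if_false]; rfl)
    have h4 : ∀ d : A × Bool, K d.1 = false → π.SameCycle ((d, 0), 1) ((d, 1), 0) := by
      intro d hd
      have := (h2 d hd).trans (h1 _)
      rw [flipEnd_flipEnd] at this
      exact this.symm
    exact ⟨(h1 d).trans (h4 _ hd), h4 d hd, h3⟩
  have hx : ∀ d, π.SameCycle ((d, 2), 2) ((faceNext σ d, 1), 0) := fun d =>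
    (x1 d).trans ((x2 d).trans (x3 _))
  have hv : ∀ d, π.SameCycle ((d, 1), 1) ((flipEnd A (faceNext σ d), 1), 1) := by
    intro d
    refine (v1 d).trans ?_
    cases hk : K (faceNext σ d).1
    · have : π.SameCycle ((d, 2), 1) ((faceNext σ d, 0), 2) :=
        hstep _ _ (by simp only [triFun, hk, Bool.false_eq_true, if_false]; rfl)
      exact this.trans (kf _ hk).2.2
    · have : π.SameCycle ((d, 2), 1) ((faceNext σ d, 0), 0) :=
        hstep _ _ (by simp only [triFun, hk, if_true]; rfl)
      exact this.trans (kt _ hk).1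
  have hold : ∀ d d', D.endVertex d = D.endVertex d' →
      π.SameCycle ((flipEnd A d, 1), 1) ((flipEnd A d', 1), 1) := by
    intro d d' h
    refine SameCycle.of_setoid ((Equiv.Perm.SameCycle.setoid π).comap
      fun d => (((flipEnd A d, 1), 1) : ((A × Bool) × Fin 5) × Fin 3)) (fun d => ?_) ((hσ d d').2 h)
    have := hv (flipEnd A d)
    rwa [faceNext, Equiv.Perm.mul_apply, flipEnd_flipEnd] at this
  have hcentre : ∀ d d', faceOf σ d = faceOf σ d' →
      π.SameCycle ((d, 4), 2) ((d', 4), 2) := by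
    intro d d' h
    exact SameCycle.of_setoid ((Equiv.Perm.SameCycle.setoid π).comap
      fun d => (((d, 4), 2) : ((A × Bool) × Fin 5) × Fin 3))
      (fun d => ((z1 _).trans (z2 d)).symm) ((faceOf_eq_iff σ d d').2 h)
  -- every corner is on the orbit of a standard one
  have hred : ∀ x, ∃ d, π.SameCycle x ((d, 1), 1) ∨ π.SameCycle x ((d, 1), 0) ∨
      π.SameCycle x ((d, 1), 2) ∨ π.SameCycle x ((d, 4), 2) := by
    rintro ⟨⟨d, i⟩, j⟩
    fin_cases i <;> fin_cases j
    · cases hk : K d.1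
      · exact ⟨_, Or.inr (Or.inl (kf d hk).1)⟩
      · exact ⟨_, Or.inl (kt d hk).1⟩
    · cases hk : K d.1
      · exact ⟨_, Or.inr (Or.inl (kf d hk).2.1)⟩
      · exact ⟨_, Or.inl (kt d hk).2.1⟩
    · cases hk : K d.1
      · exact ⟨_, Or.inl (kf d hk).2.2⟩
      · exact ⟨_, Or.inr (Or.inl (kt d hk).2.2)⟩
    · exact ⟨d, Or.inr (Or.inl (.refl _ _))⟩
    · exact ⟨d, Or.inl (.refl _ _)⟩
    · exact ⟨d, Or.inr (Or.inr (Or.inl (.refl _ _)))⟩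
    · exact ⟨d, Or.inr (Or.inr (Or.inl ((y1 d).trans ((y2 d).trans (y3 d))).symm))⟩
    · exact ⟨d, Or.inl (v1 d).symm⟩
    · exact ⟨_, Or.inr (Or.inl (hx d))⟩
    · exact ⟨d, Or.inr (Or.inl (x3 d))⟩
    · exact ⟨d, Or.inr (Or.inr (Or.inl (y1 d).symm))⟩
    · exact ⟨d, Or.inr (Or.inr (Or.inr (z1 d).symm))⟩
    · exact ⟨d, Or.inr (Or.inr (Or.inl ((y1 d).trans (y2 d)).symm))⟩
    · exact ⟨_, Or.inr (Or.inl ((x2 d).trans (x3 _)))⟩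
    · exact ⟨d, Or.inr (Or.inr (Or.inr (.refl _ _)))⟩
  intro h
  obtain ⟨d, hd⟩ := hred x
  obtain ⟨e, he⟩ := hred y
  rcases hd with hd | hd | hd | hd <;> rcases he with he | he | he | he <;>
    rw [hinv hd, hinv he] at h <;> simp only [triVertex, TriVertex.old.injEq,
      TriVertex.x.injEq, TriVertex.y.injEq, TriVertex.centre.injEq, reduceCtorEq] at h
  · have := hold _ _ h
    rw [flipEnd_flipEnd, flipEnd_flipEnd] at this
    exact hd.trans (this.trans he.symm)
  · exact hd.trans (h ▸ he.symm)
  · exact hd.trans (h ▸ he.symm)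
  · exact hd.trans ((hcentre _ _ h).trans he.symm)

end triangulation

/-! ### Colouring connected plane digraphs -/

/-- A directed closed walk in the dual contains a directed cut. -/
theorem IsDualPair.containsDirectedCut_range [Finite V] [Finite A] [Finite F]
    {D : MultiDigraph V A} {D' : MultiDigraph F A} {σ : Equiv.Perm (A × Bool)}
    (h : IsDualPair D D' σ) {m : ℕ} (v : Fin (m + 1) → F) (e : Fin (m + 1) → A)
    (he : ∀ i, D'.src (e i) = v i ∧ D'.tgt (e i) = v (i + 1)) :
    D.ContainsDirectedCut (Set.range e) := by
  classical
  have := Fintype.ofFinite A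
  -- The number of times the walk uses `a`; along a closed walk every potential difference
  -- telescopes, so `g` is a circulation.
  let g : A → ℚ := fun a => ∑ i, if e i = a then 1 else 0
  have hg0 : ∀ a, 0 ≤ g a := fun a => Finset.sum_nonneg fun i _ => by split_ifs <;> norm_num
  have hgne : ∀ a, g a ≠ 0 → a ∈ Set.range e := by
    intro a ha
    obtain ⟨i, -, hi⟩ := Finset.exists_ne_zero_of_sum_ne_zero ha
    exact ⟨i, by_contra fun h' => hi (if_neg h')⟩
  obtain ⟨B, hB, hcut⟩ := h.exists_isDirectedCut g hg0 ⟨e 0, ne_of_gt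
    (Finset.sum_pos' (fun i _ => by split_ifs <;> norm_num) ⟨0, Finset.mem_univ _, by simp⟩)⟩ (by
      intro ρ
      simp only [g, Finset.sum_mul, ite_mul, one_mul, zero_mul]
      rw [Finset.sum_comm]
      simp only [Finset.sum_ite_eq, Finset.mem_univ, if_true, coboundary_apply, (he _).1, (he _).2,
        Finset.sum_sub_distrib]
      rw [sub_eq_zero]
      exact Equiv.sum_comp (Equiv.addRight (1 : Fin (m + 1))) (fun i => ρ (v i)))
  exact ⟨B, fun a ha => hgne a (hB ha), hcut⟩

/-! ### The cubic dual of the triangulation -/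

section triangulation

variable {D : MultiDigraph V A} {σ : Equiv.Perm (A × Bool)} {K : A → Bool}

instance [Finite V] [Finite A] [Finite F] : Finite (TriVertex V A F) :=
  Finite.of_equiv _ (triVertexEquiv V A F).symm

theorem triVertex_surjective [Nonempty A] (hD : D.IsConnected) :
    Function.Surjective (triVertex σ K D) := by
  rintro (v | d | d | f)
  · obtain ⟨d, rfl⟩ := exists_end_of_isConnected hD v
    exact ⟨((flipEnd A d, 1), 1), by simp only [triVertex, flipEnd_flipEnd]⟩
  · exact ⟨((d, 1), 0), rfl⟩
  · exact ⟨((d, 1), 2), rfl⟩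
  · obtain ⟨d, rfl⟩ := faceOf_surjective σ f
    exact ⟨((d, 4), 2), rfl⟩

theorem tri_euler [Finite V] [Finite A] (h : IsDualPair D (dual σ) σ) :
    Nat.card ((A × Bool) × Fin 5) + Nat.card (TriVertex V A
      (Quotient (Equiv.Perm.SameCycle.setoid (σ * flipEnd A)))) =
      Nat.card {δ // triTail (A := A) δ} + 2 := by
  have h1 := (tri_isReversal σ (fun _ => true)).card
  have h2 := h.euler
  have hb : Nat.card Bool = 2 := by simp
  have h3 : Nat.card (Fin 3) = 3 := by simp
  have h5 : Nat.card (Fin 5) = 5 := by simp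
  rw [Nat.card_congr (triVertexEquiv _ _ _), Nat.card_sum, Nat.card_sum, Nat.card_sum]
  simp only [Nat.card_prod, hb, h3, h5] at h1 ⊢
  -- With `v`, `f`, `a` the numbers for `D`, the count is `10a + (v + 4a + f) = 15a + 2`.
  omega

theorem tri_isDualPair [Finite V] [Finite A] [Nonempty A] (hσ : D.IsRotationSystem σ)
    (h : IsDualPair D (dual σ) σ) :
    IsDualPair (ofEnds (triPerm σ K) triTail Prod.fst)
      (ofEnds (triPerm σ K) triTail (triVertex σ K D))
      ((tri_isReversal σ K).ends.symm.permCongr (portRot _)) :=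
  (tri_isReversal σ K).isDualPair portRot_iff (triVertex_next K hσ)
    (triVertex_surjective h.connected) (tri_isConnected hσ h.connected) (tri_euler h)

theorem tri_isPlanar [Finite V] [Finite A] [Nonempty A] (hσ : D.IsRotationSystem σ)
    (h : IsDualPair D (dual σ) σ) :
    (ofEnds (triPerm σ K) triTail Prod.fst).IsPlanar :=
  (tri_isReversal σ K).isPlanar portRot_iff (triVertex_iff hσ)
    (triVertex_surjective h.connected) (fun w => ⟨(w, 0), rfl⟩) (tri_isConnected hσ h.connected)
    (tri_euler h)

theorem TriEdge.ne
    (hl : ∀ d, D.endVertex d ≠ D.endVertex (flipEnd A d)) {x : ((A × Bool) × Fin 5) × Fin 3}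
    {p q : TriVertex V A (Quotient (Equiv.Perm.SameCycle.setoid (σ * flipEnd A)))}
    (hx : TriEdge σ K D x p q) : p ≠ q := by
  cases hx <;> simp only [ne_eq, TriVertex.old.injEq, TriVertex.x.injEq, reduceCtorEq,
    not_false_eq_true]
  · exact hl _
  · exact fun h => by simpa [flipEnd] using congrArg Prod.snd h

/-- The triangulation is simple, so its dual is 3-edge-connected; that dual is cubic and has ten
vertices for each arc of `D`. -/
theorem tri_isVertexConnected [Finite V] [Finite A] [Nonempty A] (hσ : D.IsRotationSystem σ)
    (h : IsDualPair D (dual σ) σ) (hl : ∀ d, D.endVertex d ≠ D.endVertex (flipEnd A d))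
    (hK : ∀ d d' : A × Bool, K d.1 → K d'.1 → D.endVertex d = D.endVertex d' →
      D.endVertex (flipEnd A d) = D.endVertex (flipEnd A d') → d = d') :
    (ofEnds (triPerm σ K) triTail Prod.fst).IsVertexConnected 3 := by
  have hcard : 3 < Nat.card ((A × Bool) × Fin 5) := by
    have hb : Nat.card Bool = 2 := by simp
    have h5 : Nat.card (Fin 5) = 5 := by simp
    have : 0 < Nat.card A := Nat.card_pos
    rw [Nat.card_prod, Nat.card_prod, hb, h5]
    omega
  have hedge := triEdge_of_corner (K := K) hσ
  have hrev := tri_isReversal σ K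
  refine (isCubic_ofEnds_fst hrev).isVertexConnected
    ((tri_isDualPair hσ h).isEdgeConnected_of_simple (by omega)
      (fun a => (hedge a.1).ne hl) ?_) hcard
  rintro a b (⟨h1, h2⟩ | ⟨h1, h2⟩)
  · exact Subtype.ext ((hedge a.1).eq hσ hl hK (hedge b.1) h1.symm h2.symm)
  -- Ends in reversed order: the comparison is with the other end of `b`, which is a head end and
  -- cannot be the tail end of `a`.
  · have hb := hedge (triPerm σ K b.1)
    rw [hrev.invol] at hb
    have := (hedge a.1).eq hσ hl hK hb h2.symm h1.symm
    exact absurd (this ▸ a.2) (fun h' => (hrev.tail b.1).1 h' b.2)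

end triangulation

/-- Every arc of a digraph without antiparallel arcs can be replaced by the chosen one
among its parallels. -/
theorem exists_simple_representatives (D : MultiDigraph V A)
    (ha : ∀ a b, D.tgt a = D.src b → D.tgt b ≠ D.src a) :
    ∃ K : A → Bool, (∀ a, ∃ b, K b ∧ D.src b = D.src a ∧ D.tgt b = D.tgt a) ∧
      ∀ d d' : A × Bool, K d.1 → K d'.1 → D.endVertex d = D.endVertex d' →
        D.endVertex (flipEnd A d) = D.endVertex (flipEnd A d') → d = d' := by
  classical
  let s : A → V × V := fun a => (D.src a, D.tgt a)
  -- The choice depends only on the predicate `s b = s a`, so parallel arcs receive the same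
  -- representative.
  let r : A → A := fun a => Classical.choose (⟨a, rfl⟩ : ∃ b, s b = s a)
  have hr : ∀ a, s (r a) = s a := fun a => Classical.choose_spec (⟨a, rfl⟩ : ∃ b, s b = s a)
  have hrr : ∀ a b, s a = s b → r a = r b := by
    intro a b h
    have : (fun c => s c = s a) = fun c => s c = s b := by rw [h]
    simp only [r]
    congr 1
  refine ⟨fun a => decide (r a = a), fun a => ⟨r a, ?_, ?_⟩, ?_⟩
  · exact decide_eq_true (hrr _ _ (hr a))
  · exact ⟨congrArg Prod.fst (hr a), congrArg Prod.snd (hr a)⟩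
  · rintro ⟨a, i⟩ ⟨b, j⟩ h1 h2 h3 h4
    have h1 := of_decide_eq_true h1
    have h2 := of_decide_eq_true h2
    have key : D.src a = D.src b → D.tgt a = D.tgt b → a = b := fun h h' =>
      h1.symm.trans ((hrr a b (Prod.ext h h')).trans h2)
    cases i <;> cases j
    · rw [key h3 h4]
    · exact absurd h3.symm (ha a b h4)
    · exact absurd h4.symm (ha a b h3)
    · rw [key h4 h3]

/-- If 3-connected cubic planar digraphs have perfect matchings without directed cuts, then
connected planar oriented graphs have acyclic 2-colourings. -/
theorem exists_colouring_of_isConnected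
    (hyp : ∀ (V A : Type) [Finite V] [Finite A] (D : MultiDigraph V A),
        D.IsVertexConnected 3 → D.IsCubic → D.IsPlanar →
          ∃ M : Set A, D.IsPerfectMatching M ∧ ¬ D.ContainsDirectedCut M)
    {V A : Type} [Finite V] [Finite A] [Nonempty A] (D : MultiDigraph V A) (hD : D.IsConnected)
    (hp : D.IsPlanar) (ho : D.IsOriented) :
    ∃ X : Set V, D.IsAcyclicSet X ∧ D.IsAcyclicSet Xᶜ := by
  classical
  have := Fintype.ofFinite A
  rw [isOriented_iff_arcs] at ho
  obtain ⟨hl, ha⟩ := ho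
  obtain ⟨σ, hσ, hpair⟩ := hp.exists_isDualPair hD
  obtain ⟨K, hrep, hK⟩ := D.exists_simple_representatives (fun a b h h' => ha a b h h')
  have hrev := tri_isReversal σ K
  have hG := tri_isDualPair (K := K) hσ hpair
  have hl' : ∀ d, D.endVertex d ≠ D.endVertex (flipEnd A d) := by
    rintro ⟨a, _ | _⟩
    · exact hl a
    · exact (hl a).symm
  obtain ⟨M, hM, hcut⟩ := hyp _ _ _ (tri_isVertexConnected hσ hpair hl' hK)
    (isCubic_ofEnds_fst hrev) (tri_isPlanar hσ hpair)
  have := Fintype.ofFinite {δ // triTail (A := A) δ}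
  obtain ⟨E, rfl⟩ : ∃ E : Set {δ // triTail (A := A) δ}, M = Eᶜ := ⟨Mᶜ, (compl_compl M).symm⟩
  -- The complement `E` of the matching has all degrees two, so it is the set of colour changes of a
  -- 2-colouring `ρ` of the triangulation.
  obtain ⟨ρ, hρ⟩ := hG.exists_dual_potential (fun a => if a ∈ E then (1 : ZMod 2) else 0)
    (sum_indicator_mul_coboundary_eq_zero (ofEnds (triPerm σ K) triTail Prod.fst) E fun w => by
      have h1 := degreeIn_compl_add (ofEnds (triPerm σ K) triTail Prod.fst) E w
      rw [isCubic_ofEnds_fst hrev w, hM w] at h1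
      exact ⟨1, by omega⟩)
  choose r hrK hrs hrt using hrep
  let edge : A → {δ // triTail (A := A) δ} := fun a => ⟨(((r a, false), 0), 0), rfl⟩
  have hsrc : ∀ a, (ofEnds (triPerm σ K) triTail (triVertex σ K D)).src (edge a) =
      .old (D.src a) := fun a => by
    rw [← hrs]
    exact if_pos (hrK a)
  have htgt : ∀ a, (ofEnds (triPerm σ K) triTail (triVertex σ K D)).tgt (edge a) =
      .old (D.tgt a) := fun a => by
    rw [← hrt]
    exact if_pos (hrK a)
  -- A directed cycle of one colour uses only triangulation edges outside `E`, that is, in the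
  -- matching. As a directed closed walk it would put a directed cut into the matching.
  have hac : ∀ Z : Set V, (∀ u ∈ Z, ∀ v ∈ Z, ρ (.old u) = ρ (.old v)) → D.IsAcyclicSet Z := by
    rintro Z hZ _ ⟨m, rfl, v, e, -, he⟩
    refine hcut ?_
    obtain ⟨B, hB, hBcut⟩ := hG.containsDirectedCut_range (fun i => .old (v i).1)
      (fun i => edge (e i).1) (fun i => by
        rw [hsrc, htgt, ← (he i).1, ← (he i).2]
        exact ⟨rfl, rfl⟩)
    refine ⟨B, hB.trans ?_, hBcut⟩
    rintro _ ⟨i, rfl⟩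
    by_contra hi
    have := congrFun hρ (edge (e i).1)
    rw [coboundary_apply, hsrc, htgt, hZ _ (e i).2.2 _ (e i).2.1, sub_self] at this
    exact hi (by simpa using this)
  refine ⟨{v | ρ (.old v) = 0}, hac _ fun u hu v hv => hu.trans hv.symm, hac _ fun u hu v hv => ?_⟩
  have h2 : ∀ z : ZMod 2, z ≠ 0 → z = 1 := by decide
  exact (h2 _ hu).trans (h2 _ hv).symm

/-! ### Joining components by arcs -/

/-- Merging two classes of an equivalence relation lowers the number of classes by one. -/
theorem card_quotient_merge [Finite Δ] {s s' : Setoid Δ} {x₀ y₀ : Δ} (h : ¬ s x₀ y₀) (hle : s ≤ s')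
    (h₀ : s' x₀ y₀) (hmin : ∀ t : Setoid Δ, s ≤ t → t x₀ y₀ → s' ≤ t) :
    Nat.card (Quotient s') + 1 = Nat.card (Quotient s) := by
  classical
  -- `l` sends the class of `y₀` to that of `x₀`; by minimality, `s'` identifies nothing beyond this
  -- merge.
  let l : Δ → Quotient s := fun x => if s x y₀ then Quotient.mk s x₀ else Quotient.mk s x
  have hl : s' ≤ Setoid.ker l := by
    refine hmin _ (fun {x y} hxy => ?_) ?_
    · change l x = l y
      have : s x y₀ ↔ s y y₀ := ⟨fun h => s.trans (s.symm hxy) h, fun h => s.trans hxy h⟩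
      simp only [l, this]
      split_ifs
      · rfl
      · exact Quotient.sound hxy
    · change l x₀ = l y₀
      simp only [l, if_neg h, if_pos (s.refl y₀)]
  have hf : Function.Bijective (fun q : {q : Quotient s // q ≠ Quotient.mk s y₀} =>
      Quotient.map' (s₂ := s') id (fun _ _ h => hle h) q.1) := by
    constructor
    · rintro ⟨⟨x⟩, hx⟩ ⟨⟨y⟩, hy⟩ hxy
      have hx' : ¬ s x y₀ := fun h => hx (Quotient.sound h)
      have hy' : ¬ s y y₀ := fun h => hy (Quotient.sound h)
      have : l x = l y := hl (Quotient.exact hxy)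
      simp only [l, if_neg hx', if_neg hy'] at this
      exact Subtype.ext this
    · rintro ⟨x⟩
      by_cases hx : s x y₀
      · exact ⟨⟨Quotient.mk s x₀, fun h' => h (Quotient.exact h')⟩,
          Quotient.sound (s'.trans h₀ (s'.symm (hle hx)))⟩
      · exact ⟨⟨Quotient.mk s x, fun h' => hx (Quotient.exact h')⟩, rfl⟩
  rw [← Nat.card_eq_of_bijective _ hf, ← Finite.card_option,
    Nat.card_congr (Equiv.optionSubtypeNe _)]

section swap

variable [DecidableEq Δ] {π : Equiv.Perm Δ} {x₀ y₀ : Δ}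

theorem mul_swap_setoid_le (t : Setoid Δ) (h : ∀ x, t x (π x)) (h₀ : t x₀ y₀) {x y : Δ}
    (hxy : (π * Equiv.swap x₀ y₀).SameCycle x y) : t x y := by
  refine SameCycle.of_setoid t (fun z => ?_) hxy
  rw [Equiv.Perm.mul_apply]
  by_cases hx : z = x₀
  · rw [hx, Equiv.swap_apply_left]
    exact t.trans h₀ (h _)
  by_cases hy : z = y₀
  · rw [hy, Equiv.swap_apply_right]
    exact t.trans (t.symm h₀) (h _)
  · rw [Equiv.swap_apply_of_ne_of_ne hx hy]
    exact h z

variable [Finite Δ]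

/-- From `x₀` the new permutation jumps to `π y₀` and then follows the old cycle of `y₀`, which
avoids `x₀`, until it reaches `y₀`. -/
theorem sameCycle_mul_swap (h : ¬ π.SameCycle x₀ y₀) :
    (π * Equiv.swap x₀ y₀).SameCycle x₀ y₀ := by
  have key : ∀ k : ℕ, (π * Equiv.swap x₀ y₀).SameCycle x₀ ((π ^ (k + 1)) y₀) := by
    intro k
    induction k with
    | zero =>
      have := sameCycle_next (π * Equiv.swap x₀ y₀) x₀
      simpa using this
    | succ k ih =>
      rw [pow_succ', Equiv.Perm.mul_apply]
      by_cases hy : (π ^ (k + 1)) y₀ = y₀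
      · rw [hy]
        have := sameCycle_next (π * Equiv.swap x₀ y₀) x₀
        simpa using this
      · have hx : (π ^ (k + 1)) y₀ ≠ x₀ := fun hx =>
          h (Equiv.Perm.SameCycle.symm ⟨(k + 1 : ℕ), by rw [zpow_natCast, hx]⟩)
        refine ih.trans ?_
        have := sameCycle_next (π * Equiv.swap x₀ y₀) ((π ^ (k + 1)) y₀)
        rwa [Equiv.Perm.mul_apply, Equiv.swap_apply_of_ne_of_ne hx hy] at this
  have := key (orderOf π - 1)
  rwa [Nat.sub_add_cancel (orderOf_pos π), pow_orderOf_eq_one, Equiv.Perm.one_apply] at this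

theorem SameCycle.mul_swap (h : ¬ π.SameCycle x₀ y₀) {x y : Δ} (hxy : π.SameCycle x y) :
    (π * Equiv.swap x₀ y₀).SameCycle x y := by
  have h₀ := sameCycle_mul_swap h
  refine SameCycle.of_setoid (Equiv.Perm.SameCycle.setoid (π * Equiv.swap x₀ y₀)) (fun z => ?_) hxy
  change (π * Equiv.swap x₀ y₀).SameCycle z (π z)
  have hz := sameCycle_next (π * Equiv.swap x₀ y₀) (Equiv.swap x₀ y₀ z)
  rw [Equiv.Perm.mul_apply, Equiv.swap_apply_self] at hz
  refine Equiv.Perm.SameCycle.trans ?_ hz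
  by_cases hx : z = x₀
  · rw [hx, Equiv.swap_apply_left]
    exact h₀
  by_cases hy : z = y₀
  · rw [hy, Equiv.swap_apply_right]
    exact h₀.symm
  · rw [Equiv.swap_apply_of_ne_of_ne hx hy]

theorem card_sameCycle_mul_swap (h : ¬ π.SameCycle x₀ y₀) :
    Nat.card (Quotient (Equiv.Perm.SameCycle.setoid (π * Equiv.swap x₀ y₀))) + 1 =
      Nat.card (Quotient (Equiv.Perm.SameCycle.setoid π)) :=
  card_quotient_merge (s := Equiv.Perm.SameCycle.setoid π) h
    (fun {_ _} hxy => SameCycle.mul_swap h hxy)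
    (sameCycle_mul_swap h)
    (fun t ht h₀ _ _ hxy => mul_swap_setoid_le t (fun z => ht (sameCycle_next π z)) h₀ hxy)

end swap

/-- The digraph `D` with a new arc from `u` to `v`. -/
def addArc (D : MultiDigraph V A) (u v : V) : MultiDigraph V (Option A) where
  src a := a.elim u D.src
  tgt a := a.elim v D.tgt

theorem card_component_addArc [Finite V] {D : MultiDigraph V A} {u v : V}
    (h : ¬ D.componentSetoid u v) :
    Nat.card (Quotient (D.addArc u v).componentSetoid) + 1 =
      Nat.card (Quotient D.componentSetoid) := by
  refine card_quotient_merge h (Setoid.eqvGen_le ?_) ((D.addArc u v).component_src_tgt none) ?_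
  · rintro _ _ ⟨a, rfl, rfl⟩
    exact (D.addArc u v).component_src_tgt (some a)
  · intro t ht h₀
    refine Setoid.eqvGen_le ?_
    rintro _ _ ⟨_ | a, rfl, rfl⟩
    · exact h₀
    · exact ht (D.component_src_tgt a)

/-- An arc-end of the old digraph, in the digraph with a new arc. -/
def oldEnd (d : A × Bool) : Option A × Bool := (some d.1, d.2)

/-- The extension of a permutation of the arc-ends that fixes the ends of a new arc. -/
def extendEnds (σ : Equiv.Perm (A × Bool)) : Equiv.Perm (Option A × Bool) where
  toFun
    | (none, b) => (none, b)
    | (some a, b) => oldEnd (σ (a, b))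
  invFun
    | (none, b) => (none, b)
    | (some a, b) => oldEnd (σ.symm (a, b))
  left_inv := by rintro ⟨_ | a, b⟩ <;> simp [oldEnd]
  right_inv := by rintro ⟨_ | a, b⟩ <;> simp [oldEnd]

theorem sameCycle_extendEnds {σ : Equiv.Perm (A × Bool)} {d d' : A × Bool} (h : σ.SameCycle d d') :
    (extendEnds σ).SameCycle (oldEnd d) (oldEnd d') :=
  SameCycle.of_setoid ((Equiv.Perm.SameCycle.setoid (extendEnds σ)).comap oldEnd)
    (fun d => sameCycle_next (extendEnds σ) (oldEnd d)) h

/-- While both its ends are fixed, the new arc acts as a separate component with a single face. Its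
ends are attached afterwards by transpositions. -/
theorem card_face_extendEnds [Finite A] (σ : Equiv.Perm (A × Bool)) :
    faceCount (extendEnds σ) = faceCount σ + 1 := by
  let l : Option A × Bool → Option (Quotient (Equiv.Perm.SameCycle.setoid (σ * flipEnd A))) :=
    fun x => x.1.map fun a => faceOf σ (a, x.2)
  have hstep : ∀ x, l ((extendEnds σ * flipEnd (Option A)) x) = l x := by
    rintro ⟨_ | a, b⟩
    · rfl
    · exact congrArg some (faceOf_next σ (a, b))
  rw [faceCount, card_sameCycle_quotient (l := l), Finite.card_option]
  · rfl
  · refine fun x y => ⟨eq_of_sameCycle hstep, fun h => ?_⟩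
    obtain ⟨_ | a, i⟩ := x <;> obtain ⟨_ | b, j⟩ := y
    · have h1 : ∀ i, (extendEnds σ * flipEnd (Option A)).SameCycle
          ((none : Option A), i) (none, !i) :=
        fun i => sameCycle_next _ _
      cases i <;> cases j
      exacts [.refl _ _, h1 _, h1 _, .refl _ _]
    · cases h
    · cases h
    · exact SameCycle.of_setoid
        ((Equiv.Perm.SameCycle.setoid (extendEnds σ * flipEnd (Option A))).comap oldEnd)
        (fun d => sameCycle_next (extendEnds σ * flipEnd (Option A)) (oldEnd d))
        ((faceOf_eq_iff σ _ _).2 (Option.some.inj h))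
  · rintro (_ | f)
    · exact ⟨(none, false), rfl⟩
    · obtain ⟨⟨a, b⟩, rfl⟩ := faceOf_surjective σ f
      exact ⟨(some a, b), rfl⟩

/-- A transposition merging two rotations thus acts on face tracing as the transposition of the
opposite ends, so its effect on the face count can be read off. -/
theorem mul_swap_mul_flipEnd [DecidableEq A] (π : Equiv.Perm (A × Bool)) (x y : A × Bool) :
    π * Equiv.swap x y * flipEnd A =
      π * flipEnd A * Equiv.swap (flipEnd A x) (flipEnd A y) := by
  ext1 z
  rw [Equiv.Perm.mul_apply, Equiv.Perm.mul_apply, Equiv.Perm.mul_apply, Equiv.Perm.mul_apply,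
    (flipEnd A).injective.map_swap, flipEnd_flipEnd, flipEnd_flipEnd]

/-! ### Planarity and orientation after adding a bridge -/

section addArc

variable {D : MultiDigraph V A} {u v : V} {σ : Equiv.Perm (A × Bool)}

theorem addArc_endVertex_extendEnds (hσ : D.IsRotationSystem σ) (z : Option A × Bool) :
    (D.addArc u v).endVertex (extendEnds σ z) = (D.addArc u v).endVertex z := by
  obtain ⟨_ | a, b⟩ := z
  · rfl
  · exact hσ.endVertex (a, b)

theorem not_sameCycle_extendEnds (d : A × Bool) (b : Bool) :
    ¬ (extendEnds σ).SameCycle (oldEnd d) (none, b) := by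
  intro h
  have := eq_of_sameCycle (l := fun z : Option A × Bool => z.1.isSome)
    (by rintro ⟨_ | a, b⟩ <;> rfl) h
  cases this

theorem not_sameCycle_face_extendEnds (d : A × Bool) (b : Bool) :
    ¬ (extendEnds σ * flipEnd (Option A)).SameCycle (oldEnd d) (none, b) := by
  intro h
  have := eq_of_sameCycle (l := fun z : Option A × Bool => z.1.isSome)
    (by rintro ⟨_ | a, b⟩ <;> rfl) h
  cases this

/-- Attaching the two ends of the new arc merges two faces each time. Including the face of the free
arc, the number of faces drops by one, while arcs increase by one and components decrease by one. -/
theorem isPlanar_addArc_of_end [Finite V] [Finite A] (hσ : D.IsRotationSystem σ)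
    (hc : Nat.card V + (faceCount σ + {v | ∀ a, D.src a ≠ v ∧ D.tgt a ≠ v}.ncard) =
      Nat.card A + 2 * Nat.card (Quotient D.componentSetoid))
    {d e : A × Bool} (h : ¬ D.componentSetoid (D.endVertex d) (D.endVertex e)) :
    (D.addArc (D.endVertex d) (D.endVertex e)).IsPlanar := by
  classical
  set D' := D.addArc (D.endVertex d) (D.endVertex e)
  have h1 := not_sameCycle_extendEnds (σ := σ) d false
  have h2 : ¬ (extendEnds σ * Equiv.swap (oldEnd d) (none, false)).SameCycle (oldEnd e)
      (none, true) := by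
    intro h'
    have := mul_swap_setoid_le (Setoid.ker fun z : Option A × Bool => decide (z = (none, true)))
      (by rintro ⟨_ | a, b⟩ <;> rfl) (by rfl) h'
    simp [oldEnd] at this
  have f1 := not_sameCycle_face_extendEnds (σ := σ) (flipEnd A d) true
  have f2 : ¬ (extendEnds σ * flipEnd (Option A) *
      Equiv.swap (oldEnd (flipEnd A d)) (none, true)).SameCycle (oldEnd (flipEnd A e))
      (none, false) := by
    intro h'
    have hcomp : ∀ d : A × Bool, Quotient.mk D.componentSetoid (D.endVertex d) =
        Quotient.mk D.componentSetoid (D.src d.1) := by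
      rintro ⟨a, _ | _⟩
      · rfl
      · exact (Quotient.sound (D.component_src_tgt a)).symm
    -- The component of `D` is invariant along faces if the new arc is assigned to the component of
    -- `d`; hence the face at `e` is still separate after the first merge.
    have := mul_swap_setoid_le (Setoid.ker fun z : Option A × Bool =>
      Quotient.mk D.componentSetoid (z.1.elim (D.endVertex d) D.src)) (by
        rintro ⟨_ | a, b⟩
        · rfl
        · change Quotient.mk D.componentSetoid (D.src a) =
            Quotient.mk D.componentSetoid (D.src (σ (flipEnd A (a, b))).1)
          rw [← hcomp, hσ.endVertex, hcomp]
          rfl) (hcomp d).symm h'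
    exact h (Quotient.exact ((hcomp e).trans this)).symm
  refine ⟨extendEnds σ * Equiv.swap (oldEnd d) (none, false) *
    Equiv.swap (oldEnd e) (none, true), fun x y => ⟨?_, ?_⟩, ?_⟩
  · refine mul_swap_setoid_le (Setoid.ker D'.endVertex) (fun z => mul_swap_setoid_le _
      (fun z => (addArc_endVertex_extendEnds hσ z).symm) ?_ (sameCycle_next _ z)) ?_
    · rfl
    · rfl
  · have hz : ∀ z, ∃ d', D.endVertex d' = D'.endVertex z ∧
        (extendEnds σ * Equiv.swap (oldEnd d) (none, false) *
          Equiv.swap (oldEnd e) (none, true)).SameCycle (oldEnd d') z := by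
      rintro ⟨_ | a, _ | _⟩
      · exact ⟨d, rfl, SameCycle.mul_swap h2 (sameCycle_mul_swap h1)⟩
      · exact ⟨e, rfl, sameCycle_mul_swap h2⟩
      · exact ⟨(a, false), rfl, .refl _ _⟩
      · exact ⟨(a, true), rfl, .refl _ _⟩
    intro hxy
    obtain ⟨x', hx, hx'⟩ := hz x
    obtain ⟨y', hy, hy'⟩ := hz y
    exact hx'.symm.trans ((SameCycle.mul_swap h2 (SameCycle.mul_swap h1
      (sameCycle_extendEnds ((hσ x' y').2 (hx.trans (hxy.trans hy.symm)))))).trans hy')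
  · have hcomp : Nat.card (Quotient D'.componentSetoid) + 1 = _ := card_component_addArc h
    have hface := card_face_extendEnds σ
    have c1 := card_sameCycle_mul_swap f1
    have c2 := card_sameCycle_mul_swap f2
    have hiso : {v | ∀ a, D'.src a ≠ v ∧ D'.tgt a ≠ v} = {v | ∀ a, D.src a ≠ v ∧ D.tgt a ≠ v} := by
      ext w
      refine ⟨fun hw a => hw (some a), fun hw a => ?_⟩
      have hw' : ∀ d, D.endVertex d ≠ w := by
        rintro ⟨a, _ | _⟩
        exacts [(hw a).1, (hw a).2]
      obtain _ | a := a
      exacts [⟨hw' d, hw' e⟩, hw a]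
    rw [faceCount, mul_swap_mul_flipEnd, mul_swap_mul_flipEnd, hiso, Finite.card_option]
    rw [faceCount] at hface
    change Nat.card (Quotient (Equiv.Perm.SameCycle.setoid (extendEnds σ * flipEnd (Option A) *
      Equiv.swap (oldEnd (flipEnd A d)) (none, true) *
      Equiv.swap (oldEnd (flipEnd A e)) (none, false)))) + 1 = _ at c2
    change _ + (Nat.card (Quotient (Equiv.Perm.SameCycle.setoid
      (extendEnds σ * flipEnd (Option A) * Equiv.swap (oldEnd (flipEnd A d)) (none, true) *
      Equiv.swap (oldEnd (flipEnd A e)) (none, false)))) + _) = _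
    omega

/-- The end at `u` stays fixed, since it is the only arc-end there. One merge keeps the number of
faces, and the loss of the isolated vertex `u` balances Euler's formula. -/
theorem isPlanar_addArc_of_isolated [Finite V] [Finite A] (hσ : D.IsRotationSystem σ)
    (hc : Nat.card V + (faceCount σ + {v | ∀ a, D.src a ≠ v ∧ D.tgt a ≠ v}.ncard) =
      Nat.card A + 2 * Nat.card (Quotient D.componentSetoid))
    {e : A × Bool} (hu : ∀ d, D.endVertex d ≠ u) (h : ¬ D.componentSetoid u (D.endVertex e)) :
    (D.addArc u (D.endVertex e)).IsPlanar := by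
  classical
  set D' := D.addArc u (D.endVertex e)
  have h1 := not_sameCycle_extendEnds (σ := σ) e true
  have f1 := not_sameCycle_face_extendEnds (σ := σ) (flipEnd A e) false
  refine ⟨extendEnds σ * Equiv.swap (oldEnd e) (none, true), fun x y => ⟨?_, ?_⟩, ?_⟩
  · exact mul_swap_setoid_le (Setoid.ker D'.endVertex)
      (fun z => (addArc_endVertex_extendEnds hσ z).symm)
      (x₀ := oldEnd e) (y₀ := (none, true)) rfl
  · have hz : ∀ z, z = (none, false) ∧ D'.endVertex z = u ∨ ∃ d', D.endVertex d' = D'.endVertex z ∧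
        (extendEnds σ * Equiv.swap (oldEnd e) (none, true)).SameCycle (oldEnd d') z := by
      rintro ⟨_ | a, _ | _⟩
      · exact Or.inl ⟨rfl, rfl⟩
      · exact Or.inr ⟨e, rfl, sameCycle_mul_swap h1⟩
      · exact Or.inr ⟨(a, false), rfl, .refl _ _⟩
      · exact Or.inr ⟨(a, true), rfl, .refl _ _⟩
    intro hxy
    rcases hz x with ⟨rfl, hx⟩ | ⟨x', hx, hx'⟩ <;> rcases hz y with ⟨rfl, hy⟩ | ⟨y', hy, hy'⟩
    · exact .refl _ _
    · exact absurd (hy.trans (hxy.symm.trans hx)) (hu y')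
    · exact absurd (hx.trans (hxy.trans hy)) (hu x')
    · exact hx'.symm.trans ((SameCycle.mul_swap h1
        (sameCycle_extendEnds ((hσ x' y').2 (hx.trans (hxy.trans hy.symm))))).trans hy')
  · have hcomp : Nat.card (Quotient D'.componentSetoid) + 1 = _ := card_component_addArc h
    have hface := card_face_extendEnds σ
    have c1 := card_sameCycle_mul_swap f1
    have hiso : {v | ∀ a, D.src a ≠ v ∧ D.tgt a ≠ v} =
        insert u {v | ∀ a, D'.src a ≠ v ∧ D'.tgt a ≠ v} := by
      ext w
      constructor
      · intro hw
        by_cases hwu : w = u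
        · exact Or.inl hwu
        · refine Or.inr fun a => ?_
          obtain _ | a := a
          · refine ⟨fun h' => hwu h'.symm, ?_⟩
            obtain ⟨a, _ | _⟩ := e
            exacts [(hw a).1, (hw a).2]
          · exact hw a
      · rintro (rfl | hw)
        · exact fun a => ⟨hu (a, false), hu (a, true)⟩
        · exact fun a => hw (some a)
    have hnot : u ∉ {v | ∀ a, D'.src a ≠ v ∧ D'.tgt a ≠ v} := fun h' => (h' none).1 rfl
    rw [hiso, Set.ncard_insert_of_notMem hnot] at hc
    rw [faceCount, mul_swap_mul_flipEnd, Finite.card_option]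
    rw [faceCount] at hface
    change _ + (Nat.card (Quotient (Equiv.Perm.SameCycle.setoid
      (extendEnds σ * flipEnd (Option A) * Equiv.swap (oldEnd (flipEnd A e)) (none, false)))) +
      _) = _
    omega

theorem IsPlanar.addArc [Finite V] [Finite A] (hp : D.IsPlanar) (e : A × Bool)
    (h : ¬ D.componentSetoid u (D.endVertex e)) : (D.addArc u (D.endVertex e)).IsPlanar := by
  obtain ⟨σ, hσ, hc⟩ := hp
  by_cases hu : ∃ d, D.endVertex d = u
  · obtain ⟨d, rfl⟩ := hu
    exact isPlanar_addArc_of_end hσ hc h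
  · exact isPlanar_addArc_of_isolated hσ hc (fun d hd => hu ⟨d, hd⟩) h

/-- The new arc is a bridge, so it lies on no directed cycle. -/
theorem IsOriented.addArc (ho : D.IsOriented) (h : ¬ D.componentSetoid u v) :
    (D.addArc u v).IsOriented := by
  rw [isOriented_iff_arcs] at ho ⊢
  have hne : u ≠ v := fun h' => h (h' ▸ D.componentSetoid.refl u)
  have hno : ∀ b, D.src b = v → D.tgt b = u → False := fun b h1 h2 =>
    h (h1 ▸ h2 ▸ D.componentSetoid.symm (D.component_src_tgt b))
  refine ⟨?_, ?_⟩
  · rintro (_ | a)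
    exacts [hne, ho.1 a]
  · rintro (_ | a) (_ | b) h1 h2
    · exact hne h1.symm
    · exact hno b h1.symm h2
    · exact hno a h2.symm h1
    · exact ho.2 a b h1 h2

theorem IsAcyclicSet.of_addArc {X : Set V} (h : (D.addArc u v).IsAcyclicSet X) :
    D.IsAcyclicSet X := by
  rintro n ⟨m, rfl, w, e, hw, he⟩
  exact h _ ⟨m, rfl, w, fun i => ⟨some (e i).1, (e i).2⟩, hw, fun i =>
    ⟨Subtype.ext (congrArg Subtype.val (he i).1), Subtype.ext (congrArg Subtype.val (he i).2)⟩⟩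

end addArc

/-- If 3-connected cubic planar digraphs have perfect matchings without directed cuts, then
planar oriented graphs have acyclic 2-colourings. -/
theorem exists_colouring
    (hyp : ∀ (V A : Type) [Finite V] [Finite A] (D : MultiDigraph V A),
        D.IsVertexConnected 3 → D.IsCubic → D.IsPlanar →
          ∃ M : Set A, D.IsPerfectMatching M ∧ ¬ D.ContainsDirectedCut M)
    {V A : Type} [Finite V] [Finite A] (D : MultiDigraph V A) (hp : D.IsPlanar)
    (ho : D.IsOriented) :
    ∃ X : Set V, D.IsAcyclicSet X ∧ D.IsAcyclicSet Xᶜ := by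
  obtain hA | ⟨⟨a⟩⟩ := isEmpty_or_nonempty A
  · have h : ∀ X, D.IsAcyclicSet X := by
      rintro X _ ⟨m, -, -, e, -⟩
      exact hA.elim (e 0).1
    exact ⟨∅, h _, h _⟩
  obtain ⟨n, hn⟩ : ∃ n, Nat.card (Quotient D.componentSetoid) = n := ⟨_, rfl⟩
  -- Induction on the number of components. The arc type must vary, since each step adds an arc.
  -- Joining always to the component of `a` avoids an arc between two isolated vertices.
  induction n generalizing A with
  | zero =>
    have : Nonempty (Quotient D.componentSetoid) := ⟨Quotient.mk _ (D.src a)⟩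
    exact absurd hn Nat.card_pos.ne'
  | succ n ih =>
    by_cases hcon : D.IsConnected
    · have : Nonempty A := ⟨a⟩
      exact exists_colouring_of_isConnected hyp D hcon hp ho
    · obtain ⟨u, hu⟩ : ∃ u, ¬ D.componentSetoid u (D.src a) := by
        by_contra! h
        exact hcon ⟨⟨D.src a⟩, fun u v =>
          D.componentSetoid.trans (h u) (D.componentSetoid.symm (h v))⟩
      have hcard := card_component_addArc hu
      obtain ⟨X, hX, hX'⟩ := ih (D.addArc u (D.src a)) (hp.addArc (a, false) hu) (ho.addArc hu)
        none (by omega)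
      exact ⟨X, hX.of_addArc, hX'.of_addArc⟩

end MultiDigraph

/-- (1) "Every planar oriented graph can be vertex-partitioned into two acyclic sets" is equivalent
to "every 3-connected cubic planar digraph has a perfect matching containing no directed cut".
(2) "Every 3-edge-connected digraph has an even subgraph whose contraction is strongly connected"
is equivalent to "every 3-edge-connected cubic digraph has a perfect matching containing no
directed cut". All digraphs are finite, with loops and parallel arcs allowed. -/
theorem mainTheorem1 :
    ((∀ (V A : Type) [Finite V] [Finite A] (D : MultiDigraph V A),
        D.IsPlanar → D.IsOriented →
          ∃ X Y : Set V, X ∪ Y = Set.univ ∧ Disjoint X Y ∧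
            D.IsAcyclicSet X ∧ D.IsAcyclicSet Y) ↔
      (∀ (V A : Type) [Finite V] [Finite A] (D : MultiDigraph V A),
        D.IsVertexConnected 3 → D.IsCubic → D.IsPlanar →
          ∃ M : Set A, D.IsPerfectMatching M ∧ ¬ D.ContainsDirectedCut M)) ∧
    ((∀ (V A : Type) [Finite V] [Finite A] (D : MultiDigraph V A),
        D.IsEdgeConnected 3 →
          ∃ E : Set A, D.IsEvenSubgraph E ∧ (D.contract E).IsStronglyConnected) ↔
      (∀ (V A : Type) [Finite V] [Finite A] (D : MultiDigraph V A),
        D.IsEdgeConnected 3 → D.IsCubic →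
          ∃ M : Set A, D.IsPerfectMatching M ∧ ¬ D.ContainsDirectedCut M)) := by
  refine ⟨⟨fun h V A _ _ D hD h3 hp =>
      MultiDigraph.exists_perfectMatching_of_colouring h D hD h3 hp,
    fun h V A _ _ D hp ho => ?_⟩, MultiDigraph.hochstaettler_iff⟩
  obtain ⟨X, hX, hX'⟩ := MultiDigraph.exists_colouring h D hp ho
  exact ⟨X, Xᶜ, Set.union_compl_self X, disjoint_compl_right, hX, hX'⟩
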